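/- Let $p\in(2,3)$, $d,k\in\mathbb N$, and for $T>0$ let $\Delta_T=\{(s,t):0\le s\le t\le T\}$. For a path $Y$ put $Y_{s,t}=Y_t-Y_s$, and $\|Y\|_{p,[s,t]}=\big(\sup_{\mathcal P}\sum_{[u,v]\in\mathcal P}|Y_{u,v}|^p\big)^{1/p}$, the supremum being over partitions of $[s,t]$; for a function $A$ on $\Delta_T$ put $\|A\|_{p/2,[s,t]}=\big(\sup_{\mathcal P}\sum_{[u,v]\in\mathcal P}|A_{u,v}|^{p/2}\big)^{2/p}$; and $\|Y\|_{p,[s,t)}=\sup_{s\le u<t}\|Y\|_{p,[s,u]}$. Let $D^p$ be the càdlàg paths on $[0,T]$ with $\|Y\|_{p,[0,T]}<\infty$, and $D_2^{p/2}$ the functions on $\Delta_T$ that are càdlàg in each variable separately with $\|A\|_{p/2,[0,T]}<\infty$. A càdlàg $p$-rough path over $\mathbb R^d$ is a pair $\mathbf X=(X,\mathbb X)$ with $X\in D^p$ being $\mathbb R^d$-valued, $\mathbb X\in D_2^{p/2}$ being $\mathbb R^{d\times d}$-valued, and $\mathbb X_{s,t}=\mathbb X_{s,u}+\mathbb X_{u,t}+X_{s,u}\otimes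 X_{u,t}$ for $0\le s\le u\le t\le T$. Put $\|\mathbf X\|_p=\|X\|_{p,[0,T]}+\|\mathbb X\|_{p/2,[0,T]}$. A controlled path $(Y,Y')\in\mathcal V^p_X(E)$ is a pair of an $E$-valued $Y\in D^p$ and an $\mathcal L(\mathbb R^d;E)$-valued $Y'\in D^p$ such that $R^Y_{s,t}:=Y_{s,t}-Y'_sX_{s,t}$ lies in $D_2^{p/2}$. Put $$\|Y,Y'\|_{X,p,[s,t]}=|Y'_s|+\|Y'\|_{p,[s,t]}+\|R^Y\|_{p/2,[s,t]},$$ $$\|Y,Y';\tilde Y,\tilde Y'\|_{X,p,[s,t]}=|Y'_s-\tilde Y'_s|+\|Y'-\tilde Y'\|_{p,[s,t]}+\|R^Y-R^{\tilde Y}\|_{p/2,[s,t]},$$ and $\|Y,Y'\|_{X,p}=\|Y,Y'\|_{X,p,[0,T]}$. For $(V,V')\in\mathcal V^p_X(\mathcal L(\mathbb R^d;\mathbb R^k))$, the rough integral is $$\int_0^tV_r\,d\mathbf X_r=\lim_{|\mathcal P|\to0}\sum_{[u,v]\in\mathcal P}\big(V_uX_{u,v}+V'_u\mathbb X_{u,v}\big),$$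 the limit being over partitions $\mathcal P$ of $[0,t]$ with mesh tending to $0$, where $V'_u$ acts on $\mathbb R^d\otimes\mathbb R^d$ by $V'_u(x\otimes z)=V'_u(x)z$. Let $\mathbf X$ be a càdlàg $p$-rough path, $(y,y')\in\mathcal V^p_X(\mathbb R^k)$, and let $(F,F'):\mathcal V^p_X(\mathbb R^k)\to\mathcal V^p_X(\mathcal L(\mathbb R^d;\mathbb R^k))$, $(Y,Y')\mapsto(F(Y),F'(Y,Y'))$, be non-anticipative: for every $t\in[0,T]$, $F_t(Y)$ depends only on $Y|_{[0,t]}$ and $F'_t(Y,Y')$ only on $(Y,Y')|_{[0,t]}$. Suppose that there is a constant $C_F>0$, and for every $K>0$ a constant $C_{F,K,X}>0$, such that for all $(Y,Y'),(\tilde Y,\tilde Y')\in\mathcal V^p_X(\mathbb R^k)$ and all $0\le s<t\le T$: (i) (growth) $$|F_t(Y)|\le C_F,\qquad |F_t(Y)-F_{t-}(Y)|\le C_F\big(1+\|Y\|_{p,[s,t)}+|Y_t-Y_{t-}|\big),$$ $$\|F(Y)\|_{p,[s,t]}\le C_F\big(1+(|Y'_s|+\|Y'\|_{p,[s,t]})\|X\|_{p,[s,t]}+\|R^Y\|_{p/2,[s,t]}\big),$$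 $$\|F(Y),F'(Y,Y')\|_{X,p,[s,t]}\le C_F\big(1+\|Y,Y'\|_{X,p,[s,t]}\big)^2\big(1+\|X\|_{p,[s,t]}\big)^2;$$ (ii) (Lipschitz) if $\|Y,Y'\|_{X,p,[s,t]}\le K$ and $\|\tilde Y,\tilde Y'\|_{X,p,[s,t]}\le K$, then $$\|F(Y)-F(\tilde Y)\|_{p,[s,t]}\le C_{F,K,X}\big(|Y_s-\tilde Y_s|+\|Y-\tilde Y\|_{p,[s,t]}\big),$$ $$\|F(Y),F'(Y,Y');F(\tilde Y),F'(\tilde Y,\tilde Y')\|_{X,p,[s,t]}\le C_{F,K,X}\big(|Y_s-\tilde Y_s|+\|Y,Y';\tilde Y,\tilde Y'\|_{X,p,[s,t]}\big).$$ Then there exists a unique controlled path $(Y,Y')\in\mathcal V^p_X(\mathbb R^k)$ with $Y'=y'+F(Y)$ and $$Y_t=y_t+\int_0^tF_s(Y)\,d\mathbf X_s,\qquad t\in[0,T].$$ Moreover, there exists a componentwise non-decreasing function $K_p:[0,\infty)^3\to[0,\infty)$, depending only on $p$ and the dimensions $d,k$, such that always $$\|Y,Y'\|_{X,p}\le K_p\big(\|y,y'\|_{X,p},\,C_F,\,\|\mathbf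 X\|_p\big).$$ -/

import Mathlib

open Set Filter Topology

noncomputable section

namespace RoughFDE

/-- The Euclidean space `ℝ^d`. -/
abbrev Vec (d : ℕ) : Type := EuclideanSpace ℝ (Fin d)

/-- The space `ℝ^{d×d}` of matrices, with the Euclidean (Frobenius) norm. -/
abbrev Mat (d : ℕ) : Type := EuclideanSpace ℝ (Fin d × Fin d)

/-- A finite partition `s = pt 0 < pt 1 < ⋯ < pt n = t` of the interval `[s, t]`
(the values `pt i` with `i > n` are irrelevant). -/
structure IntervalPartition (s t : ℝ) where
  n : ℕ
  pt : ℕ → ℝ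
  pt_zero : pt 0 = s
  pt_n : pt n = t
  pt_lt : ∀ i < n, pt i < pt (i + 1)

/-- The mesh `|P|`, the length of the longest interval of the partition. -/
def IntervalPartition.mesh {s t : ℝ} (P : IntervalPartition s t) : NNReal :=
  (Finset.range P.n).sup fun i => (P.pt (i + 1) - P.pt i).toNNReal

section Paths

variable {E : Type*} [NormedAddCommGroup E]

/-- `f` is càdlàg on `[a, b]`. -/
def CadlagOn (f : ℝ → E) (a b : ℝ) : Prop :=
  (∀ t ∈ Ico a b, ContinuousWithinAt f (Ioi t) t) ∧
    ∀ t ∈ Ioc a b, ∃ l : E, Tendsto f (𝓝[<] t) (𝓝 l)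

/-- The increments `(s, t) ↦ Y t - Y s` of a path. -/
def incr (Y : ℝ → E) : ℝ → ℝ → E := fun s t => Y t - Y s

/-- The jump `Y t - Y (t-)`. -/
def jump (Y : ℝ → E) (t : ℝ) : E := Y t - Function.leftLim Y t

/-- The `q`-variation, possibly infinite, of a two-parameter function over `[s, t]`. -/
def eVar (q : ℝ) (A : ℝ → ℝ → E) (s t : ℝ) : ENNReal :=
  (⨆ P : IntervalPartition s t,
    ∑ i ∈ Finset.range P.n, ‖A (P.pt i) (P.pt (i + 1))‖ₑ ^ q) ^ (1 / q)

/-- The `q`-variation over `[s, t]` as a real number (used where it is finite). -/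
def var (q : ℝ) (A : ℝ → ℝ → E) (s t : ℝ) : ℝ := (eVar q A s t).toReal

/-- The `q`-variation over the half-open interval `[s, t)`: the supremum over `[s, u]`, `u < t`. -/
def varIco (q : ℝ) (A : ℝ → ℝ → E) (s t : ℝ) : ℝ := (⨆ u ∈ Ico s t, eVar q A s u).toReal

/-- Càdlàg paths on `[0, T]` of finite `q`-variation. -/
structure MemD (q T : ℝ) (Y : ℝ → E) : Prop where
  cadlag : CadlagOn Y 0 T
  finite : eVar q (incr Y) 0 T < ⊤

/-- Functions on the simplex `0 ≤ s ≤ t ≤ T` that are càdlàg in each variable and have finite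
`q`-variation. -/
structure MemD₂ (q T : ℝ) (A : ℝ → ℝ → E) : Prop where
  cadlag_left : ∀ t ∈ Icc 0 T, CadlagOn (fun s => A s t) 0 t
  cadlag_right : ∀ s ∈ Icc 0 T, CadlagOn (fun t => A s t) s T
  finite : eVar q A 0 T < ⊤

end Paths

/-- `(X, XX)` is a càdlàg `p`-rough path over `ℝ^d` on `[0, T]`. -/
structure IsRoughPath {d : ℕ} (p T : ℝ) (X : ℝ → Vec d) (XX : ℝ → ℝ → Mat d) : Prop where
  path : MemD p T X
  area : MemD₂ (p / 2) T XX
  chen : ∀ s u t : ℝ, 0 ≤ s → s ≤ u → u ≤ t → t ≤ T → ∀ i j : Fin d,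
    XX s t (i, j) = XX s u (i, j) + XX u t (i, j) + incr X s u i * incr X u t j

/-- The seminorm of a rough path over `[s, t]`. -/
def roughNorm {d : ℕ} (p : ℝ) (X : ℝ → Vec d) (XX : ℝ → ℝ → Mat d) (s t : ℝ) : ℝ :=
  var p (incr X) s t + var (p / 2) XX s t

section Controlled

variable {d : ℕ} {E : Type*} [NormedAddCommGroup E] [NormedSpace ℝ E]

/-- The remainder `R^Y_{s,t} = Y_{s,t} - Y'_s X_{s,t}`. -/
def remainder (X : ℝ → Vec d) (Y : ℝ → E) (Y' : ℝ → Vec d →L[ℝ] E) : ℝ → ℝ → E :=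
  fun s t => incr Y s t - Y' s (incr X s t)

/-- `(Y, Y')` is an `E`-valued controlled path on `[0, T]` with respect to `X`. -/
structure IsControlled (p T : ℝ) (X : ℝ → Vec d) (Y : ℝ → E) (Y' : ℝ → Vec d →L[ℝ] E) :
    Prop where
  path : MemD p T Y
  deriv : MemD p T Y'
  remainder : MemD₂ (p / 2) T (remainder X Y Y')

/-- The seminorm `‖Y, Y'‖_{X,p,[s,t]}`. -/
def ctrlNorm (p : ℝ) (X : ℝ → Vec d) (Y : ℝ → E) (Y' : ℝ → Vec d →L[ℝ] E) (s t : ℝ) : ℝ :=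
  ‖Y' s‖ + var p (incr Y') s t + var (p / 2) (remainder X Y Y') s t

/-- The distance `‖Y, Y'; Z, Z'‖_{X,p,[s,t]}`. -/
def ctrlDist (p : ℝ) (X : ℝ → Vec d) (Y : ℝ → E) (Y' : ℝ → Vec d →L[ℝ] E)
    (Z : ℝ → E) (Z' : ℝ → Vec d →L[ℝ] E) (s t : ℝ) : ℝ :=
  ‖Y' s - Z' s‖ + var p (incr (Y' - Z')) s t
    + var (p / 2) (remainder X Y Y' - remainder X Z Z') s t

/-- The natural pairing of `L(ℝ^d; L(ℝ^d; E))` with `ℝ^d ⊗ ℝ^d = ℝ^{d×d}`,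
sending `(A, x ⊗ z)` to `A x z`. -/
def pairing (A : Vec d →L[ℝ] Vec d →L[ℝ] E) (M : Mat d) : E :=
  ∑ i, ∑ j, M (i, j) • A (EuclideanSpace.single i 1) (EuclideanSpace.single j 1)

/-- The compensated Riemann sum `∑ (V_u X_{u,v} + V'_u XX_{u,v})` over a partition. -/
def roughSum (X : ℝ → Vec d) (XX : ℝ → ℝ → Mat d) (V : ℝ → Vec d →L[ℝ] E)
    (V' : ℝ → Vec d →L[ℝ] Vec d →L[ℝ] E) {s t : ℝ} (P : IntervalPartition s t) : E :=
  ∑ i ∈ Finset.range P.n, (V (P.pt i) (incr X (P.pt i) (P.pt (i + 1)))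
    + pairing (V' (P.pt i)) (XX (P.pt i) (P.pt (i + 1))))

/-- The rough integral of `(V, V')` against `(X, XX)` over `[s, t]` exists, as the limit of the
compensated Riemann sums when the mesh tends to zero, and is equal to `I`. -/
def HasRoughIntegral (X : ℝ → Vec d) (XX : ℝ → ℝ → Mat d) (V : ℝ → Vec d →L[ℝ] E)
    (V' : ℝ → Vec d →L[ℝ] Vec d →L[ℝ] E) (s t : ℝ) (I : E) : Prop :=
  Tendsto (fun P : IntervalPartition s t => roughSum X XX V V' P)
    (comap IntervalPartition.mesh (𝓝 0)) (𝓝 I)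

end Controlled

section Functional

variable {d k : ℕ} (p T : ℝ) (X : ℝ → Vec d)
  (F : (ℝ → Vec k) → ℝ → Vec d →L[ℝ] Vec k)
  (F' : (ℝ → Vec k) → (ℝ → Vec d →L[ℝ] Vec k) → ℝ → Vec d →L[ℝ] Vec d →L[ℝ] Vec k)

/-- `(F, F')` maps controlled paths to controlled paths and is non-anticipative: `F_t(Y)` depends
only on `Y` on `[0, t]`, and `F'_t(Y, Y')` depends only on `(Y, Y')` on `[0, t]`. Only the values
of `F` and `F'` at controlled paths matter. -/
structure IsNonAnticipative : Prop where
  maps : ∀ Y Y', IsControlled p T X Y Y' → IsControlled p T X (F Y) (F' Y Y')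
  fst : ∀ Y Y' Z Z', IsControlled p T X Y Y' → IsControlled p T X Z Z' →
    ∀ t ∈ Icc 0 T, EqOn Y Z (Icc 0 t) → F Y t = F Z t
  snd : ∀ Y Y' Z Z', IsControlled p T X Y Y' → IsControlled p T X Z Z' →
    ∀ t ∈ Icc 0 T, EqOn Y Z (Icc 0 t) → EqOn Y' Z' (Icc 0 t) → F' Y Y' t = F' Z Z' t

/-- The growth conditions with constant `C`. -/
def GrowthCondition (C : ℝ) : Prop :=
  ∀ Y Y', IsControlled p T X Y Y' → ∀ s t : ℝ, 0 ≤ s → s < t → t ≤ T →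
    ‖F Y t‖ ≤ C ∧
    ‖jump (F Y) t‖ ≤ C * (1 + varIco p (incr Y) s t + ‖jump Y t‖) ∧
    var p (incr (F Y)) s t ≤
      C * (1 + (‖Y' s‖ + var p (incr Y') s t) * var p (incr X) s t
        + var (p / 2) (remainder X Y Y') s t) ∧
    ctrlNorm p X (F Y) (F' Y Y') s t ≤
      C * (1 + ctrlNorm p X Y Y' s t) ^ 2 * (1 + var p (incr X) s t) ^ 2

/-- The Lipschitz conditions with constant `C`, for controlled paths that are bounded by `K` on the
interval in question. -/
def LipschitzCondition (K C : ℝ) : Prop :=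
  ∀ Y Y' Z Z', IsControlled p T X Y Y' → IsControlled p T X Z Z' →
    ∀ s t : ℝ, 0 ≤ s → s < t → t ≤ T →
    ctrlNorm p X Y Y' s t ≤ K → ctrlNorm p X Z Z' s t ≤ K →
    var p (incr (F Y - F Z)) s t ≤ C * (‖Y s - Z s‖ + var p (incr (Y - Z)) s t) ∧
    ctrlDist p X (F Y) (F' Y Y') (F Z) (F' Z Z') s t ≤
      C * (‖Y s - Z s‖ + ctrlDist p X Y Y' Z Z' s t)

/-- `(Y, Y')` is a controlled path with `Y' = y' + F(Y)` and `Y = y + ∫ F(Y) d(X, XX)` on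
`[0, T]`. -/
structure IsSolution (XX : ℝ → ℝ → Mat d) (y : ℝ → Vec k) (y' : ℝ → Vec d →L[ℝ] Vec k)
    (Y : ℝ → Vec k) (Y' : ℝ → Vec d →L[ℝ] Vec k) : Prop where
  controlled : IsControlled p T X Y Y'
  deriv_eq : ∀ t ∈ Icc 0 T, Y' t = y' t + F Y t
  integral_eq : ∀ t ∈ Icc 0 T, HasRoughIntegral X XX (F Y) (F' Y Y') 0 t (Y t - y t)

end Functional

end RoughFDE

end

/-! The solution is the limit of the Picard iterates of the map that sends `(Y, Y')` to `(y + ∫ F(Y)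
dX, y' + F(Y))`, with all iterates defined on the whole of `[0, T]`.

The integral comes from sewing. The defect of `V_u X_{u,v} + V'_u XX_{u,v}` is, by Chen's relation
(`defect_germ`), a sum of two products whose variation exponents `2/p` and `1/p` add up to `3/p >
1`. Young's point-removal argument (`norm_sum_sub_le_of_defect`) and Hölder then bound Riemann sums,
compactness yields the path (`exists_additive`), and `exists_mesh` gives convergence as the mesh
tends to zero.

The main obstacle is jumps: the norm of the rough path over `[s, t]` need not become small on any
subdivision, but its norms over `[s, u]`, `u < t`, do. `control_induction` cuts `[0, T]` into
finitely many such intervals. A jump at the right end is harmless because the remainder of the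
integral over `[s, t]` involves the integrand's seminorm on `[s, t)` only: the defect vanishes when
its middle point is the endpoint, which is why truncated variations appear in `sewBound`. So each
interval is treated in two stages, a smallness argument on `[s, t)` and one further application of
the map, with large constants, that includes `t`.

On `[s, t)` the growth conditions make a fixed bound invariant; the endpoint stage and
`IsControlled.ctrlNorm_glue` turn it into a bound on `[0, T]` common to all iterates
(`IsBoundedEquation.picard_bound`). It depends on the data only through the three norms in the
statement, and it passes to the limit.

For differences, the Lipschitz bound for `F(Y)` contains the remainder without a small factor, so
the contraction holds in a norm that gives the remainder a large weight (`weighted_contraction`).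
`geoBounded_ctrlNorm_sub` propagates geometric decay from one interval to the next: errors at the
left end of an interval decay already and act as a decaying inhomogeneity. Local solutions are
therefore never concatenated. Applied to consecutive iterates this gives a limit, which one more use
of the Lipschitz bound identifies with its own image. Applied to two constant sequences of solutions
it gives uniqueness. -/

namespace RoughFDE

/-! ### Variation over weakly increasing grids: Minkowski, superadditivity, semicontinuity -/

section Variation

variable {E G : Type*} [NormedAddCommGroup E] [NormedAddCommGroup G]

/-- A weakly increasing sequence of points of `[s, t]`. -/
structure IsGrid (s t : ℝ) (a : ℕ → ℝ) : Prop where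
  mono : Monotone a
  mem : ∀ i, a i ∈ Icc s t

theorem IsGrid.widen {s t s' t' : ℝ} {a : ℕ → ℝ} (h : IsGrid s t a) (hs : s' ≤ s) (ht : t ≤ t') :
    IsGrid s' t' a :=
  ⟨h.mono, fun i => Icc_subset_Icc hs ht (h.mem i)⟩

theorem IsGrid.shift {s t : ℝ} {a : ℕ → ℝ} (h : IsGrid s t a) (m : ℕ) :
    IsGrid s t (fun i => a (i + m)) :=
  ⟨fun _ _ hij => h.mono (by omega), fun i => h.mem _⟩

theorem IsGrid.comp_mono {s t s' t' : ℝ} {a : ℕ → ℝ} (h : IsGrid s t a) {f : ℝ → ℝ}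
    (hf : Monotone f) (hm : ∀ x ∈ Icc s t, f x ∈ Icc s' t') : IsGrid s' t' (fun i => f (a i)) :=
  ⟨fun _ _ hij => hf (h.mono hij), fun i => hm _ (h.mem i)⟩

theorem IsGrid.le_succ {s t : ℝ} {a : ℕ → ℝ} (h : IsGrid s t a) (i : ℕ) : a i ≤ a (i + 1) :=
  h.mono (Nat.le_succ i)

theorem IsGrid.left_le_right {s t : ℝ} {a : ℕ → ℝ} (h : IsGrid s t a) : s ≤ t :=
  (h.mem 0).1.trans (h.mem 0).2

theorem IntervalPartition.le_of_le {s t : ℝ} (P : IntervalPartition s t) {i j : ℕ} (hij : i ≤ j)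
    (hj : j ≤ P.n) : P.pt i ≤ P.pt j := by
  induction j, hij using Nat.le_induction with
  | base => exact le_rfl
  | succ j hij ih => exact (ih (by omega)).trans (P.pt_lt j (by omega)).le

theorem IntervalPartition.isGrid {s t : ℝ} (P : IntervalPartition s t) :
    IsGrid s t (fun i => P.pt (min i P.n)) := by
  refine ⟨fun i j hij => P.le_of_le (by omega) (by omega), fun i => ⟨?_, ?_⟩⟩
  · exact P.pt_zero.symm.le.trans (P.le_of_le (by omega) (by omega))
  · exact (P.le_of_le (by omega) le_rfl).trans P.pt_n.le

theorem IntervalPartition.sum_min {s t : ℝ} (P : IntervalPartition s t) {M : Type*}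
    [AddCommMonoid M] (f : ℝ → ℝ → M) :
    ∑ i ∈ Finset.range P.n, f (P.pt (min i P.n)) (P.pt (min (i + 1) P.n)) =
      ∑ i ∈ Finset.range P.n, f (P.pt i) (P.pt (i + 1)) := by
  refine Finset.sum_congr rfl fun i hi => ?_
  have := Finset.mem_range.1 hi
  rw [min_eq_left (by omega), min_eq_left (by omega)]

/-- Removing repeated points from a weakly increasing sequence. -/
theorem exists_partition_of_monotone {a : ℕ → ℝ} (ha : Monotone a) {f : ℝ → ℝ → ENNReal}
    (hf : ∀ i, f (a i) (a i) = 0) (n : ℕ) :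
    ∃ P : IntervalPartition (a 0) (a n),
      ∑ i ∈ Finset.range P.n, f (P.pt i) (P.pt (i + 1)) =
        ∑ i ∈ Finset.range n, f (a i) (a (i + 1)) := by
  induction n with
  | zero => exact ⟨⟨0, fun _ => a 0, rfl, rfl, by simp⟩, by simp⟩
  | succ n ih =>
    obtain ⟨P, hP⟩ := ih
    rw [Finset.sum_range_succ, ← hP]
    rcases (ha (Nat.le_succ n)).eq_or_lt with h | h
    · refine ⟨⟨P.n, P.pt, P.pt_zero, P.pt_n.trans h, P.pt_lt⟩, ?_⟩
      have : f (a n) (a (n + 1)) = 0 := by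
        rw [Nat.succ_eq_add_one] at h; rw [← h]; exact hf n
      simp [this]
    · refine ⟨⟨P.n + 1, fun i => if i ≤ P.n then P.pt i else a (n + 1), by simp [P.pt_zero],
        by simp, fun i hi => ?_⟩, ?_⟩
      · rcases Nat.lt_succ_iff_lt_or_eq.1 hi with hi | rfl
        · simp only [show i ≤ P.n by omega, show i + 1 ≤ P.n by omega, if_true]
          exact P.pt_lt i hi
        · simpa [P.pt_n] using h
      · simp only [Finset.sum_range_succ]
        congr 1
        · refine Finset.sum_congr rfl fun i hi => ?_
          have := Finset.mem_range.1 hi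
          simp only [show i ≤ P.n by omega, show i + 1 ≤ P.n by omega, if_true]
        · simp [P.pt_n]

/-- The `q`-variation of `A` over `[s, t]` is finite and at most `c`. -/
def VarLE (q : ℝ) (A : ℝ → ℝ → E) (s t c : ℝ) : Prop :=
  0 ≤ c ∧ ∀ (a : ℕ → ℝ) (n : ℕ), IsGrid s t a →
    ∑ i ∈ Finset.range n, ‖A (a i) (a (i + 1))‖ ^ q ≤ c ^ q

/-- `A` vanishes on the diagonal and has finite `q`-variation over `[s, t]`. -/
structure FinVar (q : ℝ) (A : ℝ → ℝ → E) (s t : ℝ) : Prop where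
  diag : ∀ u ∈ Icc s t, A u u = 0
  finite : eVar q A s t < ⊤

theorem var_nonneg (q : ℝ) (A : ℝ → ℝ → E) (s t : ℝ) : 0 ≤ var q A s t := ENNReal.toReal_nonneg

theorem enorm_sum_rpow (A : ℝ → ℝ → E) {q : ℝ} (hq : 0 < q) (a : ℕ → ℝ) (n : ℕ) :
    ∑ i ∈ Finset.range n, ‖A (a i) (a (i + 1))‖ₑ ^ q =
      ENNReal.ofReal (∑ i ∈ Finset.range n, ‖A (a i) (a (i + 1))‖ ^ q) := by
  rw [ENNReal.ofReal_sum_of_nonneg fun i _ => by positivity]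
  refine Finset.sum_congr rfl fun i _ => ?_
  rw [← ofReal_norm, ENNReal.ofReal_rpow_of_nonneg (norm_nonneg _) hq.le]

theorem VarLE.eVar_le {q : ℝ} (hq : 0 < q) {A : ℝ → ℝ → E} {s t c : ℝ} (h : VarLE q A s t c) :
    eVar q A s t ≤ ENNReal.ofReal c := by
  have : (⨆ P : IntervalPartition s t,
      ∑ i ∈ Finset.range P.n, ‖A (P.pt i) (P.pt (i + 1))‖ₑ ^ q) ≤ ENNReal.ofReal c ^ q := by
    refine iSup_le fun P => ?_
    rw [← P.sum_min fun x y => ‖A x y‖ₑ ^ q, enorm_sum_rpow A hq (fun i => P.pt (min i P.n)),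
      ENNReal.ofReal_rpow_of_nonneg h.1 hq.le]
    exact ENNReal.ofReal_le_ofReal (h.2 _ _ P.isGrid)
  calc eVar q A s t ≤ (ENNReal.ofReal c ^ q) ^ (1 / q) := ENNReal.rpow_le_rpow this (by positivity)
    _ = ENNReal.ofReal c := by rw [← ENNReal.rpow_mul, mul_one_div_cancel hq.ne', ENNReal.rpow_one]

theorem VarLE.var_le {q : ℝ} (hq : 0 < q) {A : ℝ → ℝ → E} {s t c : ℝ} (h : VarLE q A s t c) :
    var q A s t ≤ c :=
  ENNReal.toReal_le_of_le_ofReal h.1 (h.eVar_le hq)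

theorem VarLE.finVar {q : ℝ} (hq : 0 < q) {A : ℝ → ℝ → E} {s t c : ℝ} (h : VarLE q A s t c)
    (hd : ∀ u ∈ Icc s t, A u u = 0) : FinVar q A s t :=
  ⟨hd, (h.eVar_le hq).trans_lt ENNReal.ofReal_lt_top⟩

/-- A grid may repeat points and need not reach `s` or `t`. Padding it with both endpoints only adds
nonnegative terms, and deleting repetitions costs nothing since `A` vanishes on the diagonal.
Working with grids makes clamping and shifting of partitions painless. -/
theorem FinVar.varLE {q : ℝ} (hq : 0 < q) {A : ℝ → ℝ → E} {s t : ℝ} (h : FinVar q A s t) :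
    VarLE q A s t (var q A s t) := by
  refine ⟨var_nonneg _ _ _ _, fun a n ha => ?_⟩
  let b : ℕ → ℝ := fun i => if i = 0 then s else if i ≤ n + 1 then a (i - 1) else t
  have hb : Monotone b := by
    refine monotone_nat_of_le_succ fun i => ?_
    rcases Nat.eq_zero_or_pos i with rfl | hi
    · simpa [b] using (ha.mem 0).1
    · rcases le_or_gt (i + 1) (n + 1) with h1 | h1
      · simp only [b, show i ≠ 0 by omega, show i ≤ n + 1 by omega, h1, if_true, if_false,
          show i + 1 ≠ 0 by omega]
        exact ha.mono (by omega)
      · simp only [b, show i ≠ 0 by omega, show ¬ (i + 1 ≤ n + 1) by omega, if_false,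
          show i + 1 ≠ 0 by omega]
        split_ifs
        · exact (ha.mem _).2
        · exact le_rfl
  have hst := ha.left_le_right
  have hbm : ∀ i, b i ∈ Icc s t := by
    intro i
    simp only [b]
    split_ifs
    · exact ⟨le_rfl, hst⟩
    · exact ha.mem _
    · exact ⟨hst, le_rfl⟩
  obtain ⟨P, hP⟩ := exists_partition_of_monotone hb (f := fun x y => ‖A x y‖ₑ ^ q)
    (fun i => by simp [h.diag _ (hbm i), hq]) (n + 2)
  have hb0 : b 0 = s := by simp [b]
  have hbn : b (n + 2) = t := by simp [b]
  have h1 : ENNReal.ofReal (∑ i ∈ Finset.range n, ‖A (a i) (a (i + 1))‖ ^ q) ≤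
      ⨆ P : IntervalPartition s t,
        ∑ i ∈ Finset.range P.n, ‖A (P.pt i) (P.pt (i + 1))‖ₑ ^ q := by
    rw [← enorm_sum_rpow A hq]
    refine le_trans ?_ (le_iSup (fun P : IntervalPartition s t =>
      ∑ i ∈ Finset.range P.n, ‖A (P.pt i) (P.pt (i + 1))‖ₑ ^ q)
        ⟨P.n, P.pt, P.pt_zero.trans hb0, P.pt_n.trans hbn, P.pt_lt⟩)
    dsimp only
    rw [hP, Finset.sum_range_succ, Finset.sum_range_succ']
    refine le_trans (le_of_eq ?_) (le_self_add.trans le_self_add)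
    refine Finset.sum_congr rfl fun i hi => ?_
    have := Finset.mem_range.1 hi
    simp [b, show i ≤ n by omega, show i + 1 ≤ n by omega]
  have h2 : var q A s t ^ q = (⨆ P : IntervalPartition s t,
        ∑ i ∈ Finset.range P.n, ‖A (P.pt i) (P.pt (i + 1))‖ₑ ^ q).toReal := by
    rw [var, eVar, ← ENNReal.toReal_rpow, ← Real.rpow_mul ENNReal.toReal_nonneg,
      one_div_mul_cancel hq.ne', Real.rpow_one]
  have h3 : (⨆ P : IntervalPartition s t,
        ∑ i ∈ Finset.range P.n, ‖A (P.pt i) (P.pt (i + 1))‖ₑ ^ q) ≠ ⊤ := by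
    intro htop
    have := h.finite
    rw [eVar, htop, ENNReal.top_rpow_of_pos (by positivity)] at this
    exact lt_irrefl _ this
  rw [h2]
  exact (ENNReal.ofReal_le_iff_le_toReal h3).1 h1

theorem var_rpow_le {q : ℝ} (hq : 0 < q) {A : ℝ → ℝ → E} {s t C : ℝ} (hC : 0 ≤ C)
    (h : ∀ (a : ℕ → ℝ) (n : ℕ), IsGrid s t a →
      ∑ i ∈ Finset.range n, ‖A (a i) (a (i + 1))‖ ^ q ≤ C) : var q A s t ^ q ≤ C := by
  have h1 : VarLE q A s t (C ^ (1 / q)) := by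
    refine ⟨by positivity, fun a n ha => ?_⟩
    rw [← Real.rpow_mul hC, one_div_mul_cancel hq.ne', Real.rpow_one]
    exact h a n ha
  calc var q A s t ^ q ≤ (C ^ (1 / q)) ^ q :=
        Real.rpow_le_rpow (var_nonneg _ _ _ _) (h1.var_le hq) hq.le
    _ = C := by rw [← Real.rpow_mul hC, one_div_mul_cancel hq.ne', Real.rpow_one]

namespace VarLE

variable {q : ℝ} {A B : ℝ → ℝ → E} {D : ℝ → ℝ → G} {s t s' t' c c' : ℝ}

theorem mono (h : VarLE q A s t c) (hs : s ≤ s') (ht : t' ≤ t) : VarLE q A s' t' c :=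
  ⟨h.1, fun a n ha => h.2 a n (ha.widen hs ht)⟩

theorem le (hq : 0 < q) (h : VarLE q A s t c) (hc : c ≤ c') : VarLE q A s t c' :=
  ⟨h.1.trans hc, fun a n ha => (h.2 a n ha).trans (Real.rpow_le_rpow h.1 hc hq.le)⟩

theorem of_norm_le (hq : 0 < q) (h : VarLE q A s t c)
    (hD : ∀ a b, s ≤ a → a ≤ b → b ≤ t → ‖D a b‖ ≤ ‖A a b‖) : VarLE q D s t c :=
  ⟨h.1, fun a n ha => (Finset.sum_le_sum fun i _ => Real.rpow_le_rpow (norm_nonneg _)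
    (hD _ _ (ha.mem i).1 (ha.le_succ i) (ha.mem _).2) hq.le).trans (h.2 a n ha)⟩

/-- Minkowski's inequality on each grid. This is why `p / 2 ≥ 1` is needed for remainders and areas.
-/
theorem add (hq : 1 ≤ q) (hA : VarLE q A s t c) (hB : VarLE q B s t c') :
    VarLE q (A + B) s t (c + c') := by
  have hq0 : 0 < q := by linarith
  have hc := hA.1
  have hc' := hB.1
  refine ⟨by positivity, fun a n ha => ?_⟩
  have h1 := Real.Lp_add_le_of_nonneg (Finset.range n) hq
    (f := fun i => ‖A (a i) (a (i + 1))‖) (g := fun i => ‖B (a i) (a (i + 1))‖)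
    (fun _ _ => norm_nonneg _) (fun _ _ => norm_nonneg _)
  have key : ∀ {x y : ℝ}, 0 ≤ x → 0 ≤ y → x ≤ y ^ q → x ^ (1 / q) ≤ y := by
    intro x y hx hy hxy
    calc x ^ (1 / q) ≤ (y ^ q) ^ (1 / q) := Real.rpow_le_rpow hx hxy (by positivity)
      _ = y := by rw [← Real.rpow_mul hy, mul_one_div_cancel hq0.ne', Real.rpow_one]
  have hS : ∀ f : ℕ → ℝ, (∀ i, 0 ≤ f i) → 0 ≤ ∑ i ∈ Finset.range n, f i ^ q := fun f hf =>
    Finset.sum_nonneg fun i _ => Real.rpow_nonneg (hf i) _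
  have h2 := h1.trans (add_le_add (key (hS _ fun _ => norm_nonneg _) hc (hA.2 a n ha))
    (key (hS _ fun _ => norm_nonneg _) hc' (hB.2 a n ha)))
  have h3 : 0 ≤ ∑ i ∈ Finset.range n,
      (‖A (a i) (a (i + 1))‖ + ‖B (a i) (a (i + 1))‖) ^ q := hS _ fun _ => by positivity
  calc ∑ i ∈ Finset.range n, ‖(A + B) (a i) (a (i + 1))‖ ^ q
      ≤ ∑ i ∈ Finset.range n, (‖A (a i) (a (i + 1))‖ + ‖B (a i) (a (i + 1))‖) ^ q :=
        Finset.sum_le_sum fun i _ => Real.rpow_le_rpow (norm_nonneg _) (norm_add_le _ _) hq0.le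
    _ = ((∑ i ∈ Finset.range n, (‖A (a i) (a (i + 1))‖ + ‖B (a i) (a (i + 1))‖) ^ q)
          ^ (1 / q)) ^ q := by
        rw [← Real.rpow_mul h3, one_div_mul_cancel hq0.ne', Real.rpow_one]
    _ ≤ (c + c') ^ q := Real.rpow_le_rpow (Real.rpow_nonneg h3 _) h2 hq0.le

theorem neg (h : VarLE q A s t c) : VarLE q (-A) s t c :=
  ⟨h.1, fun a n ha => by simpa using h.2 a n ha⟩

theorem sub (hq : 1 ≤ q) (hA : VarLE q A s t c) (hB : VarLE q B s t c') :
    VarLE q (A - B) s t (c + c') := by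
  rw [sub_eq_add_neg]; exact hA.add hq hB.neg

theorem const_mul {v : ℝ → ℝ → ℝ} (h : VarLE q v s t c) {K : ℝ} (hK : 0 ≤ K) :
    VarLE q (fun a b => K * v a b) s t (K * c) := by
  refine ⟨mul_nonneg hK h.1, fun a n ha => ?_⟩
  rw [Real.mul_rpow hK h.1]
  calc ∑ i ∈ Finset.range n, ‖K * v (a i) (a (i + 1))‖ ^ q
      = K ^ q * ∑ i ∈ Finset.range n, ‖v (a i) (a (i + 1))‖ ^ q := by
        rw [Finset.mul_sum]
        refine Finset.sum_congr rfl fun i _ => ?_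
        rw [norm_mul, Real.norm_of_nonneg hK, Real.mul_rpow hK (norm_nonneg _)]
    _ ≤ K ^ q * c ^ q := mul_le_mul_of_nonneg_left (h.2 a n ha) (Real.rpow_nonneg hK _)

theorem norm_le (hq : 0 < q) (h : VarLE q A s t c) {a b : ℝ} (ha : s ≤ a) (hab : a ≤ b)
    (hb : b ≤ t) : ‖A a b‖ ≤ c := by
  have hg : IsGrid s t (fun i => if i = 0 then a else b) := by
    refine ⟨monotone_nat_of_le_succ fun i => ?_, fun i => ?_⟩
    · rcases Nat.eq_zero_or_pos i with rfl | hi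
      · simpa using hab
      · simp [show i ≠ 0 by omega]
    · split_ifs
      · exact ⟨ha, hab.trans hb⟩
      · exact ⟨ha.trans hab, hb⟩
  have := h.2 _ 1 hg
  simp only [Finset.range_one, Finset.sum_singleton, if_true, zero_add, one_ne_zero,
    if_false] at this
  exact (Real.rpow_le_rpow_iff (norm_nonneg _) h.1 hq).1 this

/-- Finite `p / 2`-variation implies finite `p`-variation. -/
theorem double (h : VarLE (q / 2) A s t c) : VarLE q A s t c := by
  refine ⟨h.1, fun a n ha => ?_⟩
  have hsq : ∀ x : ℝ, 0 ≤ x → x ^ q = (x ^ (q / 2)) ^ 2 := by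
    intro x hx
    rw [← Real.rpow_natCast, ← Real.rpow_mul hx]
    norm_num
  rw [hsq c h.1]
  calc ∑ i ∈ Finset.range n, ‖A (a i) (a (i + 1))‖ ^ q
      = ∑ i ∈ Finset.range n, (‖A (a i) (a (i + 1))‖ ^ (q / 2)) ^ 2 :=
        Finset.sum_congr rfl fun i _ => hsq _ (norm_nonneg _)
    _ ≤ (∑ i ∈ Finset.range n, ‖A (a i) (a (i + 1))‖ ^ (q / 2)) ^ 2 :=
        Finset.sum_sq_le_sq_sum_of_nonneg fun i _ => by positivity
    _ ≤ (c ^ (q / 2)) ^ 2 :=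
        pow_le_pow_left₀ (Finset.sum_nonneg fun i _ => by positivity) (h.2 a n ha) 2

/-- A bound for functions that are nonzero on at most one interval of each partition. -/
theorem of_single (hq : 0 < q) (hc : 0 ≤ c) (u : ℝ)
    (h0 : ∀ a b, s ≤ a → a ≤ b → b ≤ t → ¬ (a < u ∧ u ≤ b) → A a b = 0)
    (h1 : ∀ a b, s ≤ a → a < u → u ≤ b → b ≤ t → ‖A a b‖ ≤ c) : VarLE q A s t c := by
  refine ⟨hc, fun a n ha => ?_⟩
  have hz : ∀ i, ¬ (a i < u ∧ u ≤ a (i + 1)) → ‖A (a i) (a (i + 1))‖ ^ q = 0 := fun i hi => by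
    rw [h0 _ _ (ha.mem _).1 (ha.le_succ i) (ha.mem _).2 hi, norm_zero, Real.zero_rpow hq.ne']
  by_cases hex : ∃ i ∈ Finset.range n, a i < u ∧ u ≤ a (i + 1)
  · obtain ⟨i, hi, hiu, hui⟩ := hex
    rw [Finset.sum_eq_single i]
    · exact Real.rpow_le_rpow (norm_nonneg _) (h1 _ _ (ha.mem _).1 hiu hui (ha.mem _).2) hq.le
    · intro j _ hji
      refine hz j fun hj => ?_
      rcases Nat.lt_or_gt_of_ne hji with h | h
      · exact absurd (ha.mono (show j + 1 ≤ i by omega)) (by linarith [hj.2])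
      · exact absurd (ha.mono (show i + 1 ≤ j by omega)) (by linarith [hj.1])
    · exact fun h => absurd hi h
  · push Not at hex
    rw [Finset.sum_eq_zero fun i hi => hz i fun h => absurd h.2 (not_le.2 (hex i hi h.1))]
    exact Real.rpow_nonneg hc _

end VarLE

theorem FinVar.mono {q : ℝ} (hq : 0 < q) {A : ℝ → ℝ → E} {s t s' t' : ℝ} (h : FinVar q A s t)
    (hs : s ≤ s') (ht : t' ≤ t) : FinVar q A s' t' :=
  ((h.varLE hq).mono hs ht).finVar hq fun u hu => h.diag u (Icc_subset_Icc hs ht hu)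

theorem FinVar.var_mono {q : ℝ} (hq : 0 < q) {A : ℝ → ℝ → E} {s t s' t' : ℝ} (h : FinVar q A s t)
    (hs : s ≤ s') (ht : t' ≤ t) : var q A s' t' ≤ var q A s t :=
  ((h.varLE hq).mono hs ht).var_le hq

theorem FinVar.norm_le {q : ℝ} (hq : 0 < q) {A : ℝ → ℝ → E} {s t : ℝ} (h : FinVar q A s t)
    {a b : ℝ} (ha : s ≤ a) (hab : a ≤ b) (hb : b ≤ t) : ‖A a b‖ ≤ var q A s t :=
  (h.varLE hq).norm_le hq ha hab hb

/-- Two grids on adjacent intervals concatenate to one; the connecting cell contributes a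
nonnegative term that is dropped. -/
theorem FinVar.superadditive {q : ℝ} (hq : 0 < q) {A : ℝ → ℝ → E} {s u t : ℝ}
    (h : FinVar q A s t) (hsu : s ≤ u) (hut : u ≤ t) :
    var q A s u ^ q + var q A u t ^ q ≤ var q A s t ^ q := by
  have hV := (h.varLE hq).2
  have key : ∀ (a : ℕ → ℝ) (n : ℕ), IsGrid s u a → ∀ (b : ℕ → ℝ) (m : ℕ), IsGrid u t b →
      ∑ i ∈ Finset.range n, ‖A (a i) (a (i + 1))‖ ^ q +
        ∑ i ∈ Finset.range m, ‖A (b i) (b (i + 1))‖ ^ q ≤ var q A s t ^ q := by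
    intro a n ha b m hb
    have hg : IsGrid s t (fun i => if i ≤ n then a i else b (i - (n + 1))) := by
      refine ⟨monotone_nat_of_le_succ fun i => ?_, fun i => ?_⟩
      · rcases lt_trichotomy i n with hi | rfl | hi
        · simp only [hi.le, show i + 1 ≤ n by omega, if_true]
          exact ha.le_succ i
        · simp only [le_refl, if_true, show ¬ (i + 1 ≤ i) by omega, if_false]
          exact (ha.mem _).2.trans (hb.mem _).1
        · simp only [show ¬ (i ≤ n) by omega, show ¬ (i + 1 ≤ n) by omega, if_false]
          exact hb.mono (by omega)
      · split_ifs
        · exact Icc_subset_Icc le_rfl hut (ha.mem i)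
        · exact Icc_subset_Icc hsu le_rfl (hb.mem _)
    have h1 := hV _ (n + 1 + m) hg
    rw [Finset.sum_range_add, Finset.sum_range_succ] at h1
    refine le_trans ?_ h1
    refine add_le_add (le_trans (le_of_eq ?_) (le_add_of_nonneg_right (by positivity)))
      (le_of_eq ?_)
    · refine Finset.sum_congr rfl fun i hi => ?_
      have := Finset.mem_range.1 hi
      simp [show i ≤ n by omega, show i + 1 ≤ n by omega]
    · refine Finset.sum_congr rfl fun i hi => ?_
      simp only [show ¬ (n + 1 + i ≤ n) by omega, show ¬ (n + 1 + i + 1 ≤ n) by omega, if_false,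
        show n + 1 + i - (n + 1) = i by omega, show n + 1 + i + 1 - (n + 1) = i + 1 by omega]
  have hle : var q A u t ^ q ≤ var q A s t ^ q :=
    Real.rpow_le_rpow (var_nonneg _ _ _ _) (h.var_mono hq hsu le_rfl) hq.le
  have h2 : var q A s u ^ q ≤ var q A s t ^ q - var q A u t ^ q := by
    refine var_rpow_le hq (sub_nonneg.2 hle) fun a n ha => ?_
    rw [le_sub_comm]
    refine var_rpow_le hq ?_ fun b m hb => ?_
    · have := key a n ha (fun _ => u) 0 ⟨monotone_const, fun _ => ⟨le_rfl, hut⟩⟩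
      simpa using this
    · rw [le_sub_iff_add_le']
      exact key a n ha b m hb
  linarith

theorem sum_le_of_superadditive {f : ℝ → ℝ → ℝ} {s t : ℝ} (h0 : ∀ a b, 0 ≤ f a b)
    (h : ∀ a u b, s ≤ a → a ≤ u → u ≤ b → b ≤ t → f a u + f u b ≤ f a b)
    {a : ℕ → ℝ} (ha : IsGrid s t a) (n : ℕ) :
    ∑ i ∈ Finset.range n, f (a i) (a (i + 1)) ≤ f s t := by
  have h1 : ∑ i ∈ Finset.range n, f (a i) (a (i + 1)) ≤ f (a 0) (a n) := by
    induction n with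
    | zero => simpa using h0 _ _
    | succ n ih =>
      rw [Finset.sum_range_succ]
      exact (add_le_add_left ih _).trans
        (h _ _ _ (ha.mem _).1 (ha.mono (Nat.zero_le n)) (ha.le_succ n) (ha.mem _).2)
  have h2 := h s (a 0) (a n) le_rfl (ha.mem 0).1 (ha.mono (Nat.zero_le n)) (ha.mem n).2
  have h3 := h s (a n) t le_rfl (ha.mem n).1 (ha.mem n).2 le_rfl
  linarith [h0 s (a 0), h0 (a n) t]

/-- The variation itself, as a function of the interval, has finite variation. -/
theorem FinVar.varLE_var {q : ℝ} (hq : 0 < q) {A : ℝ → ℝ → E} {s t : ℝ} (h : FinVar q A s t) :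
    VarLE q (fun a b => var q A a b) s t (var q A s t) := by
  refine ⟨var_nonneg _ _ _ _, fun a n ha => ?_⟩
  simp only [Real.norm_of_nonneg (var_nonneg _ _ _ _)]
  exact sum_le_of_superadditive (f := fun x y => var q A x y ^ q)
    (fun _ _ => Real.rpow_nonneg (var_nonneg _ _ _ _) _)
    (fun x u y hx hxu huy hy => (h.mono hq hx hy).superadditive hq hxu huy) ha n

/-- Variation is lower semicontinuous under pointwise convergence. -/
theorem VarLE.of_tendsto {q : ℝ} {ι : Type*} {l : Filter ι} [l.NeBot]
    {A : ι → ℝ → ℝ → E} {B : ℝ → ℝ → E} {s t c : ℝ} (hq : 0 < q)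
    (h : ∀ᶠ i in l, VarLE q (A i) s t c)
    (hB : ∀ a b, s ≤ a → a ≤ b → b ≤ t → Tendsto (fun i => A i a b) l (𝓝 (B a b))) :
    VarLE q B s t c := by
  obtain ⟨i, hi⟩ := h.exists
  refine ⟨hi.1, fun a n ha => ?_⟩
  have h1 : Tendsto (fun i => ∑ j ∈ Finset.range n, ‖A i (a j) (a (j + 1))‖ ^ q) l
      (𝓝 (∑ j ∈ Finset.range n, ‖B (a j) (a (j + 1))‖ ^ q)) :=
    tendsto_finsetSum _ fun j _ =>
      ((hB _ _ (ha.mem j).1 (ha.le_succ j) (ha.mem _).2).norm.rpow_const (Or.inr hq.le))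
  exact le_of_tendsto h1 (h.mono fun i hi => hi.2 a n ha)

/-- `A` is right-continuous in its left variable on `[s, t]`. -/
def RightContLeft (A : ℝ → ℝ → E) (s t : ℝ) : Prop :=
  ∀ u v, s ≤ u → u < v → v ≤ t → ContinuousWithinAt (fun x => A x v) (Ioi u) u

/-- Take a nearly optimal grid on `[u, t]` and move its points into `[v, t]` by `max v`.
Right-continuity makes its finitely many terms converge as `v` decreases to `u`, and the moved grid
competes in the supremum for `[v, t]`. -/
theorem FinVar.eventually_le {q : ℝ} (hq : 0 < q) {A : ℝ → ℝ → E} {s t u : ℝ}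
    (h : FinVar q A s t) (hA : RightContLeft A s t) (hsu : s ≤ u) (hut : u < t) {η : ℝ}
    (hη : 0 < η) : ∀ᶠ v in 𝓝[>] u, var q A u t ^ q ≤ var q A v t ^ q + η := by
  by_cases hcase : var q A u t ^ q ≤ η
  · exact Eventually.of_forall fun v =>
      hcase.trans (le_add_of_nonneg_left (Real.rpow_nonneg (var_nonneg _ _ _ _) _))
  push Not at hcase
  obtain ⟨a, n, ha, han⟩ : ∃ (a : ℕ → ℝ) (n : ℕ), IsGrid u t a ∧
      var q A u t ^ q - η / 2 < ∑ i ∈ Finset.range n, ‖A (a i) (a (i + 1))‖ ^ q := by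
    by_contra hcon
    push Not at hcon
    have := var_rpow_le hq (A := A) (s := u) (t := t) (C := var q A u t ^ q - η / 2)
      (by linarith) hcon
    linarith
  have hT : Tendsto (fun v => ∑ i ∈ Finset.range n, ‖A (max v (a i)) (max v (a (i + 1)))‖ ^ q)
      (𝓝[>] u) (𝓝 (∑ i ∈ Finset.range n, ‖A (a i) (a (i + 1))‖ ^ q)) := by
    refine tendsto_finsetSum _ fun i _ => ?_
    refine Tendsto.rpow_const ?_ (Or.inr hq.le)
    refine Tendsto.norm ?_
    have hnhds : Ioo u t ∈ 𝓝[>] u := Ioo_mem_nhdsGT hut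
    rcases (ha.mem i).1.eq_or_lt with hi | hi
    · rcases (ha.mem (i + 1)).1.eq_or_lt with hi1 | hi1
      · rw [← hi, ← hi1, h.diag u ⟨hsu, hut.le⟩]
        refine tendsto_const_nhds.congr' ?_
        filter_upwards [hnhds] with v hv
        rw [max_eq_left hv.1.le, h.diag v ⟨hsu.trans hv.1.le, hv.2.le⟩]
      · rw [← hi]
        refine (hA u _ hsu hi1 (ha.mem _).2).tendsto.congr' ?_
        filter_upwards [hnhds, Ioo_mem_nhdsGT hi1] with v hv hv1
        rw [max_eq_left hv.1.le, max_eq_right hv1.2.le]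
    · have hi1 : u < a (i + 1) := hi.trans_le (ha.le_succ i)
      refine tendsto_const_nhds.congr' ?_
      filter_upwards [Ioo_mem_nhdsGT hi, Ioo_mem_nhdsGT hi1] with v hv hv1
      rw [max_eq_right hv.2.le, max_eq_right hv1.2.le]
  filter_upwards [hT.eventually (lt_mem_nhds (sub_lt_self _ (half_pos hη))),
    Ioo_mem_nhdsGT hut] with v hv hvu
  have hg : IsGrid v t (fun i => max v (a i)) :=
    ha.comp_mono (fun x y hxy => max_le_max le_rfl hxy) fun x hx =>
      ⟨le_max_left _ _, max_le hvu.2.le hx.2⟩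
  have := ((h.mono hq (hsu.trans hvu.1.le) le_rfl).varLE hq).2 _ n hg
  linarith

/-- By superadditivity the part on `[u, v]` is at most what `[v, t]` loses against `[u, t]`, and
that loss tends to zero by `FinVar.eventually_le`. -/
theorem FinVar.tendsto_right {q : ℝ} (hq : 0 < q) {A : ℝ → ℝ → E} {s t u : ℝ}
    (h : FinVar q A s t) (hA : RightContLeft A s t) (hsu : s ≤ u) (hut : u < t) :
    Tendsto (fun v => var q A u v) (𝓝[>] u) (𝓝 0) := by
  have h1 : Tendsto (fun v => var q A u v ^ q) (𝓝[>] u) (𝓝 0) := by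
    rw [Metric.tendsto_nhds]
    intro η hη
    filter_upwards [h.eventually_le hq hA hsu hut (half_pos hη), Ioo_mem_nhdsGT hut] with v hv hvu
    have := (h.mono hq hsu le_rfl).superadditive hq hvu.1.le hvu.2.le
    rw [Real.dist_0_eq_abs, abs_of_nonneg (Real.rpow_nonneg (var_nonneg _ _ _ _) _)]
    linarith
  have h2 := h1.rpow_const (p := 1 / q) (Or.inr (by positivity))
  rw [Real.zero_rpow (by positivity)] at h2
  refine h2.congr fun v => ?_
  rw [← Real.rpow_mul (var_nonneg _ _ _ _), mul_one_div_cancel hq.ne', Real.rpow_one]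

end Variation

end RoughFDE

namespace RoughFDE

/-! ### Variation over half-open intervals -/

section Truncation

variable {E : Type*} [NormedAddCommGroup E]

/-- The function `A` with the intervals that end at `t` or later disregarded. -/
noncomputable def trunc (t : ℝ) (A : ℝ → ℝ → E) : ℝ → ℝ → E := fun a b => if b < t then A a b else 0

theorem trunc_of_lt {t : ℝ} {A : ℝ → ℝ → E} {a b : ℝ} (h : b < t) : trunc t A a b = A a b :=
  if_pos h

theorem trunc_of_le {t : ℝ} {A : ℝ → ℝ → E} {a b : ℝ} (h : t ≤ b) : trunc t A a b = 0 :=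
  if_neg (not_lt.2 h)

theorem norm_trunc_le (t : ℝ) (A : ℝ → ℝ → E) (a b : ℝ) : ‖trunc t A a b‖ ≤ ‖A a b‖ := by
  unfold trunc; split_ifs <;> simp

theorem norm_trunc_mono {t t' : ℝ} (h : t ≤ t') (A : ℝ → ℝ → E) (a b : ℝ) :
    ‖trunc t A a b‖ ≤ ‖trunc t' A a b‖ := by
  rcases lt_or_ge b t with hb | hb
  · rw [trunc_of_lt hb, trunc_of_lt (hb.trans_le h)]
  · simp [trunc_of_le hb]

/-- The cells that end before `t` lie in a common `[s, u]` with `u < t`, and all later cells count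
zero. This encodes a half-open bound as a bound on the closed interval. -/
theorem varLE_trunc {q : ℝ} (hq : 0 < q) {A : ℝ → ℝ → E} {s t c : ℝ} (hst : s < t)
    (h : ∀ u ∈ Ioo s t, VarLE q A s u c) : VarLE q (trunc t A) s t c := by
  have hc : 0 ≤ c := (h ((s + t) / 2) ⟨by linarith, by linarith⟩).1
  refine ⟨hc, fun a n ha => ?_⟩
  induction n with
  | zero => simpa using Real.rpow_nonneg hc q
  | succ n ih =>
    rcases lt_or_ge (a (n + 1)) t with hn | hn
    · set u := max (a (n + 1)) ((s + t) / 2) with hu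
      have hus : u ∈ Ioo s t := ⟨by rw [hu]; exact lt_max_of_lt_right (by linarith), by
        rw [hu]; exact max_lt hn (by linarith)⟩
      have hg : IsGrid s u (fun i => a (min i (n + 1))) :=
        ⟨fun i j hij => ha.mono (by omega), fun i => ⟨(ha.mem _).1,
          (ha.mono (by omega)).trans (le_max_left _ _)⟩⟩
      refine le_trans (Finset.sum_le_sum fun i hi => ?_) ((h u hus).2 _ (n + 1) hg)
      have := Finset.mem_range.1 hi
      rw [min_eq_left (by omega), min_eq_left (by omega)]
      exact Real.rpow_le_rpow (norm_nonneg _) (norm_trunc_le _ _ _ _) hq.le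
    · rw [Finset.sum_range_succ, trunc_of_le hn, norm_zero, Real.zero_rpow hq.ne', add_zero]
      exact ih

theorem VarLE.trunc {q : ℝ} (hq : 0 < q) {A : ℝ → ℝ → E} {s t c : ℝ} (h : VarLE q A s t c)
    (v : ℝ) : VarLE q (trunc v A) s t c :=
  h.of_norm_le hq fun _ _ _ _ _ => norm_trunc_le _ _ _ _

theorem FinVar.trunc {q : ℝ} (hq : 0 < q) {A : ℝ → ℝ → E} {s t : ℝ} (h : FinVar q A s t)
    (v : ℝ) : FinVar q (trunc v A) s t :=
  ((h.varLE hq).trunc hq v).finVar hq fun u hu =>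
    norm_le_zero_iff.1 ((norm_trunc_le _ _ _ _).trans (by simp [h.diag u hu]))

/-- The variation over a closed interval is bounded by the one over the half-open interval and
the size of the last increment. -/
theorem varLE_of_Ico {q : ℝ} (hq : 1 ≤ q) {A : ℝ → ℝ → E} {s t c c' : ℝ} (hst : s < t)
    (hd : A t t = 0) (h : ∀ u ∈ Ioo s t, VarLE q A s u c) (hc' : 0 ≤ c')
    (hj : ∀ u ∈ Ico s t, ‖A u t‖ ≤ c') : VarLE q A s t (c + c') := by
  have hq0 : 0 < q := by linarith
  have h1 := varLE_trunc hq0 hst h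
  -- What truncation removes lives on cells ending at `t`, and at most one of them is nondegenerate.
  have h2 : VarLE q (A - RoughFDE.trunc t A) s t c' := by
    refine .of_single hq0 hc' t (fun a b ha hab hb hn => ?_) fun a b ha hat htb hbt => ?_
    · rcases hb.lt_or_eq with hb | rfl
      · simp [trunc_of_lt hb]
      · have : a = b := le_antisymm hab (not_lt.1 fun h => hn ⟨h, le_rfl⟩)
        simp [this, trunc_of_le le_rfl, hd]
    · obtain rfl := le_antisymm hbt htb
      simpa [trunc_of_le le_rfl] using hj a ⟨ha, hat⟩
  simpa using h1.add hq h2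

end Truncation

/-! ### Paths of finite variation -/

section PathVariation

variable {E : Type*} [NormedAddCommGroup E] {q s u t : ℝ} {Y : ℝ → E}

@[simp]
theorem incr_self (Y : ℝ → E) (s : ℝ) : incr Y s s = 0 := sub_self _

theorem incr_add_incr (Y : ℝ → E) (s u t : ℝ) : incr Y s u + incr Y u t = incr Y s t := by
  simp [incr]

theorem incr_sub (Y Z : ℝ → E) : incr (Y - Z) = incr Y - incr Z := by
  ext s t; simp [incr]; abel

theorem incr_add (Y Z : ℝ → E) : incr (Y + Z) = incr Y + incr Z := by
  ext s t; simp [incr]; abel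

theorem VarLE.clampLeft {A : ℝ → ℝ → E} {c : ℝ} (hsu : s ≤ u) (h : VarLE q A s u c) :
    VarLE q (fun a b => A (min a u) (min b u)) s t c :=
  ⟨h.1, fun a n ha => h.2 (fun i => min (a i) u) n (ha.comp_mono (f := fun x => min x u)
    (fun _ _ hxy => min_le_min hxy le_rfl)
    fun _ hx => ⟨le_min hx.1 hsu, min_le_right _ _⟩)⟩

theorem VarLE.clampRight {A : ℝ → ℝ → E} {c : ℝ} (hut : u ≤ t) (h : VarLE q A u t c) :
    VarLE q (fun a b => A (max a u) (max b u)) s t c :=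
  ⟨h.1, fun a n ha => h.2 (fun i => max (a i) u) n (ha.comp_mono (f := fun x => max x u)
    (fun _ _ hxy => max_le_max hxy le_rfl)
    fun _ hx => ⟨le_max_right _ _, max_le hx.2 hut⟩)⟩

theorem VarLE.glue_incr (hq : 1 ≤ q) {c c' : ℝ} (hsu : s ≤ u) (hut : u ≤ t)
    (h : VarLE q (incr Y) s u c) (h' : VarLE q (incr Y) u t c') :
    VarLE q (incr Y) s t (c + c') := by
  have h1 := (h.clampLeft (t := t) hsu).add hq (h'.clampRight (s := s) hut)
  refine h1.of_norm_le (by linarith) fun a b ha hab hb => le_of_eq ?_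
  congr 1
  simp only [Pi.add_apply]
  rcases le_total a u with h1 | h1 <;> rcases le_total b u with h2 | h2 <;>
    simp [h1, h2, incr]

theorem VarLE.norm_incr_le (hq : 0 < q) {c : ℝ} (h : VarLE q (incr Y) s t c) {a : ℝ}
    (ha : a ∈ Icc s t) : ‖Y a‖ ≤ ‖Y s‖ + c := by
  have h1 := h.norm_le hq le_rfl ha.1 ha.2
  have h2 : Y a = Y s + incr Y s a := by simp [incr]
  rw [h2]
  exact (norm_add_le _ _).trans (by gcongr)

theorem MemD.finVar {T : ℝ} (h : MemD q T Y) : FinVar q (incr Y) 0 T :=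
  ⟨fun u _ => incr_self Y u, h.finite⟩

theorem CadlagOn.rightContLeft_incr {T : ℝ} (h : CadlagOn Y 0 T) :
    RightContLeft (incr Y) 0 T := fun u v hu huv hv => by
  have := h.1 u ⟨hu, huv.trans_le hv⟩
  exact continuousWithinAt_const.sub this

/-- A path of finite variation in a complete space has left limits. -/
theorem exists_leftLim_of_finVar [CompleteSpace E] (hq : 0 < q) (h : FinVar q (incr Y) s t)
    {x : ℝ} (hx : x ∈ Ioc s t) : ∃ l : E, Tendsto Y (𝓝[<] x) (𝓝 l) := by
  refine cauchy_map_iff_exists_tendsto.1 (Metric.cauchy_iff.2 ⟨inferInstance, fun ε hε => ?_⟩)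
  have hmono : MonotoneOn (fun u => var q (incr Y) s u ^ q) (Ico s x) := fun u hu v hv huv =>
    Real.rpow_le_rpow (var_nonneg _ _ _ _)
      ((h.mono hq le_rfl (hv.2.le.trans hx.2)).var_mono hq le_rfl huv) hq.le
  set S := (fun u => var q (incr Y) s u ^ q) '' Ico s x with hS
  have hbdd : BddAbove S := ⟨var q (incr Y) s t ^ q, by
    rintro _ ⟨u, hu, rfl⟩
    exact Real.rpow_le_rpow (var_nonneg _ _ _ _) (h.var_mono hq le_rfl (hu.2.le.trans hx.2)) hq.le⟩
  have hne : S.Nonempty := ⟨_, s, ⟨le_rfl, hx.1⟩, rfl⟩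
  have hεq : 0 < (ε / 2) ^ q := Real.rpow_pos_of_pos (half_pos hε) _
  -- From such a `u` on, superadditivity leaves less than `(ε / 2) ^ q` of variation before `x`, so
  -- the values on `(u, x)` form a set of small diameter.
  obtain ⟨_, ⟨u, hu, rfl⟩, hu2⟩ := exists_lt_of_lt_csSup hne (sub_lt_self (sSup S) hεq)
  refine ⟨Y '' Ioo u x, image_mem_map (Ioo_mem_nhdsLT hu.2), ?_⟩
  have key : ∀ a b, a ∈ Ioo u x → b ∈ Ioo u x → a ≤ b → dist (Y a) (Y b) < ε := by
    intro a b ha hb hab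
    have h1 := (h.mono hq le_rfl (hb.2.le.trans hx.2)).superadditive hq hu.1 hb.1.le
    have h2 : var q (incr Y) s b ^ q ≤ sSup S :=
      le_csSup hbdd ⟨b, ⟨hu.1.trans hb.1.le, hb.2⟩, rfl⟩
    have h3 : var q (incr Y) u b ^ q < (ε / 2) ^ q := by
      simp only at hu2
      linarith
    have h4 := (Real.rpow_lt_rpow_iff (var_nonneg _ _ _ _) (half_pos hε).le hq).1 h3
    have h5 := (h.mono hq hu.1 (hb.2.le.trans hx.2)).norm_le hq ha.1.le hab le_rfl
    rw [dist_comm, dist_eq_norm]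
    change ‖incr Y a b‖ < ε
    linarith
  rintro _ ⟨a, ha, rfl⟩ _ ⟨b, hb, rfl⟩
  rcases le_total a b with hab | hab
  · exact key a b ha hb hab
  · rw [dist_comm]; exact key b a hb ha hab

theorem memD_of_finVar [CompleteSpace E] {T : ℝ} (hq : 0 < q) (h : FinVar q (incr Y) 0 T)
    (hr : ∀ t ∈ Ico 0 T, ContinuousWithinAt Y (Ioi t) t) : MemD q T Y :=
  ⟨⟨hr, fun _ hx => exists_leftLim_of_finVar hq h hx⟩, h.finite⟩

end PathVariation

/-- Induction along intervals: a property that holds on intervals whose interior is small for a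
superadditive function, and that passes to unions of adjacent intervals, holds everywhere. -/
theorem control_induction {ω : ℝ → ℝ → ℝ} {T θ : ℝ} (hθ : 0 < θ) (h0 : ∀ s t, 0 ≤ ω s t)
    (hsup : ∀ s u t, 0 ≤ s → s ≤ u → u ≤ t → t ≤ T → ω s u + ω u t ≤ ω s t)
    (hlsc : ∀ u t, 0 ≤ u → u < t → t ≤ T → ∀ η, 0 < η →
      ∀ᶠ v in 𝓝[>] u, ω u t ≤ ω v t + η)
    {Q : ℕ → ℝ → ℝ → Prop}
    (small : ∀ s t, 0 ≤ s → s < t → t ≤ T → (∀ u ∈ Ioo s t, ω s u ≤ θ) → Q 0 s t)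
    (glue : ∀ n s u t, 0 ≤ s → s < u → u < t → t ≤ T → Q 0 s u → Q n u t → Q (n + 1) s t)
    (mono : ∀ n s t, Q n s t → Q (n + 1) s t) (n : ℕ) :
    ∀ s t, 0 ≤ s → s < t → t ≤ T → ω s t ≤ n * θ → Q n s t := by
  induction n with
  | zero =>
    intro s t hs hst ht hω
    refine small s t hs hst ht fun u hu => ?_
    have := hsup s u t hs hu.1.le hu.2.le ht
    simp only [Nat.cast_zero, zero_mul] at hω
    linarith [h0 u t]
  | succ n ih =>
    intro s t hs hst ht hω
    by_cases hsm : ∀ u ∈ Ioo s t, ω s u ≤ θ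
    · have : ∀ m, Q m s t := fun m => by
        induction m with
        | zero => exact small s t hs hst ht hsm
        | succ m hm => exact mono _ _ _ hm
      exact this _
    push Not at hsm
    obtain ⟨v, hv, hvθ⟩ := hsm
    -- The first piece is made as long as its interior allows. Only `w < u` is tested, because a
    -- jump at `u` may push `ω s u` far above `θ`.
    set S : Set ℝ := {u | u ∈ Icc s t ∧ ∀ w ∈ Ioo s u, ω s w ≤ θ} with hS
    have hsS : s ∈ S := ⟨⟨le_rfl, hst.le⟩, fun w hw => absurd hw.1 (not_lt.2 hw.2.le)⟩
    have hSv : ∀ u ∈ S, u ≤ v := fun u hu => not_lt.1 fun h => absurd (hu.2 v ⟨hv.1, h⟩)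
      (not_le.2 hvθ)
    have hbdd : BddAbove S := ⟨v, hSv⟩
    set u := sSup S with hu
    have hsu : s ≤ u := le_csSup hbdd hsS
    have huv : u ≤ v := csSup_le ⟨s, hsS⟩ hSv
    have hut : u < t := huv.trans_lt hv.2
    have hsmall : ∀ w ∈ Ioo s u, ω s w ≤ θ := by
      intro w hw
      obtain ⟨u', hu', hwu'⟩ := exists_lt_of_lt_csSup ⟨s, hsS⟩ hw.2
      exact hu'.2 w ⟨hw.1, hwu'⟩
    have hbig : ∀ w ∈ Ioo u t, θ < ω s w := by
      intro w hw
      by_contra hcon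
      push Not at hcon
      have : w ∈ S := by
        refine ⟨⟨hsu.trans hw.1.le, hw.2.le⟩, fun x hx => ?_⟩
        have := hsup s x w hs hx.1.le hx.2.le (hw.2.le.trans ht)
        linarith [h0 x w]
      exact absurd (le_csSup hbdd this) (not_le.2 hw.1)
    -- For `w > u` the control from `s` exceeds `θ`, which leaves at most `n * θ` for `[w, t]`;
    -- semicontinuity lets `w` decrease to `u`.
    have hun : ω u t ≤ n * θ := by
      refine le_of_forall_pos_le_add fun η hη => ?_
      obtain ⟨w, hw1, hw2⟩ := ((hlsc u t (hs.trans hsu) hut ht η hη).and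
        (Ioo_mem_nhdsGT hut)).exists
      have h1 := hsup s w t hs (hsu.trans hw2.1.le) hw2.2.le ht
      have h2 := hbig w hw2
      push_cast at hω
      linarith
    have hQ := ih u t (hs.trans hsu) hut ht hun
    -- The hypotheses on `ω` do not exclude an empty first piece; the induction hypothesis then
    -- already concerns `[s, t]`.
    rcases hsu.eq_or_lt with h | h
    · rw [← h] at hQ
      exact mono _ _ _ hQ
    · exact glue n s u t hs h hut ht (small s u hs h (hut.le.trans ht) hsmall) hQ

end RoughFDE

namespace RoughFDE

/-! ### Sewing: Young's estimate and existence of the sewn path -/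

section Sewing

variable {E : Type*} [NormedAddCommGroup E]

/-- The failure of additivity of a two-parameter function. -/
def defect (Ξ : ℝ → ℝ → E) (s u t : ℝ) : E := Ξ s t - Ξ s u - Ξ u t

theorem sum_remove_point (Ξ : ℝ → ℝ → E) (a : ℕ → ℝ) {n i : ℕ} (hi : i < n) :
    ∑ j ∈ Finset.range (n + 1), Ξ (a j) (a (j + 1)) =
      ∑ j ∈ Finset.range n, Ξ (a (if j ≤ i then j else j + 1))
        (a (if j + 1 ≤ i then j + 1 else j + 1 + 1)) - defect Ξ (a i) (a (i + 1)) (a (i + 2)) := by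
  obtain ⟨k, rfl⟩ : ∃ k, n = i + 1 + k := ⟨n - (i + 1), by omega⟩
  rw [show i + 1 + k + 1 = i + 1 + 1 + k by omega, Finset.sum_range_add,
    Finset.sum_range_add _ (i + 1) k, Finset.sum_range_succ _ (i + 1), Finset.sum_range_succ _ i,
    Finset.sum_range_succ _ i]
  have h1 : ∀ j ∈ Finset.range i, Ξ (a j) (a (j + 1)) =
      Ξ (a (if j ≤ i then j else j + 1)) (a (if j + 1 ≤ i then j + 1 else j + 1 + 1)) := by
    intro j hj
    have := Finset.mem_range.1 hj
    rw [if_pos (by omega), if_pos (by omega)]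
  have h2 : ∀ j ∈ Finset.range k, Ξ (a (i + 1 + 1 + j)) (a (i + 1 + 1 + j + 1)) =
      Ξ (a (if i + 1 + j ≤ i then i + 1 + j else i + 1 + j + 1))
        (a (if i + 1 + j + 1 ≤ i then i + 1 + j + 1 else i + 1 + j + 1 + 1)) := by
    intro j _
    rw [if_neg (by omega), if_neg (by omega)]
    congr 2 <;> ring_nf
  rw [Finset.sum_congr rfl h1, Finset.sum_congr rfl h2, if_pos le_rfl,
    if_neg (show ¬ (i + 1 ≤ i) by omega)]
  simp only [defect]
  abel

/-- Young's argument: of the `n + 1` interior points, one has a defect whose `r`-th power is at most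
the average `W / (n + 1)`. Removing it changes the sum by exactly that defect, and the procedure
repeats until one cell is left. -/
theorem norm_sum_sub_le_of_defect {Ξ : ℝ → ℝ → E} {u v W r : ℝ} (hr : 0 < r)
    (h : ∀ (a : ℕ → ℝ) (n : ℕ), IsGrid u v a →
      ∑ i ∈ Finset.range n, ‖defect Ξ (a i) (a (i + 1)) (a (i + 2))‖ ^ r ≤ W) (n : ℕ) :
    ∀ a : ℕ → ℝ, IsGrid u v a →
      ‖∑ i ∈ Finset.range (n + 1), Ξ (a i) (a (i + 1)) - Ξ (a 0) (a (n + 1))‖ ≤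
        ∑ i ∈ Finset.range n, (W / (i + 1)) ^ (1 / r) := by
  induction n with
  | zero => intro a _; simp
  | succ n ih =>
    intro a ha
    obtain ⟨i, hi, hle⟩ : ∃ i ∈ Finset.range (n + 1),
        ‖defect Ξ (a i) (a (i + 1)) (a (i + 2))‖ ^ r ≤ W / (n + 1) := by
      refine Finset.exists_le_of_sum_le ⟨0, by simp⟩ ((h a (n + 1) ha).trans (le_of_eq ?_))
      rw [Finset.sum_const, Finset.card_range, nsmul_eq_mul]
      push_cast
      field_simp
    have hi' := Finset.mem_range.1 hi
    have hle' : ‖defect Ξ (a i) (a (i + 1)) (a (i + 2))‖ ≤ (W / (n + 1)) ^ (1 / r) := by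
      calc ‖defect Ξ (a i) (a (i + 1)) (a (i + 2))‖
          = (‖defect Ξ (a i) (a (i + 1)) (a (i + 2))‖ ^ r) ^ (1 / r) := by
            rw [← Real.rpow_mul (norm_nonneg _), mul_one_div_cancel hr.ne', Real.rpow_one]
        _ ≤ _ := Real.rpow_le_rpow (by positivity) hle (by positivity)
    have hg : IsGrid u v (fun j => a (if j ≤ i then j else j + 1)) :=
      ⟨fun j k hjk => ha.mono (by split_ifs <;> omega), fun j => ha.mem _⟩
    have h1 := ih _ hg
    rw [sum_remove_point Ξ a hi', Finset.sum_range_succ (fun i : ℕ => (W / ((i : ℝ) + 1)) ^ (1 / r)) n]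
    have e0 : (if 0 ≤ i then 0 else 0 + 1) = 0 := by simp
    have e1 : (if n + 1 ≤ i then n + 1 else n + 1 + 1) = n + 1 + 1 := by
      rw [if_neg (by omega)]
    simp only [e0, e1] at h1
    rw [sub_right_comm]
    exact (norm_sub_le _ _).trans (add_le_add h1 hle')

/-- Hölder with exponents `3 / 2` and `3`, applied to `p / 3`-th powers: `p / 2`-variation times
`p`-variation has finite `p / 3`-variation. -/
theorem sum_mul_rpow_le {p : ℝ} {n : ℕ} {f g : ℕ → ℝ} {F G : ℝ}
    (hf : ∀ i, 0 ≤ f i) (hg : ∀ i, 0 ≤ g i) (hF : 0 ≤ F) (hG : 0 ≤ G)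
    (h1 : ∑ i ∈ Finset.range n, f i ^ (p / 2) ≤ F ^ (p / 2))
    (h2 : ∑ i ∈ Finset.range n, g i ^ p ≤ G ^ p) :
    ∑ i ∈ Finset.range n, (f i * g i) ^ (p / 3) ≤ (F * G) ^ (p / 3) := by
  have hH : Real.HolderConjugate (3 / 2) 3 := by
    rw [Real.holderConjugate_iff]; norm_num
  have h := Real.inner_le_Lp_mul_Lq_of_nonneg (Finset.range n) hH
    (f := fun i => f i ^ (p / 3)) (g := fun i => g i ^ (p / 3))
    (fun i _ => Real.rpow_nonneg (hf i) _) (fun i _ => Real.rpow_nonneg (hg i) _)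
  have e1 : ∀ i, (f i ^ (p / 3)) ^ (3 / 2 : ℝ) = f i ^ (p / 2) := fun i => by
    rw [← Real.rpow_mul (hf i)]; congr 1; ring
  have e2 : ∀ i, (g i ^ (p / 3)) ^ (3 : ℝ) = g i ^ p := fun i => by
    rw [← Real.rpow_mul (hg i)]; congr 1; ring
  simp only [e1, e2] at h
  simp_rw [Real.mul_rpow (hf _) (hg _)]
  refine h.trans ?_
  rw [Real.mul_rpow hF hG]
  have k1 : F ^ (p / 3) = (F ^ (p / 2)) ^ (1 / (3 / 2) : ℝ) := by
    rw [← Real.rpow_mul hF]; congr 1; ring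
  have k2 : G ^ (p / 3) = (G ^ p) ^ (1 / 3 : ℝ) := by
    rw [← Real.rpow_mul hG]; congr 1; ring
  rw [k1, k2]
  have n1 : 0 ≤ ∑ i ∈ Finset.range n, f i ^ (p / 2) :=
    Finset.sum_nonneg fun i _ => Real.rpow_nonneg (hf i) _
  have n2 : 0 ≤ ∑ i ∈ Finset.range n, g i ^ p :=
    Finset.sum_nonneg fun i _ => Real.rpow_nonneg (hg i) _
  gcongr

/-- The constant in the sewing estimate. -/
noncomputable def sewConst (p : ℝ) : ℝ :=
  (2 : ℝ) ^ (3 / p) * ∑' n : ℕ, (1 / ((n : ℝ) + 1)) ^ (3 / p)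

theorem sewConst_nonneg (p : ℝ) : 0 ≤ sewConst p :=
  mul_nonneg (by positivity) (tsum_nonneg fun n => by positivity)

theorem summable_sewConst {p : ℝ} (hp : 0 < p) (hp3 : p < 3) :
    Summable fun n : ℕ => (1 / ((n : ℝ) + 1)) ^ (3 / p) := by
  have h := (Real.summable_one_div_nat_rpow (p := 3 / p)).2 ((one_lt_div hp).2 hp3)
  refine ((summable_nat_add_iff 1).2 h).congr fun n => ?_
  rw [Real.div_rpow (by positivity) (by positivity), Real.one_rpow]
  push_cast
  rfl

variable {E₁ E₂ E₃ E₄ : Type*} [NormedAddCommGroup E₁] [NormedAddCommGroup E₂]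
  [NormedAddCommGroup E₃] [NormedAddCommGroup E₄]

/-- Young's argument with `r = p / 3 < 1`. Subadditivity of `x ^ (p / 3)` separates the two
products, which produces the factor `2`, and the average defects sum to a convergent series because
`3 / p > 1`. -/
theorem norm_sum_sub_le {p : ℝ} (hp : 0 < p) (hp3 : p < 3) {Ξ : ℝ → ℝ → E}
    {f₁ : ℝ → ℝ → E₁} {g₁ : ℝ → ℝ → E₂} {f₂ : ℝ → ℝ → E₃} {g₂ : ℝ → ℝ → E₄}
    {u v F₁ G₁ F₂ G₂ : ℝ}
    (hΞ : ∀ x ∈ Icc u v, Ξ x x = 0)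
    (hd : ∀ x y z, u ≤ x → x ≤ y → y ≤ z → z ≤ v →
      ‖defect Ξ x y z‖ ≤ ‖f₁ x y‖ * ‖g₁ y z‖ + ‖f₂ x y‖ * ‖g₂ y z‖)
    (hf₁ : VarLE (p / 2) f₁ u v F₁) (hg₁ : VarLE p g₁ u v G₁)
    (hf₂ : VarLE p f₂ u v F₂) (hg₂ : VarLE (p / 2) g₂ u v G₂)
    {a : ℕ → ℝ} (ha : IsGrid u v a) (n : ℕ) :
    ‖∑ i ∈ Finset.range n, Ξ (a i) (a (i + 1)) - Ξ (a 0) (a n)‖ ≤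
      sewConst p * (F₁ * G₁ + F₂ * G₂) := by
  have n1 := hf₁.1
  have n2 := hg₁.1
  have n3 := hf₂.1
  have n4 := hg₂.1
  set K := F₁ * G₁ + F₂ * G₂ with hK
  have hK0 : 0 ≤ K := by positivity
  rcases Nat.eq_zero_or_pos n with rfl | hn
  · simpa [hΞ _ (ha.mem 0)] using mul_nonneg (sewConst_nonneg p) hK0
  obtain ⟨m, rfl⟩ : ∃ m, n = m + 1 := ⟨n - 1, by omega⟩
  have key : ∀ (a : ℕ → ℝ) (n : ℕ), IsGrid u v a →
      ∑ i ∈ Finset.range n, ‖defect Ξ (a i) (a (i + 1)) (a (i + 2))‖ ^ (p / 3) ≤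
        2 * K ^ (p / 3) := by
    intro a n ha
    have s1 := sum_mul_rpow_le (n := n) (f := fun i => ‖f₁ (a i) (a (i + 1))‖)
      (g := fun i => ‖g₁ (a (i + 1)) (a (i + 2))‖) (fun _ => norm_nonneg _)
      (fun _ => norm_nonneg _) n1 n2 (hf₁.2 a n ha) (hg₁.2 _ n (ha.shift 1))
    have s2 := sum_mul_rpow_le (n := n) (g := fun i => ‖f₂ (a i) (a (i + 1))‖)
      (f := fun i => ‖g₂ (a (i + 1)) (a (i + 2))‖) (fun _ => norm_nonneg _)
      (fun _ => norm_nonneg _) n4 n3 (hg₂.2 _ n (ha.shift 1)) (hf₂.2 a n ha)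
    have hp3' : 0 ≤ p / 3 := by positivity
    calc ∑ i ∈ Finset.range n, ‖defect Ξ (a i) (a (i + 1)) (a (i + 2))‖ ^ (p / 3)
        ≤ ∑ i ∈ Finset.range n,
            ((‖f₁ (a i) (a (i + 1))‖ * ‖g₁ (a (i + 1)) (a (i + 2))‖) ^ (p / 3) +
              (‖g₂ (a (i + 1)) (a (i + 2))‖ * ‖f₂ (a i) (a (i + 1))‖) ^ (p / 3)) := by
          refine Finset.sum_le_sum fun i _ => ?_
          refine (Real.rpow_le_rpow (norm_nonneg _) (hd _ _ _ (ha.mem i).1 (ha.le_succ i)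
            (ha.le_succ (i + 1)) (ha.mem _).2) hp3').trans ?_
          rw [mul_comm ‖f₂ _ _‖]
          exact Real.rpow_add_le_add_rpow (by positivity) (by positivity) hp3' (by linarith)
      _ ≤ (F₁ * G₁) ^ (p / 3) + (G₂ * F₂) ^ (p / 3) := by
          rw [Finset.sum_add_distrib]; exact add_le_add s1 s2
      _ ≤ K ^ (p / 3) + K ^ (p / 3) := by
          have i1 : F₁ * G₁ ≤ K := le_add_of_nonneg_right (by positivity)
          have i2 : G₂ * F₂ ≤ K := by rw [mul_comm]; exact le_add_of_nonneg_left (by positivity)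
          gcongr
      _ = 2 * K ^ (p / 3) := by ring
  refine (norm_sum_sub_le_of_defect (by positivity) key m a ha).trans ?_
  have hterm : ∀ i : ℕ, (2 * K ^ (p / 3) / ((i : ℝ) + 1)) ^ (1 / (p / 3)) =
      (2 : ℝ) ^ (3 / p) * K * (1 / ((i : ℝ) + 1)) ^ (3 / p) := by
    intro i
    rw [show 1 / (p / 3) = 3 / p by field_simp, div_eq_mul_one_div,
      Real.mul_rpow (by positivity) (by positivity), Real.mul_rpow (by positivity) (by positivity),
      ← Real.rpow_mul hK0, show p / 3 * (3 / p) = 1 by field_simp, Real.rpow_one]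
  simp_rw [hterm]
  rw [← Finset.mul_sum, sewConst]
  have := (summable_sewConst hp hp3).sum_le_tsum (Finset.range m) fun i _ => by positivity
  calc _ ≤ (2 : ℝ) ^ (3 / p) * K * ∑' n : ℕ, (1 / ((n : ℝ) + 1)) ^ (3 / p) := by gcongr
    _ = _ := by ring

/-- For every finite set of points there is a partition of `[0, T]` that contains it. -/
theorem exists_grid_of_finset {T : ℝ} (hT : 0 ≤ T) (D : Finset ℝ) :
    ∃ (c : ℕ → ℝ) (n : ℕ), IsGrid 0 T c ∧ c 0 = 0 ∧ c n = T ∧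
      ∀ x ∈ D, x ∈ Icc 0 T → ∃ i, c i = x := by
  classical
  set D' : Finset ℝ := insert 0 (D.filter (· ∈ Icc 0 T)) with hD'
  have hm : ∀ x ∈ D', x ∈ Icc 0 T := by
    intro x hx
    rcases Finset.mem_insert.1 hx with rfl | hx
    · exact ⟨le_rfl, hT⟩
    · exact (Finset.mem_filter.1 hx).2
  set k := D'.card with hk
  have hk0 : 0 < k := Finset.card_pos.2 ⟨0, Finset.mem_insert_self _ _⟩
  let e := D'.orderEmbOfFin hk.symm
  have he : ∀ j, e j ∈ Icc 0 T := fun j => hm _ (Finset.orderEmbOfFin_mem _ _ _)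
  have hsurj : ∀ x ∈ D', ∃ j, e j = x := fun x hx => by
    have : x ∈ Set.range e := by rw [Finset.range_orderEmbOfFin]; exact hx
    exact this
  refine ⟨fun i => if h : i < k then e ⟨i, h⟩ else T, k, ⟨?_, ?_⟩, ?_, by simp, ?_⟩
  · refine monotone_nat_of_le_succ fun i => ?_
    by_cases h1 : i + 1 < k
    · simp only [h1, show i < k by omega, dif_pos]
      exact e.monotone (by simp)
    · simp only [h1, dif_neg, not_false_eq_true]
      split_ifs
      · exact (he _).2
      · exact le_rfl
  · intro i
    split_ifs
    · exact he _
    · exact ⟨hT, le_rfl⟩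
  · simp only [hk0, dif_pos]
    obtain ⟨j, hj⟩ := hsurj 0 (Finset.mem_insert_self _ _)
    refine le_antisymm ?_ (he _).1
    rw [← hj]
    exact e.monotone (Nat.zero_le _)
  · intro x hx hxT
    obtain ⟨j, hj⟩ := hsurj x (Finset.mem_insert_of_mem (Finset.mem_filter.2 ⟨hx, hxT⟩))
    exact ⟨j, by simp [hj]⟩

/-- Sewing: an almost additive function is close to the increments of a path. -/
theorem exists_additive [ProperSpace E] {T : ℝ} (hT : 0 ≤ T) {Ξ : ℝ → ℝ → E}
    {B : ℝ → ℝ → ℝ} (hΞ : ∀ x ∈ Icc 0 T, Ξ x x = 0)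
    (hB : ∀ u v, 0 ≤ u → u ≤ v → v ≤ T → ∀ (a : ℕ → ℝ) (n : ℕ), IsGrid u v a →
      ‖∑ i ∈ Finset.range n, Ξ (a i) (a (i + 1)) - Ξ (a 0) (a n)‖ ≤ B u v) :
    ∃ J : ℝ → E, ∀ u v, 0 ≤ u → u ≤ v → v ≤ T → ‖J v - J u - Ξ u v‖ ≤ B u v := by
  choose c n hc hc0 hcn hcD using fun D : Finset ℝ => exists_grid_of_finset hT D
  let cl : ℝ → ℝ → ℝ → ℝ := fun u v x => max u (min x v)
  have hclm : ∀ u v, Monotone (cl u v) := fun u v x y hxy =>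
    max_le_max le_rfl (min_le_min hxy le_rfl)
  let S : Finset ℝ → ℝ → ℝ → E := fun D u v =>
    ∑ i ∈ Finset.range (n D), Ξ (cl u v (c D i)) (cl u v (c D (i + 1)))
  have hS : ∀ D u v, 0 ≤ u → u ≤ v → v ≤ T → ‖S D u v - Ξ u v‖ ≤ B u v := by
    intro D u v hu huv hv
    have hg : IsGrid u v (fun i => cl u v (c D i)) :=
      (hc D).comp_mono (hclm u v) fun x _ => ⟨le_max_left _ _, max_le huv (min_le_right _ _)⟩
    have h := hB u v hu huv hv _ (n D) hg
    have e0 : cl u v (c D 0) = u := by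
      simp only [cl, hc0]; rw [min_eq_left (hu.trans huv), max_eq_left hu]
    have e1 : cl u v (c D (n D)) = v := by
      simp only [cl, hcn]; rw [min_eq_right hv, max_eq_right huv]
    rw [e0, e1] at h
    exact h
  -- Since `u` is a grid point, every cell lies on one side of it, and its clamp to the other side
  -- is degenerate.
  have hadd : ∀ D u v, u ∈ D → 0 ≤ u → u ≤ v → v ≤ T → S D 0 u + S D u v = S D 0 v := by
    intro D u v hD hu huv hv
    obtain ⟨j, hj⟩ := hcD D u hD ⟨hu, huv.trans hv⟩
    simp only [S]
    rw [← Finset.sum_add_distrib]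
    refine Finset.sum_congr rfl fun i _ => ?_
    have hm0 := (hc D).mem i
    have hm1 := (hc D).mem (i + 1)
    rcases Nat.lt_or_ge i j with h | h
    · have h2 : c D (i + 1) ≤ u := hj ▸ (hc D).mono (show i + 1 ≤ j by omega)
      have h1 : c D i ≤ u := ((hc D).le_succ i).trans h2
      simp only [cl, min_eq_left h1, min_eq_left h2, min_eq_left (h1.trans huv),
        min_eq_left (h2.trans huv), max_eq_left h1, max_eq_left h2]
      rw [hΞ u ⟨hu, huv.trans hv⟩, add_zero]
    · have h1 : u ≤ c D i := hj ▸ (hc D).mono h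
      have h2 : u ≤ c D (i + 1) := h1.trans ((hc D).le_succ i)
      simp only [cl, min_eq_right h1, min_eq_right h2, max_eq_right hu,
        max_eq_right (le_min h1 huv), max_eq_right (le_min h2 huv),
        max_eq_right (le_min hm0.1 (hu.trans huv)), max_eq_right (le_min hm1.1 (hu.trans huv))]
      rw [hΞ u ⟨hu, huv.trans hv⟩, zero_add]
  -- The sums stay in a fixed closed ball, so an ultrafilter finer than `atTop` has limits by
  -- compactness and no Cauchy estimate is needed. Each `u` eventually belongs to `D`, from where on
  -- additivity at `u` is exact.
  let U : Ultrafilter (Finset ℝ) := Ultrafilter.of atTop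
  have hlim : ∀ t, ∃ l : E, t ∈ Icc 0 T → Tendsto (fun D => S D 0 t) U (𝓝 l) := by
    intro t
    by_cases ht : t ∈ Icc 0 T
    · have hmem : ∀ D, S D 0 t ∈ Metric.closedBall (Ξ 0 t) (B 0 t) := fun D => by
        rw [mem_closedBall_iff_norm]; exact hS D 0 t le_rfl ht.1 ht.2
      obtain ⟨l, _, hl⟩ := (isCompact_closedBall (Ξ 0 t) (B 0 t)).ultrafilter_le_nhds
        (U.map fun D => S D 0 t) (le_principal_iff.2 (Filter.mem_map.2 (Eventually.of_forall hmem)))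
      exact ⟨l, fun _ => hl⟩
    · exact ⟨0, fun h => absurd h ht⟩
  choose J hJ using hlim
  refine ⟨J, fun u v hu huv hv => ?_⟩
  have h1 : Tendsto (fun D => ‖S D 0 v - S D 0 u - Ξ u v‖) U (𝓝 ‖J v - J u - Ξ u v‖) :=
    (((hJ v ⟨hu.trans huv, hv⟩).sub (hJ u ⟨hu, huv.trans hv⟩)).sub_const _).norm
  refine le_of_tendsto h1 ?_
  have h2 : ∀ᶠ D in (U : Filter (Finset ℝ)), u ∈ D := by
    have : ∀ᶠ D in (atTop : Filter (Finset ℝ)), u ∈ D :=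
      (eventually_ge_atTop {u}).mono fun D hD => hD (Finset.mem_singleton_self u)
    exact (Ultrafilter.of_le atTop) this
  filter_upwards [h2] with D hD
  rw [← hadd D u v hD hu huv hv, add_sub_cancel_left]
  exact hS D u v hu huv hv

end Sewing

end RoughFDE

namespace RoughFDE

/-! ### Convergence of Riemann sums as the mesh tends to zero -/

section MeshConvergence

variable {E E₁ E₂ E₃ E₄ : Type*} [NormedAddCommGroup E] [NormedAddCommGroup E₁]
  [NormedAddCommGroup E₂] [NormedAddCommGroup E₃] [NormedAddCommGroup E₄]

/-- A two-parameter function whose defect is controlled by products of functions of finite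
variation with complementary exponents. -/
structure IsSewable (p T : ℝ) (Ξ : ℝ → ℝ → E) (f₁ : ℝ → ℝ → E₁) (g₁ : ℝ → ℝ → E₂)
    (f₂ : ℝ → ℝ → E₃) (g₂ : ℝ → ℝ → E₄) : Prop where
  defect_le : ∀ x y z, 0 ≤ x → x ≤ y → y ≤ z → z ≤ T →
    ‖defect Ξ x y z‖ ≤ ‖f₁ x y‖ * ‖g₁ y z‖ + ‖f₂ x y‖ * ‖g₂ y z‖
  fin_f₁ : FinVar (p / 2) f₁ 0 T
  fin_g₁ : FinVar p g₁ 0 T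
  fin_f₂ : FinVar p f₂ 0 T
  fin_g₂ : FinVar (p / 2) g₂ 0 T
  cont_f₁ : RightContLeft f₁ 0 T
  cont_g₁ : RightContLeft g₁ 0 T
  cont_f₂ : RightContLeft f₂ 0 T
  cont_g₂ : RightContLeft g₂ 0 T

/-- The bound in the sewing estimate. -/
noncomputable def sewBound (p : ℝ) (f₁ : ℝ → ℝ → E₁) (g₁ : ℝ → ℝ → E₂) (f₂ : ℝ → ℝ → E₃)
    (g₂ : ℝ → ℝ → E₄) (u v : ℝ) : ℝ :=
  sewConst p * (var (p / 2) (trunc v f₁) u v * var p g₁ u v +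
    var p (trunc v f₂) u v * var (p / 2) g₂ u v)

variable {p T : ℝ} {Ξ : ℝ → ℝ → E} {f₁ : ℝ → ℝ → E₁} {g₁ : ℝ → ℝ → E₂} {f₂ : ℝ → ℝ → E₃}
  {g₂ : ℝ → ℝ → E₄}

namespace IsSewable

theorem diag (h : IsSewable p T Ξ f₁ g₁ f₂ g₂) (x : ℝ) (hx : x ∈ Icc 0 T) : Ξ x x = 0 := by
  have := h.defect_le x x x hx.1 le_rfl le_rfl hx.2
  rw [h.fin_f₁.diag x hx, h.fin_f₂.diag x hx] at this
  simpa [defect] using this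

theorem exists_path [ProperSpace E] (hp : 0 < p) (hp3 : p < 3) (hT : 0 ≤ T)
    (h : IsSewable p T Ξ f₁ g₁ f₂ g₂) :
    ∃ J : ℝ → E, ∀ u v, 0 ≤ u → u ≤ v → v ≤ T →
      ‖J v - J u - Ξ u v‖ ≤ sewBound p f₁ g₁ f₂ g₂ u v := by
  refine exists_additive hT h.diag fun u v hu huv hv a n ha => ?_
  have hp2 : 0 < p / 2 := by positivity
  refine norm_sum_sub_le hp hp3 (fun x hx => h.diag x (Icc_subset_Icc hu hv hx)) ?_
    (((h.fin_f₁.trunc hp2 v).mono hp2 hu hv).varLE hp2) ((h.fin_g₁.mono hp hu hv).varLE hp)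
    (((h.fin_f₂.trunc hp v).mono hp hu hv).varLE hp) ((h.fin_g₂.mono hp2 hu hv).varLE hp2) ha n
  intro x y z hx hxy hyz hz
  -- If the middle point `y` is the right endpoint, the defect vanishes. Hence the left factors
  -- matter only on cells ending before `v`, and their truncated variation suffices.
  rcases (hyz.trans hz).lt_or_eq with hy | rfl
  · rw [trunc_of_lt hy, trunc_of_lt hy]
    exact h.defect_le x y z (hu.trans hx) hxy hyz (hz.trans hv)
  · obtain rfl := le_antisymm hyz hz
    have : defect Ξ x y y = 0 := by
      simp [defect, h.diag y ⟨hu.trans huv, hv⟩]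
    rw [this, norm_zero]
    positivity

/-- The sum of the variations of the four functions that control the defect. -/
noncomputable def control (_ : IsSewable p T Ξ f₁ g₁ f₂ g₂) (s t : ℝ) : ℝ :=
  var (p / 2) f₁ s t ^ (p / 2) + var p g₁ s t ^ p + var p f₂ s t ^ p +
    var (p / 2) g₂ s t ^ (p / 2)

theorem control_superadditive (h : IsSewable p T Ξ f₁ g₁ f₂ g₂) (hp : 0 < p) {s u t : ℝ}
    (hs : 0 ≤ s) (hsu : s ≤ u) (hut : u ≤ t) (ht : t ≤ T) :
    h.control s u + h.control u t ≤ h.control s t := by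
  have hp2 : 0 < p / 2 := by positivity
  have h1 := (h.fin_f₁.mono hp2 hs ht).superadditive hp2 hsu hut
  have h2 := (h.fin_g₁.mono hp hs ht).superadditive hp hsu hut
  have h3 := (h.fin_f₂.mono hp hs ht).superadditive hp hsu hut
  have h4 := (h.fin_g₂.mono hp2 hs ht).superadditive hp2 hsu hut
  unfold control
  linarith

theorem control_nonneg (h : IsSewable p T Ξ f₁ g₁ f₂ g₂) (s t : ℝ) : 0 ≤ h.control s t := by
  have k : ∀ x y : ℝ, 0 ≤ x → 0 ≤ x ^ y := fun x y hx => Real.rpow_nonneg hx y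
  unfold control
  have := k _ (p / 2) (var_nonneg (p / 2) f₁ s t)
  have := k _ p (var_nonneg p g₁ s t)
  have := k _ p (var_nonneg p f₂ s t)
  have := k _ (p / 2) (var_nonneg (p / 2) g₂ s t)
  linarith

theorem control_lsc (h : IsSewable p T Ξ f₁ g₁ f₂ g₂) (hp : 0 < p) {u t : ℝ}
    (hu : 0 ≤ u) (hut : u < t) (ht : t ≤ T) {η : ℝ} (hη : 0 < η) :
    ∀ᶠ v in 𝓝[>] u, h.control u t ≤ h.control v t + η := by
  have hp2 : 0 < p / 2 := by positivity
  have hη4 : 0 < η / 4 := by positivity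
  filter_upwards [(h.fin_f₁.mono hp2 le_rfl ht).eventually_le hp2
      (fun u v hu huv hv => h.cont_f₁ u v hu huv (hv.trans ht)) hu hut hη4,
    (h.fin_g₁.mono hp le_rfl ht).eventually_le hp
      (fun u v hu huv hv => h.cont_g₁ u v hu huv (hv.trans ht)) hu hut hη4,
    (h.fin_f₂.mono hp le_rfl ht).eventually_le hp
      (fun u v hu huv hv => h.cont_f₂ u v hu huv (hv.trans ht)) hu hut hη4,
    (h.fin_g₂.mono hp2 le_rfl ht).eventually_le hp2
      (fun u v hu huv hv => h.cont_g₂ u v hu huv (hv.trans ht)) hu hut hη4] with v h1 h2 h3 h4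
  unfold control
  linarith

end IsSewable

/-- The product has homogeneity `2 / p + 1 / p = 3 / p` in the control. One full power is kept for
summation, and the excess `3 / p - 1` is spent on the smallness of `x`, the truncated factor. The
primed version exchanges the roles of the exponents. -/
theorem mul_le_rpow_mul {p x y ω θ : ℝ} (hp1 : 1 ≤ p) (hp3 : p < 3) (hx : 0 ≤ x)
    (hy : 0 ≤ y) (hω : 0 ≤ ω) (hxθ : x ^ (p / 2) ≤ θ) (hxω : x ^ (p / 2) ≤ ω)
    (hyω : y ^ p ≤ ω) : x * y ≤ θ ^ (3 / p - 1) * ω := by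
  have hp : 0 < p := by linarith
  have hX : 0 ≤ x ^ (p / 2) := Real.rpow_nonneg hx _
  have hκ : 0 < 3 / p - 1 := by rw [sub_pos, one_lt_div hp]; exact hp3
  have h1 : 0 ≤ 1 - 1 / p := by rw [sub_nonneg, div_le_one hp]; exact hp1
  have e1 : x = (x ^ (p / 2)) ^ (3 / p - 1) * (x ^ (p / 2)) ^ (1 - 1 / p) := by
    rcases hx.eq_or_lt with rfl | hx0
    · rw [Real.zero_rpow (by positivity), Real.zero_rpow hκ.ne', zero_mul]
    · rw [← Real.rpow_add (by positivity), ← Real.rpow_mul hx,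
        show p / 2 * (3 / p - 1 + (1 - 1 / p)) = 1 by field_simp; ring, Real.rpow_one]
  have e2 : y = (y ^ p) ^ (1 / p) := by
    rw [← Real.rpow_mul hy, mul_one_div_cancel hp.ne', Real.rpow_one]
  have e3 : ω ^ (1 - 1 / p) * ω ^ (1 / p) = ω := by
    rcases hω.eq_or_lt with rfl | hω0
    · rw [Real.zero_rpow (x := 1 / p) (by positivity), mul_zero]
    · rw [← Real.rpow_add hω0]; simp
  calc x * y = (x ^ (p / 2)) ^ (3 / p - 1) * (x ^ (p / 2)) ^ (1 - 1 / p) * (y ^ p) ^ (1 / p) := by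
        rw [← e1, ← e2]
    _ ≤ θ ^ (3 / p - 1) * ω ^ (1 - 1 / p) * ω ^ (1 / p) := by
        have := hX.trans hxθ
        gcongr
    _ = θ ^ (3 / p - 1) * ω := by rw [mul_assoc, e3]

theorem mul_le_rpow_mul' {p x y ω θ : ℝ} (hp2 : 2 ≤ p) (hp3 : p < 3) (hx : 0 ≤ x)
    (hy : 0 ≤ y) (hω : 0 ≤ ω) (hxθ : x ^ p ≤ θ) (hxω : x ^ p ≤ ω)
    (hyω : y ^ (p / 2) ≤ ω) : x * y ≤ θ ^ (3 / p - 1) * ω := by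
  have hp : 0 < p := by linarith
  have hX : 0 ≤ x ^ p := Real.rpow_nonneg hx _
  have hκ : 0 < 3 / p - 1 := by rw [sub_pos, one_lt_div hp]; exact hp3
  have h1 : 0 ≤ 1 - 2 / p := by rw [sub_nonneg, div_le_one hp]; exact hp2
  have e1 : x = (x ^ p) ^ (3 / p - 1) * (x ^ p) ^ (1 - 2 / p) := by
    rcases hx.eq_or_lt with rfl | hx0
    · rw [Real.zero_rpow (by positivity), Real.zero_rpow hκ.ne', zero_mul]
    · rw [← Real.rpow_add (by positivity), ← Real.rpow_mul hx,
        show p * (3 / p - 1 + (1 - 2 / p)) = 1 by field_simp; ring, Real.rpow_one]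
  have e2 : y = (y ^ (p / 2)) ^ (2 / p) := by
    rw [← Real.rpow_mul hy, show p / 2 * (2 / p) = 1 by field_simp, Real.rpow_one]
  have e3 : ω ^ (1 - 2 / p) * ω ^ (2 / p) = ω := by
    rcases hω.eq_or_lt with rfl | hω0
    · rw [Real.zero_rpow (x := 2 / p) (by positivity), mul_zero]
    · rw [← Real.rpow_add hω0]; simp
  calc x * y = (x ^ p) ^ (3 / p - 1) * (x ^ p) ^ (1 - 2 / p) * (y ^ (p / 2)) ^ (2 / p) := by
        rw [← e1, ← e2]
    _ ≤ θ ^ (3 / p - 1) * ω ^ (1 - 2 / p) * ω ^ (2 / p) := by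
        have := hX.trans hxθ
        gcongr
    _ = θ ^ (3 / p - 1) * ω := by rw [mul_assoc, e3]

namespace IsSewable

/-- On every cell the sewing bound is a small constant times the control of the cell, and
superadditivity sums the controls. Truncation lets smallness on `[s, t)` serve cells that end at `t`
too. -/
theorem norm_sum_sub_le_of_small (h : IsSewable p T Ξ f₁ g₁ f₂ g₂) (hp : 2 < p) (hp3 : p < 3)
    {J : ℝ → E}
    (hJ : ∀ u v, 0 ≤ u → u ≤ v → v ≤ T → ‖J v - J u - Ξ u v‖ ≤ sewBound p f₁ g₁ f₂ g₂ u v)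
    {s t θ : ℝ} (hs : 0 ≤ s) (hst : s < t) (ht : t ≤ T) (hθ0 : 0 ≤ θ)
    (hθ : ∀ u ∈ Ioo s t, h.control s u ≤ θ) {a : ℕ → ℝ} (ha : IsGrid s t a) (n : ℕ) :
    ‖∑ i ∈ Finset.range n, Ξ (a i) (a (i + 1)) - (J (a n) - J (a 0))‖ ≤
      2 * sewConst p * θ ^ (3 / p - 1) * h.control s t := by
  have hp0 : 0 < p := by linarith
  have hp2 : 0 < p / 2 := by positivity
  have hc : ∀ x y : ℝ, var (p / 2) f₁ x y ^ (p / 2) ≤ h.control x y ∧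
      var p g₁ x y ^ p ≤ h.control x y ∧ var p f₂ x y ^ p ≤ h.control x y ∧
      var (p / 2) g₂ x y ^ (p / 2) ≤ h.control x y := by
    intro x y
    have k1 := Real.rpow_nonneg (var_nonneg (p / 2) f₁ x y) (p / 2)
    have k2 := Real.rpow_nonneg (var_nonneg p g₁ x y) p
    have k3 := Real.rpow_nonneg (var_nonneg p f₂ x y) p
    have k4 := Real.rpow_nonneg (var_nonneg (p / 2) g₂ x y) (p / 2)
    unfold control
    refine ⟨?_, ?_, ?_, ?_⟩ <;> linarith
  have pow_le : ∀ {q x : ℝ}, 0 < q → 0 ≤ x → x ^ q ≤ θ → x ≤ θ ^ (1 / q) := by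
    intro q x hq hx hxθ
    calc x = (x ^ q) ^ (1 / q) := by rw [← Real.rpow_mul hx, mul_one_div_cancel hq.ne', Real.rpow_one]
      _ ≤ _ := Real.rpow_le_rpow (by positivity) hxθ (by positivity)
  have le_pow : ∀ {q x : ℝ}, 0 < q → 0 ≤ x → x ≤ θ ^ (1 / q) → x ^ q ≤ θ := by
    intro q x hq hx hxθ
    calc x ^ q ≤ (θ ^ (1 / q)) ^ q := Real.rpow_le_rpow hx hxθ hq.le
      _ = θ := by rw [← Real.rpow_mul hθ0, one_div_mul_cancel hq.ne', Real.rpow_one]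
  have hF₁ : VarLE (p / 2) (trunc t f₁) s t (θ ^ (1 / (p / 2))) :=
    varLE_trunc hp2 hst fun u hu => ((h.fin_f₁.mono hp2 hs (hu.2.le.trans ht)).varLE hp2).le hp2
      (pow_le hp2 (var_nonneg _ _ _ _) ((hc s u).1.trans (hθ u hu)))
  have hF₂ : VarLE p (trunc t f₂) s t (θ ^ (1 / p)) :=
    varLE_trunc hp0 hst fun u hu => ((h.fin_f₂.mono hp0 hs (hu.2.le.trans ht)).varLE hp0).le hp0
      (pow_le hp0 (var_nonneg _ _ _ _) ((hc s u).2.2.1.trans (hθ u hu)))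
  have cell : ∀ x y, s ≤ x → x ≤ y → y ≤ t →
      ‖J y - J x - Ξ x y‖ ≤ 2 * sewConst p * θ ^ (3 / p - 1) * h.control x y := by
    intro x y hx hxy hy
    have hx0 := hs.trans hx
    have hyT := hy.trans ht
    refine (hJ x y hx0 hxy hyT).trans ?_
    have b1 : VarLE (p / 2) (trunc y f₁) x y (θ ^ (1 / (p / 2))) :=
      (hF₁.mono hx hy).of_norm_le hp2 fun _ _ _ _ _ => norm_trunc_mono hy _ _ _
    have b2 : VarLE p (trunc y f₂) x y (θ ^ (1 / p)) :=
      (hF₂.mono hx hy).of_norm_le hp0 fun _ _ _ _ _ => norm_trunc_mono hy _ _ _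
    have b3 : VarLE (p / 2) (trunc y f₁) x y (var (p / 2) f₁ x y) :=
      ((h.fin_f₁.mono hp2 hx0 hyT).varLE hp2).trunc hp2 y
    have b4 : VarLE p (trunc y f₂) x y (var p f₂ x y) :=
      ((h.fin_f₂.mono hp0 hx0 hyT).varLE hp0).trunc hp0 y
    have c1 := mul_le_rpow_mul (by linarith) hp3 (var_nonneg (p / 2) (trunc y f₁) x y)
      (var_nonneg p g₁ x y) (h.control_nonneg x y)
      (le_pow hp2 (var_nonneg _ _ _ _) (b1.var_le hp2))
      ((Real.rpow_le_rpow (var_nonneg _ _ _ _) (b3.var_le hp2) hp2.le).trans (hc x y).1)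
      (hc x y).2.1
    have c2 := mul_le_rpow_mul' hp.le hp3 (var_nonneg p (trunc y f₂) x y)
      (var_nonneg (p / 2) g₂ x y) (h.control_nonneg x y)
      (le_pow hp0 (var_nonneg _ _ _ _) (b2.var_le hp0))
      ((Real.rpow_le_rpow (var_nonneg _ _ _ _) (b4.var_le hp0) hp0.le).trans (hc x y).2.2.1)
      (hc x y).2.2.2
    calc sewBound p f₁ g₁ f₂ g₂ x y ≤ sewConst p * (θ ^ (3 / p - 1) * h.control x y +
          θ ^ (3 / p - 1) * h.control x y) :=
          mul_le_mul_of_nonneg_left (add_le_add c1 c2) (sewConst_nonneg p)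
      _ = _ := by ring
  have htel : ∑ i ∈ Finset.range n, (J (a (i + 1)) - J (a i)) = J (a n) - J (a 0) :=
    Finset.sum_range_sub (fun i => J (a i)) n
  rw [← htel, ← Finset.sum_sub_distrib]
  have hC : 0 ≤ 2 * sewConst p * θ ^ (3 / p - 1) := by
    have := sewConst_nonneg p
    positivity
  calc _ ≤ ∑ i ∈ Finset.range n, ‖Ξ (a i) (a (i + 1)) - (J (a (i + 1)) - J (a i))‖ :=
        norm_sum_le _ _
    _ ≤ ∑ i ∈ Finset.range n, 2 * sewConst p * θ ^ (3 / p - 1) * h.control (a i) (a (i + 1)) := by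
        refine Finset.sum_le_sum fun i _ => ?_
        rw [norm_sub_rev]
        exact cell _ _ (ha.mem i).1 (ha.le_succ i) (ha.mem _).2
    _ = 2 * sewConst p * θ ^ (3 / p - 1) *
        ∑ i ∈ Finset.range n, h.control (a i) (a (i + 1)) := by rw [Finset.mul_sum]
    _ ≤ _ := mul_le_mul_of_nonneg_left (sum_le_of_superadditive h.control_nonneg
        (fun x u y hx hxu huy hy => h.control_superadditive hp0 (hs.trans hx) hxu huy (hy.trans ht))
        ha n) hC

/-- The right factors have vanishing variation over `[u, y]` as `y` decreases to `u`, while the left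
factors are merely bounded. So `x` may be far from `u`, and a jump at `u` does no harm. -/
theorem exists_norm_splitting_le (h : IsSewable p T Ξ f₁ g₁ f₂ g₂) (hp : 0 < p) {u : ℝ}
    (hu : 0 ≤ u) (huT : u < T) {η : ℝ} (hη : 0 < η) :
    ∃ δ > 0, ∀ x y, 0 ≤ x → x ≤ u → u ≤ y → y ≤ T → y ≤ u + δ → ‖defect Ξ x u y‖ ≤ η := by
  have hp2 : 0 < p / 2 := by positivity
  have h1 := (h.fin_g₁.tendsto_right hp h.cont_g₁ hu huT).const_mul (var (p / 2) f₁ 0 T)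
  have h2 := (h.fin_g₂.tendsto_right hp2 h.cont_g₂ hu huT).const_mul (var p f₂ 0 T)
  have h3 := h1.add h2
  simp only [mul_zero, add_zero] at h3
  obtain ⟨w, hw, hwη⟩ := mem_nhdsGT_iff_exists_Ioc_subset.1
    (h3.eventually (ge_mem_nhds hη))
  refine ⟨w - u, sub_pos.2 hw, fun x y hx hxu huy hyT hyw => ?_⟩
  rcases huy.eq_or_lt with rfl | huy'
  · have : defect Ξ x u u = 0 := by simp [defect, h.diag u ⟨hu, huT.le⟩]
    rw [this, norm_zero]
    exact hη.le
  refine (h.defect_le x u y hx hxu huy hyT).trans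
    (le_trans ?_ (hwη ⟨huy', by linarith⟩))
  have k1 := h.fin_f₁.norm_le hp2 hx hxu huT.le
  have k2 := h.fin_f₂.norm_le hp hx hxu huT.le
  have k3 := (h.fin_g₁.mono hp hu hyT).norm_le hp le_rfl huy le_rfl
  have k4 := (h.fin_g₂.mono hp2 hu hyT).norm_le hp2 le_rfl huy le_rfl
  have := var_nonneg (p / 2) f₁ 0 T
  have := var_nonneg p f₂ 0 T
  gcongr

/-- The Riemann sums converge when the mesh tends to zero. -/
theorem exists_mesh (h : IsSewable p T Ξ f₁ g₁ f₂ g₂) (hp : 2 < p) (hp3 : p < 3)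
    {J : ℝ → E}
    (hJ : ∀ u v, 0 ≤ u → u ≤ v → v ≤ T → ‖J v - J u - Ξ u v‖ ≤ sewBound p f₁ g₁ f₂ g₂ u v)
    {t : ℝ} (ht0 : 0 < t) (ht : t ≤ T) {η : ℝ} (hη : 0 < η) :
    ∃ δ > 0, ∀ (a : ℕ → ℝ) (n : ℕ), IsGrid 0 t a → a 0 = 0 → a n = t →
      (∀ i < n, a (i + 1) - a i ≤ δ) →
      ‖∑ i ∈ Finset.range n, Ξ (a i) (a (i + 1)) - (J t - J 0)‖ ≤ η := by
  have hp0 : 0 < p := by linarith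
  have hκ : 0 < 3 / p - 1 := by rw [sub_pos, one_lt_div hp0]; exact hp3
  have hC := sewConst_nonneg p
  set ε : ℝ := η / (2 * (h.control 0 t + 1)) with hε
  have hω0 := h.control_nonneg 0 t
  have hε0 : 0 < ε := by positivity
  -- Chosen so that the constant of `norm_sum_sub_le_of_small` is at most `ε`.
  set θ : ℝ := (ε / (2 * sewConst p + 1)) ^ (1 / (3 / p - 1)) with hθ
  have hθ0 : 0 < θ := by positivity
  have hθε : 2 * sewConst p * θ ^ (3 / p - 1) ≤ ε := by
    rw [hθ, ← Real.rpow_mul (by positivity), one_div_mul_cancel hκ.ne', Real.rpow_one,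
      mul_div_assoc', div_le_iff₀ (by positivity)]
    nlinarith
  obtain ⟨n, hn⟩ := exists_nat_ge (h.control 0 t / θ)
  have hmain := control_induction (ω := h.control) (T := T) (θ := θ) hθ0 h.control_nonneg
    (fun s u t hs hsu hut ht => h.control_superadditive hp0 hs hsu hut ht)
    (fun u t hu hut ht η hη => h.control_lsc hp0 hu hut ht hη)
    -- The part `ε * h.control s t` of the error is superadditive, so it survives joining intervals;
    -- `η'` pays for the cells that straddle the joints.
    (Q := fun _ s t => ∀ η' > 0, ∃ δ > 0, ∀ (a : ℕ → ℝ) (n : ℕ), IsGrid s t a → a 0 = s →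
      a n = t → (∀ i < n, a (i + 1) - a i ≤ δ) →
      ‖∑ i ∈ Finset.range n, Ξ (a i) (a (i + 1)) - (J t - J s)‖ ≤ ε * h.control s t + η')
    ?_ ?_ (fun _ _ _ h => h) n 0 t le_rfl ht0 ht ((div_le_iff₀ hθ0).1 hn)
  · obtain ⟨δ, hδ, H⟩ := hmain (η / 2) (by positivity)
    refine ⟨δ, hδ, fun a n ha h0 h1 h2 => (H a n ha h0 h1 h2).trans ?_⟩
    have : ε * h.control 0 t ≤ η / 2 := by
      rw [hε, div_mul_eq_mul_div, div_le_div_iff₀ (by positivity) (by positivity)]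
      nlinarith
    linarith
  · intro s t hs hst ht hsm η' hη'
    refine ⟨1, one_pos, fun a n ha h0 h1 _ => ?_⟩
    have h3 := h.norm_sum_sub_le_of_small hp hp3 hJ hs hst ht hθ0.le hsm ha n
    rw [h0, h1] at h3
    have h4 := h.control_nonneg s t
    nlinarith
  · intro n s u t hs hsu hut ht h1 h2 η' hη'
    have hη3 : 0 < η' / 3 := by positivity
    obtain ⟨δ₁, hδ₁, H₁⟩ := h1 _ hη3
    obtain ⟨δ₂, hδ₂, H₂⟩ := h2 _ hη3
    obtain ⟨δ₃, hδ₃, H₃⟩ := h.exists_norm_splitting_le hp0 (hs.trans hsu.le) (hut.trans_le ht) hη3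
    refine ⟨min δ₁ (min δ₂ δ₃), by positivity, fun a n ha h0 h1 hstep => ?_⟩
    have st₁ : ∀ i < n, a (i + 1) - a i ≤ δ₁ := fun i hi => (hstep i hi).trans (min_le_left _ _)
    have st₂ : ∀ i < n, a (i + 1) - a i ≤ δ₂ := fun i hi =>
      (hstep i hi).trans ((min_le_right _ _).trans (min_le_left _ _))
    have st₃ : ∀ i < n, a (i + 1) - a i ≤ δ₃ := fun i hi =>
      (hstep i hi).trans ((min_le_right _ _).trans (min_le_right _ _))
    have g₁ : IsGrid s u (fun i => min (a i) u) := ha.comp_mono (f := fun x => min x u)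
      (fun _ _ hxy => min_le_min hxy le_rfl)
      fun _ hx => ⟨le_min hx.1 hsu.le, min_le_right _ _⟩
    have g₂ : IsGrid u t (fun i => max (a i) u) := ha.comp_mono (f := fun x => max x u)
      (fun _ _ hxy => max_le_max hxy le_rfl)
      fun _ hx => ⟨le_max_right _ _, max_le hx.2 hut.le⟩
    have E₁ := H₁ _ n g₁ (by simp [h0, hsu.le]) (by simp [h1, hut.le]) fun i hi => by
      refine le_trans ?_ (st₁ i hi)
      have := ha.le_succ i
      rcases le_total (a i) u with h3 | h3 <;> rcases le_total (a (i + 1)) u with h4 | h4 <;>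
        simp [h3, h4] <;> linarith
    have E₂ := H₂ _ n g₂ (by simp [h0, hsu.le]) (by simp [h1, hut.le]) fun i hi => by
      refine le_trans ?_ (st₂ i hi)
      have := ha.le_succ i
      rcases le_total (a i) u with h3 | h3 <;> rcases le_total (a (i + 1)) u with h4 | h4 <;>
        simp [h3, h4] <;> linarith
    -- Inserting `u` into the grid alters only the cell containing it, by a defect at `u`. The
    -- cut-off makes the bound valid for all arguments and is inactive on the given grid.
    set D : ℝ → ℝ → E := fun x y => if y ≤ x + δ₃ then
      Ξ x y - Ξ (min x u) (min y u) - Ξ (max x u) (max y u) else 0 with hD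
    have huT : u ∈ Icc 0 T := ⟨hs.trans hsu.le, hut.le.trans ht⟩
    have hDv : VarLE 1 D s t (η' / 3) := by
      refine .of_single one_pos hη3.le u (fun x y hx hxy hy hn => ?_) fun x y hx hxu huy hy => ?_
      · simp only [hD]
        split_ifs
        · rcases lt_or_ge x u with h3 | h3
          · have h4 : y ≤ u := (not_le.1 fun h => hn ⟨h3, h⟩).le
            simp [min_eq_left h3.le, min_eq_left h4, max_eq_right h3.le, max_eq_right h4,
              h.diag u huT]
          · simp [min_eq_right h3, min_eq_right (h3.trans hxy), max_eq_left h3,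
              max_eq_left (h3.trans hxy), h.diag u huT]
        · rfl
      · simp only [hD]
        split_ifs with hxy
        · rw [min_eq_left hxu.le, min_eq_right huy, max_eq_right hxu.le, max_eq_left huy]
          exact H₃ x y (hs.trans hx) hxu.le huy (hy.trans ht) (by linarith)
        · simpa using hη3.le
    have hsum := hDv.2 a n ha
    simp only [Real.rpow_one] at hsum
    have hsplit : ∑ i ∈ Finset.range n, Ξ (a i) (a (i + 1)) - (J t - J s) =
        (∑ i ∈ Finset.range n, Ξ (min (a i) u) (min (a (i + 1)) u) - (J u - J s)) +
        (∑ i ∈ Finset.range n, Ξ (max (a i) u) (max (a (i + 1)) u) - (J t - J u)) +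
        ∑ i ∈ Finset.range n, D (a i) (a (i + 1)) := by
      have : ∑ i ∈ Finset.range n, D (a i) (a (i + 1)) = ∑ i ∈ Finset.range n,
          (Ξ (a i) (a (i + 1)) - Ξ (min (a i) u) (min (a (i + 1)) u) -
            Ξ (max (a i) u) (max (a (i + 1)) u)) := by
        refine Finset.sum_congr rfl fun i hi => ?_
        have := st₃ i (Finset.mem_range.1 hi)
        simp only [hD]
        rw [if_pos (by linarith)]
      rw [this, Finset.sum_sub_distrib, Finset.sum_sub_distrib]
      abel
    rw [hsplit]
    have hD' := (norm_sum_le _ _).trans hsum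
    have hsa := mul_le_mul_of_nonneg_left
      (h.control_superadditive hp0 hs hsu.le hut.le ht) hε0.le
    refine (norm_add₃_le).trans ?_
    linarith

end IsSewable

end MeshConvergence

end RoughFDE

namespace RoughFDE

/-! ### Algebra of càdlàg paths -/

section Cadlag

variable {E F : Type*} [NormedAddCommGroup E] [NormedAddCommGroup F] {f g : ℝ → E} {a b : ℝ}

theorem CadlagOn.mono {a' b' : ℝ} (h : CadlagOn f a b) (ha : a ≤ a') (hb : b' ≤ b) :
    CadlagOn f a' b' :=
  ⟨fun t ht => h.1 t ⟨ha.trans ht.1, ht.2.trans_le hb⟩,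
    fun t ht => h.2 t ⟨ha.trans_lt ht.1, ht.2.trans hb⟩⟩

theorem cadlagOn_const (c : E) : CadlagOn (fun _ => c) a b :=
  ⟨fun _ _ => continuousWithinAt_const, fun _ _ => ⟨c, tendsto_const_nhds⟩⟩

theorem CadlagOn.sub (hf : CadlagOn f a b) (hg : CadlagOn g a b) :
    CadlagOn (fun t => f t - g t) a b :=
  ⟨fun t ht => (hf.1 t ht).sub (hg.1 t ht), fun t ht => by
    obtain ⟨l, hl⟩ := hf.2 t ht
    obtain ⟨m, hm⟩ := hg.2 t ht
    exact ⟨l - m, hl.sub hm⟩⟩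

theorem CadlagOn.add (hf : CadlagOn f a b) (hg : CadlagOn g a b) :
    CadlagOn (fun t => f t + g t) a b :=
  ⟨fun t ht => (hf.1 t ht).add (hg.1 t ht), fun t ht => by
    obtain ⟨l, hl⟩ := hf.2 t ht
    obtain ⟨m, hm⟩ := hg.2 t ht
    exact ⟨l + m, hl.add hm⟩⟩

theorem CadlagOn.clm_apply [NormedSpace ℝ E] [NormedSpace ℝ F] {A : ℝ → E →L[ℝ] F}
    (hA : CadlagOn A a b) (hf : CadlagOn f a b) : CadlagOn (fun t => A t (f t)) a b :=
  ⟨fun t ht => (hA.1 t ht).clm_apply (hf.1 t ht), fun t ht => by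
    obtain ⟨l, hl⟩ := hA.2 t ht
    obtain ⟨m, hm⟩ := hf.2 t ht
    exact ⟨l m, (isBoundedBilinearMap_apply (𝕜 := ℝ) (E := E) (F := F)).continuous.continuousAt.tendsto.comp
      (hl.prodMk_nhds hm)⟩⟩

theorem MemD.add {q T : ℝ} (hq : 1 ≤ q) (hf : MemD q T f) (hg : MemD q T g) :
    MemD q T (fun t => f t + g t) := by
  have hq0 : 0 < q := by linarith
  refine ⟨hf.cadlag.add hg.cadlag, ?_⟩
  have h := ((hf.finVar.varLE hq0).add hq (hg.finVar.varLE hq0)).finVar hq0 (fun u _ => by simp)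
  rw [← incr_add] at h
  exact h.finite

theorem MemD.sub {q T : ℝ} (hq : 1 ≤ q) (hf : MemD q T f) (hg : MemD q T g) :
    MemD q T (fun t => f t - g t) := by
  have hq0 : 0 < q := by linarith
  refine ⟨hf.cadlag.sub hg.cadlag, ?_⟩
  have h := ((hf.finVar.varLE hq0).sub hq (hg.finVar.varLE hq0)).finVar hq0 (fun u _ => by simp)
  rw [← incr_sub] at h
  exact h.finite

theorem MemD₂.rightContLeft {q T : ℝ} {A : ℝ → ℝ → E} (h : MemD₂ q T A) : RightContLeft A 0 T :=
  fun u v hu huv hv => (h.cadlag_left v ⟨hu.trans huv.le, hv⟩).1 u ⟨hu, huv⟩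

end Cadlag

/-! ### Controlled paths: algebra, restriction and gluing -/

section Controlled

variable {d : ℕ} {E : Type*} [NormedAddCommGroup E] [NormedSpace ℝ E]
  {p T : ℝ} {X : ℝ → Vec d} {XX : ℝ → ℝ → Mat d}
  {Y Z : ℝ → E} {Y' Z' : ℝ → Vec d →L[ℝ] E}

@[simp]
theorem remainder_self (X : ℝ → Vec d) (Y : ℝ → E) (Y' : ℝ → Vec d →L[ℝ] E) (u : ℝ) :
    remainder X Y Y' u u = 0 := by simp [remainder]

theorem remainder_sub (X : ℝ → Vec d) (Y Z : ℝ → E) (Y' Z' : ℝ → Vec d →L[ℝ] E) :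
    remainder X (Y - Z) (Y' - Z') = remainder X Y Y' - remainder X Z Z' := by
  ext s t; simp [remainder, incr_sub]; abel

theorem ctrlDist_eq_ctrlNorm_sub (p : ℝ) (X : ℝ → Vec d) (Y Z : ℝ → E)
    (Y' Z' : ℝ → Vec d →L[ℝ] E) (s t : ℝ) :
    ctrlDist p X Y Y' Z Z' s t = ctrlNorm p X (Y - Z) (Y' - Z') s t := by
  rw [ctrlDist, ctrlNorm, remainder_sub]; rfl

theorem norm_incr_le_remainder (X : ℝ → Vec d) (Y : ℝ → E) (Y' : ℝ → Vec d →L[ℝ] E) (a b : ℝ) :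
    ‖incr Y a b‖ ≤ ‖Y' a‖ * ‖incr X a b‖ + ‖remainder X Y Y' a b‖ := by
  have : incr Y a b = Y' a (incr X a b) + remainder X Y Y' a b := by simp [remainder]
  rw [this]
  exact (norm_add_le _ _).trans (add_le_add ((Y' a).le_opNorm _) le_rfl)

theorem IsControlled.finVar_remainder (h : IsControlled p T X Y Y') :
    FinVar (p / 2) (RoughFDE.remainder X Y Y') 0 T :=
  ⟨fun u _ => remainder_self X Y Y' u, h.remainder.finite⟩

/-- The derivative is evaluated at left endpoints only, so its bound is needed just on `[s, t)`. -/
theorem varLE_incr_of_remainder (hp : 1 ≤ p) {s t m x r : ℝ} (hx : VarLE p (incr X) s t x)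
    (hr : VarLE (p / 2) (remainder X Y Y') s t r) (hm0 : 0 ≤ m)
    (hm : ∀ a ∈ Ico s t, ‖Y' a‖ ≤ m) : VarLE p (incr Y) s t (m * x + r) := by
  have hp0 : 0 < p := by linarith
  have h1 : VarLE p (fun a b => ‖incr X a b‖) s t x :=
    hx.of_norm_le hp0 fun _ _ _ _ _ => by simp
  have h2 : VarLE p (fun a b => ‖remainder X Y Y' a b‖) s t r :=
    hr.double.of_norm_le hp0 fun _ _ _ _ _ => by simp
  refine ((h1.const_mul hm0).add hp h2).of_norm_le hp0 fun a b ha hab hb => ?_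
  rw [Pi.add_apply, Pi.add_apply, Real.norm_of_nonneg (by positivity)]
  rcases hab.eq_or_lt with rfl | hab
  · simp
  · have := hm a ⟨ha, hab.trans_le hb⟩
    exact (norm_incr_le_remainder X Y Y' a b).trans (by gcongr)

theorem isControlled_of_varLE [CompleteSpace E] (hp : 2 ≤ p) (hX : MemD p T X)
    (hY' : MemD p T Y') (hY : ∀ t ∈ Ico 0 T, ContinuousWithinAt Y (Ioi t) t) {c : ℝ}
    (hR : VarLE (p / 2) (remainder X Y Y') 0 T c) : IsControlled p T X Y Y' := by
  have hp0 : 0 < p := by linarith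
  have hv := hY'.finVar.varLE hp0
  have h1 := varLE_incr_of_remainder (by linarith) (hX.finVar.varLE hp0) hR
    (m := ‖Y' 0‖ + var p (incr Y') 0 T) (by have := var_nonneg p (incr Y') 0 T; positivity)
    fun a ha => hv.norm_incr_le hp0 (Ico_subset_Icc_self ha)
  have hYD := memD_of_finVar hp0 (h1.finVar hp0 fun u _ => incr_self Y u) hY
  refine ⟨hYD, hY', ⟨fun t ht => ?_, fun s hs => ?_, (hR.finVar (by positivity) fun u _ =>
    remainder_self X Y Y' u).finite⟩⟩
  · exact ((cadlagOn_const (Y t)).sub (hYD.cadlag.mono le_rfl ht.2)).sub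
      ((hY'.cadlag.mono le_rfl ht.2).clm_apply
        ((cadlagOn_const (X t)).sub (hX.cadlag.mono le_rfl ht.2)))
  · exact ((hYD.cadlag.mono hs.1 le_rfl).sub (cadlagOn_const (Y s))).sub
      ((cadlagOn_const (Y' s)).clm_apply
        ((hX.cadlag.mono hs.1 le_rfl).sub (cadlagOn_const (X s))))

theorem IsControlled.sub (hp : 2 ≤ p) (h : IsControlled p T X Y Y')
    (h' : IsControlled p T X Z Z') : IsControlled p T X (Y - Z) (Y' - Z') := by
  have hp2 : 1 ≤ p / 2 := by linarith
  have hR := ((h.finVar_remainder.varLE (by linarith)).sub hp2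
    (h'.finVar_remainder.varLE (by linarith))).finVar (by linarith) (fun u _ => by simp)
  rw [← remainder_sub] at hR
  refine ⟨h.path.sub (by linarith) h'.path, h.deriv.sub (by linarith) h'.deriv,
    ⟨fun t ht => ?_, fun s hs => ?_, hR.finite⟩⟩
  · rw [remainder_sub]
    exact (h.remainder.cadlag_left t ht).sub (h'.remainder.cadlag_left t ht)
  · rw [remainder_sub]
    exact (h.remainder.cadlag_right s hs).sub (h'.remainder.cadlag_right s hs)

theorem isControlled_zero (hX : MemD p T X) (hp : 2 ≤ p) [CompleteSpace E] :
    IsControlled p T X (0 : ℝ → E) (0 : ℝ → Vec d →L[ℝ] E) := by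
  have hp0 : 0 < p := by linarith
  have hz : ∀ {F : Type _} [NormedAddCommGroup F] (q : ℝ), 0 < q →
      VarLE q (0 : ℝ → ℝ → F) 0 T 0 := fun q hq =>
    ⟨le_rfl, fun a n _ => by simp [Real.zero_rpow hq.ne']⟩
  refine isControlled_of_varLE hp hX ⟨cadlagOn_const 0, ?_⟩
    (fun t _ => continuousWithinAt_const) (c := 0) ?_
  · have h : incr (0 : ℝ → Vec d →L[ℝ] E) = 0 := by ext; simp [incr]
    rw [h]
    exact (hz p hp0).eVar_le hp0 |>.trans_lt ENNReal.ofReal_lt_top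
  · have h : remainder X (0 : ℝ → E) (0 : ℝ → Vec d →L[ℝ] E) = 0 := by
      ext; simp [remainder, incr]
    rw [h]
    exact hz _ (by positivity)

/-- Bounds on the seminorm of a controlled path over `[s, t]`. -/
theorem IsControlled.ctrlNorm_bounds (hp : 0 < p) (h : IsControlled p T X Y Y') {s t G : ℝ}
    (hs : 0 ≤ s) (ht : t ≤ T) (hG : ctrlNorm p X Y Y' s t ≤ G) :
    (∀ a ∈ Icc s t, ‖Y' a‖ ≤ G) ∧ VarLE p (incr Y') s t G ∧
      VarLE (p / 2) (RoughFDE.remainder X Y Y') s t G := by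
  have hp2 : 0 < p / 2 := by positivity
  have h1 := (h.deriv.finVar.mono hp hs ht).varLE hp
  have h2 := (h.finVar_remainder.mono hp2 hs ht).varLE hp2
  have h3 := var_nonneg p (incr Y') s t
  have h4 := var_nonneg (p / 2) (RoughFDE.remainder X Y Y') s t
  have h5 := norm_nonneg (Y' s)
  unfold ctrlNorm at hG
  refine ⟨fun a ha => (h1.norm_incr_le hp ha).trans (by linarith), h1.le hp (by linarith),
    h2.le hp2 (by linarith)⟩

theorem ctrlNorm_nonneg (p : ℝ) (X : ℝ → Vec d) (Y : ℝ → E) (Y' : ℝ → Vec d →L[ℝ] E) (s t : ℝ) :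
    0 ≤ ctrlNorm p X Y Y' s t :=
  add_nonneg (add_nonneg (norm_nonneg _) (var_nonneg _ _ _ _)) (var_nonneg _ _ _ _)

theorem IsControlled.ctrlNorm_mono (hp : 0 < p) (h : IsControlled p T X Y Y') {s t t' : ℝ}
    (hs : 0 ≤ s) (ht : t ≤ t') (ht' : t' ≤ T) :
    ctrlNorm p X Y Y' s t ≤ ctrlNorm p X Y Y' s t' := by
  have hp2 : 0 < p / 2 := by positivity
  exact add_le_add (add_le_add le_rfl ((h.deriv.finVar.mono hp hs ht').var_mono hp le_rfl ht))
    ((h.finVar_remainder.mono hp2 hs ht').var_mono hp2 le_rfl ht)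

/-- The seminorm is not monotone in its left endpoint, as it contains `‖Y' s‖`; comparing with `‖Y'
0‖` costs one more variation of `Y'`, hence the factor `2`. -/
theorem IsControlled.ctrlNorm_le_sub (hp : 0 < p) (h : IsControlled p T X Y Y') {s t : ℝ}
    (hs : 0 ≤ s) (hst : s ≤ t) (ht : t ≤ T) :
    ctrlNorm p X Y Y' s t ≤ 2 * ctrlNorm p X Y Y' 0 T := by
  have hp2 : 0 < p / 2 := by positivity
  have h1 := (h.deriv.finVar.varLE hp).norm_incr_le hp (a := s) ⟨hs, hst.trans ht⟩
  have h2 := h.deriv.finVar.var_mono hp hs ht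
  have h3 := h.finVar_remainder.var_mono hp2 hs ht
  have h4 := var_nonneg (p / 2) (RoughFDE.remainder X Y Y') 0 T
  have h5 := norm_nonneg (Y' 0)
  unfold ctrlNorm
  linarith

/-- Bounds on adjacent intervals give a bound on the union. -/
theorem IsControlled.ctrlNorm_glue (hp : 2 ≤ p) (hX : MemD p T X) (h : IsControlled p T X Y Y')
    {s u t : ℝ} (hs : 0 ≤ s) (hsu : s ≤ u) (hut : u ≤ t) (ht : t ≤ T) :
    ctrlNorm p X Y Y' s t ≤ (1 + var p (incr X) 0 T) *
      (ctrlNorm p X Y Y' s u + ctrlNorm p X Y Y' u t) := by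
  have hp0 : 0 < p := by linarith
  have hp2 : 0 < p / 2 := by positivity
  have v1 := (h.deriv.finVar.mono hp0 hs (hut.trans ht)).varLE hp0
  have v2 := (h.deriv.finVar.mono hp0 (hs.trans hsu) ht).varLE hp0
  have r1 := (h.finVar_remainder.mono hp2 hs (hut.trans ht)).varLE hp2
  have r2 := (h.finVar_remainder.mono hp2 (hs.trans hsu) ht).varLE hp2
  have x2 := hX.finVar.varLE hp0
  have hx := x2.1
  have hv := (VarLE.glue_incr (by linarith) hsu hut v1 v2).var_le hp0
  set V1 := var p (incr Y') s u
  set V2 := var p (incr Y') u t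
  set x := var p (incr X) 0 T
  -- Across `u` the remainder splits as `R_{a,u} + R_{u,b} + (Y'_u - Y'_a) X_{u,b}`. The last term
  -- is nonzero on at most one cell.
  have hB : VarLE (p / 2) (fun a b => incr Y' (min a u) u (incr X u (max b u))) s t (V1 * x) := by
    refine .of_single hp2 (mul_nonneg v1.1 hx) u (fun a b ha hab hb hn => ?_)
      fun a b ha hau hub hb => ?_
    · rcases lt_or_ge a u with h1 | h1
      · have : b ≤ u := (not_le.1 fun h => hn ⟨h1, h⟩).le
        simp [max_eq_right this]
      · simp [min_eq_right h1]
    · rw [min_eq_left hau.le, max_eq_left hub]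
      refine (ContinuousLinearMap.le_opNorm _ _).trans ?_
      have k1 := v1.norm_le hp0 ha hau.le le_rfl
      have k2 := x2.norm_le hp0 (hs.trans hsu) hub (hb.trans ht)
      exact mul_le_mul k1 k2 (norm_nonneg _) v1.1
  have hR := ((r1.clampLeft (t := t) hsu).add (by linarith) (r2.clampRight (s := s) hut)).add
    (by linarith) hB
  have hR' : VarLE (p / 2) (RoughFDE.remainder X Y Y') s t
      (var (p / 2) (RoughFDE.remainder X Y Y') s u + var (p / 2) (RoughFDE.remainder X Y Y') u t
        + V1 * x) := by
    refine hR.of_norm_le hp2 fun a b ha hab hb => le_of_eq ?_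
    congr 1
    simp only [Pi.add_apply]
    rcases le_total a u with h1 | h1 <;> rcases le_total b u with h2 | h2
    · simp [h1, h2]
    · simp only [min_eq_left h1, min_eq_right h2, max_eq_right h1, max_eq_left h2,
        RoughFDE.remainder, incr, _root_.sub_apply, map_sub]
      abel
    · have : a = u := le_antisymm (hab.trans h2) h1
      subst this
      have : a = b := le_antisymm hab h2
      subst this
      simp
    · simp [h1, h2]
  have hr := hR'.var_le hp2
  have n1 := norm_nonneg (Y' s)
  have n2 := norm_nonneg (Y' u)
  unfold ctrlNorm
  have := r1.1
  have := r2.1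
  have := v1.1
  have := v2.1
  set R1 := var (p / 2) (RoughFDE.remainder X Y Y') s u
  set R2 := var (p / 2) (RoughFDE.remainder X Y Y') u t
  nlinarith [mul_nonneg hx n1, mul_nonneg hx n2, mul_nonneg hx r1.1, mul_nonneg hx r2.1,
    mul_nonneg hx v2.1]

end Controlled

end RoughFDE

namespace RoughFDE

/-! ### The rough integral as a controlled path -/

section RoughIntegral

variable {d : ℕ} {E : Type*} [NormedAddCommGroup E] [NormedSpace ℝ E]
  {p T : ℝ} {X : ℝ → Vec d} {XX : ℝ → ℝ → Mat d}

theorem norm_pairing_le (A : Vec d →L[ℝ] Vec d →L[ℝ] E) (M : Mat d) :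
    ‖pairing A M‖ ≤ (d : ℝ) ^ 2 * ‖A‖ * ‖M‖ := by
  have h : ∀ i j, ‖M (i, j) • A (EuclideanSpace.single i 1) (EuclideanSpace.single j 1)‖ ≤
      ‖A‖ * ‖M‖ := fun i j => by
    rw [norm_smul, mul_comm]
    refine mul_le_mul ?_ (PiLp.norm_apply_le M (i, j)) (norm_nonneg _) (norm_nonneg A)
    simpa using A.le_opNorm₂ (EuclideanSpace.single i (1 : ℝ)) (EuclideanSpace.single j (1 : ℝ))
  calc ‖pairing A M‖ ≤ ∑ _i : Fin d, ∑ _j : Fin d, ‖A‖ * ‖M‖ :=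
        (norm_sum_le _ _).trans (Finset.sum_le_sum fun i _ =>
          (norm_sum_le _ _).trans (Finset.sum_le_sum fun j _ => h i j))
    _ = (d : ℝ) ^ 2 * ‖A‖ * ‖M‖ := by simp; ring

theorem pairing_sub_left (A B : Vec d →L[ℝ] Vec d →L[ℝ] E) (M : Mat d) :
    pairing (A - B) M = pairing A M - pairing B M := by
  simp [pairing, smul_sub, Finset.sum_sub_distrib]

theorem pairing_sub_right (A : Vec d →L[ℝ] Vec d →L[ℝ] E) (M N : Mat d) :
    pairing A (M - N) = pairing A M - pairing A N := by
  simp [pairing, sub_smul, Finset.sum_sub_distrib]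

theorem pairing_eq_apply (A : Vec d →L[ℝ] Vec d →L[ℝ] E) {M : Mat d} {x z : Vec d}
    (h : ∀ i j, M (i, j) = x i * z j) : pairing A M = A x z := by
  have hx : ∀ x : Vec d, x = ∑ i, x i • EuclideanSpace.single i (1 : ℝ) := fun x => by
    ext j
    simp [Finset.sum_apply, Pi.single_apply]
  conv_rhs => rw [hx x, hx z]
  simp only [pairing, h, map_sum, map_smul, _root_.sum_apply,
    _root_.smul_apply, Finset.smul_sum, mul_smul]
  rw [Finset.sum_comm]
  exact Finset.sum_congr rfl fun _ _ => Finset.sum_congr rfl fun _ _ => smul_comm _ _ _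

theorem IsRoughPath.area_diag (hX : IsRoughPath p T X XX) {u : ℝ} (hu : u ∈ Icc 0 T) :
    XX u u = 0 := by
  ext ⟨i, j⟩
  have := hX.chen u u u hu.1 le_rfl le_rfl hu.2 i j
  simpa using this

theorem IsRoughPath.finVar_area (hX : IsRoughPath p T X XX) : FinVar (p / 2) XX 0 T :=
  ⟨fun _ hu => hX.area_diag hu, hX.area.finite⟩

/-- The local approximation `V_u X_{u,v} + V'_u XX_{u,v}` of the rough integral. -/
noncomputable def germ (X : ℝ → Vec d) (XX : ℝ → ℝ → Mat d) (V : ℝ → Vec d →L[ℝ] E)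
    (V' : ℝ → Vec d →L[ℝ] Vec d →L[ℝ] E) (u v : ℝ) : E :=
  V u (incr X u v) + pairing (V' u) (XX u v)

variable {V W : ℝ → Vec d →L[ℝ] E} {V' W' : ℝ → Vec d →L[ℝ] Vec d →L[ℝ] E}

/-- Chen's relation turns the defect of the area into `V'_s X_{s,u} X_{u,t}`, which completes the
increment of `V` to its remainder. -/
theorem defect_germ (hX : IsRoughPath p T X XX) (V : ℝ → Vec d →L[ℝ] E)
    (V' : ℝ → Vec d →L[ℝ] Vec d →L[ℝ] E) {s u t : ℝ} (hs : 0 ≤ s)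
    (hsu : s ≤ u) (hut : u ≤ t) (ht : t ≤ T) :
    defect (germ X XX V V') s u t =
      -(remainder X V V' s u (incr X u t)) - pairing (incr V' s u) (XX u t) := by
  have h1 : pairing (V' s) (XX s t - XX s u - XX u t) = V' s (incr X s u) (incr X u t) :=
    pairing_eq_apply _ fun i j => by
      have := hX.chen s u t hs hsu hut ht i j
      simp only [PiLp.sub_apply]
      linarith
  have h2 : incr X s t = incr X s u + incr X u t := (incr_add_incr X s u t).symm
  rw [pairing_sub_right, pairing_sub_right, sub_sub, sub_eq_iff_eq_add] at h1
  simp only [defect, germ, h1, h2, remainder]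
  simp only [incr, pairing_sub_left, map_add, map_sub, _root_.sub_apply]
  abel

/-- The part of the defect of the germ that involves the derivative of the integrand. -/
noncomputable def derivVar (V' : ℝ → Vec d →L[ℝ] Vec d →L[ℝ] E) (a b : ℝ) : ℝ :=
  (d : ℝ) ^ 2 * ‖incr V' a b‖

theorem varLE_derivVar (hp : 0 < p) {s t c : ℝ} (h : VarLE p (incr V') s t c) :
    VarLE p (derivVar V') s t ((d : ℝ) ^ 2 * c) :=
  (h.of_norm_le (D := fun a b => ‖incr V' a b‖) hp fun a b _ _ _ =>
    (norm_norm (incr V' a b)).le).const_mul (by positivity)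

theorem isSewable_germ (hp : 0 < p) (hX : IsRoughPath p T X XX) (hV : IsControlled p T X V V') :
    IsSewable p T (germ X XX V V') (remainder X V V') (incr X) (derivVar V') XX where
  defect_le x y z hx hxy hyz hz := by
    rw [defect_germ hX V V' hx hxy hyz hz]
    refine (norm_sub_le _ _).trans (add_le_add ?_ ?_)
    · rw [norm_neg]
      exact ContinuousLinearMap.le_opNorm _ _
    · refine (norm_pairing_le _ _).trans (le_of_eq ?_)
      rw [derivVar, Real.norm_of_nonneg (mul_nonneg (by positivity) (norm_nonneg (incr V' x y)))]
  fin_f₁ := hV.finVar_remainder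
  fin_g₁ := hX.path.finVar
  fin_f₂ := (varLE_derivVar hp (hV.deriv.finVar.varLE hp)).finVar hp fun u _ => by
    rw [derivVar, incr_self]
    exact mul_eq_zero_of_right _ (norm_zero (E := Vec d →L[ℝ] Vec d →L[ℝ] E))
  fin_g₂ := hX.finVar_area
  cont_f₁ := hV.remainder.rightContLeft
  cont_g₁ := hX.path.cadlag.rightContLeft_incr
  cont_f₂ u v hu huv hv :=
    continuousWithinAt_const.mul (hV.deriv.cadlag.rightContLeft_incr u v hu huv hv).norm
  cont_g₂ := hX.area.rightContLeft

theorem IntervalPartition.step_lt {s t : ℝ} {P : IntervalPartition s t} {δ : NNReal}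
    (h : P.mesh < δ) {i : ℕ} (hi : i < P.n) : P.pt (i + 1) - P.pt i ≤ δ := by
  have h1 : (P.pt (i + 1) - P.pt i).toNNReal ≤ P.mesh :=
    Finset.le_sup (f := fun i => (P.pt (i + 1) - P.pt i).toNNReal) (Finset.mem_range.2 hi)
  exact (Real.le_coe_toNNReal _).trans (by exact_mod_cast h1.trans h.le)

/-- Uniform partitions have arbitrarily small mesh, and for `t = 0` the empty one has mesh zero.
Without this, limits along the mesh would not be unique. -/
theorem neBot_mesh {t : ℝ} (ht : 0 ≤ t) :
    (comap (IntervalPartition.mesh (s := 0) (t := t)) (𝓝 0)).NeBot := by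
  refine comap_neBot fun S hS => ?_
  rcases ht.eq_or_lt with rfl | ht
  · refine ⟨⟨0, fun _ => 0, rfl, rfl, by simp⟩, ?_⟩
    exact mem_of_mem_nhds (by simpa [IntervalPartition.mesh] using hS)
  · obtain ⟨δ, hδ, hδS⟩ := (NNReal.nhds_zero_basis.mem_iff).1 hS
    obtain ⟨n, hn⟩ := exists_nat_gt (t / δ)
    have hδ' : (0 : ℝ) < δ := by exact_mod_cast hδ
    have hn0 : (0 : ℝ) < n := (by positivity : (0 : ℝ) < t / δ).trans hn
    refine ⟨⟨n, fun i => i * (t / n), by simp, by field_simp, fun i _ => ?_⟩, hδS ?_⟩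
    · have : 0 < t / n := by positivity
      push_cast
      linarith
    · rw [mem_Iio, IntervalPartition.mesh, Finset.sup_lt_iff (by simpa using hδ)]
      intro i _
      have h1 : ((i + 1 : ℕ) : ℝ) * (t / n) - i * (t / n) = t / n := by push_cast; ring
      simp only [h1]
      rw [← NNReal.coe_lt_coe, Real.coe_toNNReal _ (by positivity)]
      rw [div_lt_iff₀ hδ'] at hn
      rw [div_lt_iff₀ hn0]
      linarith

theorem HasRoughIntegral.unique {t : ℝ} (ht : 0 ≤ t) {I I' : E}
    (h : HasRoughIntegral X XX V V' 0 t I) (h' : HasRoughIntegral X XX V V' 0 t I') : I = I' :=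
  haveI := neBot_mesh ht
  tendsto_nhds_unique h h'

theorem hasRoughIntegral_zero (X : ℝ → Vec d) (XX : ℝ → ℝ → Mat d) (V : ℝ → Vec d →L[ℝ] E)
    (V' : ℝ → Vec d →L[ℝ] Vec d →L[ℝ] E) : HasRoughIntegral X XX V V' 0 0 0 := by
  refine tendsto_const_nhds.congr fun P => ?_
  have : P.n = 0 := by
    by_contra hn
    have h1 := P.pt_lt 0 (by omega)
    have h2 := P.le_of_le (i := 1) (j := P.n) (by omega) le_rfl
    have := P.pt_zero
    have := P.pt_n
    simp only [zero_add] at h1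
    linarith
  simp [roughSum, this]

theorem HasRoughIntegral.sub {t : ℝ} {I I' : E}
    (h : HasRoughIntegral X XX V V' 0 t I) (h' : HasRoughIntegral X XX W W' 0 t I') :
    HasRoughIntegral X XX (V - W) (V' - W') 0 t (I - I') := by
  refine (Tendsto.sub h h').congr fun P => ?_
  simp only [roughSum, ← Finset.sum_sub_distrib]
  refine Finset.sum_congr rfl fun i _ => ?_
  simp only [Pi.sub_apply, _root_.sub_apply, pairing_sub_left]
  abel

/-- Existence of the rough integral together with its local estimate. -/
theorem exists_roughIntegral [ProperSpace E] (hp : 2 < p) (hp3 : p < 3) (hT : 0 ≤ T)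
    (hX : IsRoughPath p T X XX) (hV : IsControlled p T X V V') :
    ∃ J : ℝ → E, (∀ t ∈ Icc 0 T, HasRoughIntegral X XX V V' 0 t (J t)) ∧
      ∀ u v, 0 ≤ u → u ≤ v → v ≤ T → ‖J v - J u - germ X XX V V' u v‖ ≤
        sewBound p (remainder X V V') (incr X) (derivVar V') XX u v := by
  have hp0 : 0 < p := by linarith
  have hS := isSewable_germ hp0 hX hV
  obtain ⟨J, hJ⟩ := hS.exists_path hp0 hp3 hT
  refine ⟨fun t => J t - J 0, fun t ht => ?_, fun u v hu huv hv => ?_⟩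
  · rcases ht.1.eq_or_lt with rfl | ht0
    · simpa using hasRoughIntegral_zero X XX V V'
    · rw [HasRoughIntegral, Metric.tendsto_nhds]
      intro η hη
      obtain ⟨δ, hδ, H⟩ := hS.exists_mesh hp hp3 hJ ht0 ht.2 (half_pos hη)
      have hev : ∀ᶠ x : NNReal in 𝓝 0, x < ⟨δ, hδ.le⟩ := Iio_mem_nhds hδ
      filter_upwards [preimage_mem_comap hev] with P hP
      have h1 := H _ P.n P.isGrid (by simp [P.pt_zero]) (by simp [P.pt_n]) fun i hi => by
        rw [min_eq_left (by omega), min_eq_left (by omega)]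
        exact IntervalPartition.step_lt hP hi
      rw [P.sum_min] at h1
      rw [dist_eq_norm]
      exact h1.trans_lt (by linarith)
  · simpa using hJ u v hu huv hv

/-- The constant in the estimate of the remainder of the rough integral. -/
noncomputable def intConst (p : ℝ) (d : ℕ) : ℝ := (d : ℝ) ^ 2 + sewConst p * (1 + (d : ℝ) ^ 2)

theorem intConst_nonneg (p : ℝ) (d : ℕ) : 0 ≤ intConst p d := by
  have := sewConst_nonneg p
  unfold intConst
  positivity

/-- The remainder of the rough integral is bounded in terms of the integrand on the half-open
interval. -/
theorem varLE_integral_remainder [ProperSpace E] (hp : 2 < p) (hp3 : p < 3)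
    (hX : IsRoughPath p T X XX) (hV : IsControlled p T X V V') {J : ℝ → E}
    (hJ : ∀ t ∈ Icc 0 T, HasRoughIntegral X XX V V' 0 t (J t)) {s t G : ℝ} (hs : 0 ≤ s)
    (hst : s < t) (ht : t ≤ T) (hG : ∀ u ∈ Ioo s t, ctrlNorm p X V V' s u ≤ G) :
    VarLE (p / 2) (remainder X J V) s t (intConst p d * G * roughNorm p X XX s t) := by
  have hp0 : 0 < p := by linarith
  have hp2 : 0 < p / 2 := by positivity
  have hT : 0 ≤ T := hs.trans (hst.le.trans ht)
  -- By uniqueness of the limits, any path of integrals is the sewn one and inherits its local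
  -- estimate.
  have hJ' : ∀ u v, 0 ≤ u → u ≤ v → v ≤ T → ‖J v - J u - germ X XX V V' u v‖ ≤
        sewBound p (remainder X V V') (incr X) (derivVar V') XX u v := by
    obtain ⟨J₁, h1, h2⟩ := exists_roughIntegral hp hp3 hT hX hV
    intro u v hu huv hv
    rw [(hJ v ⟨hu.trans huv, hv⟩).unique (hu.trans huv) (h1 v ⟨hu.trans huv, hv⟩),
      (hJ u ⟨hu, huv.trans hv⟩).unique hu (h1 u ⟨hu, huv.trans hv⟩)]
    exact h2 u v hu huv hv
  have hb := fun u (hu : u ∈ Ioo s t) => hV.ctrlNorm_bounds hp0 hs (hu.2.le.trans ht) (hG u hu)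
  have hG0 : 0 ≤ G := (hb ((s + t) / 2) ⟨by linarith, by linarith⟩).2.1.1
  have hVa : ∀ a ∈ Ico s t, ‖V' a‖ ≤ G := fun a ha =>
    (hb (max a ((s + t) / 2)) ⟨lt_max_of_lt_right (by linarith), max_lt ha.2 (by linarith)⟩).1 a
      ⟨ha.1, le_max_left _ _⟩
  have hR : VarLE (p / 2) (trunc t (remainder X V V')) s t G :=
    varLE_trunc hp2 hst fun u hu => (hb u hu).2.2
  have hD : VarLE p (trunc t (derivVar V')) s t ((d : ℝ) ^ 2 * G) :=
    varLE_trunc hp0 hst fun u hu => varLE_derivVar hp0 (hb u hu).2.1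
  have hS := isSewable_germ hp0 hX hV
  have fR := (hS.fin_f₁.trunc hp2 t).mono hp2 hs ht
  have fA := hX.finVar_area.mono hp2 hs ht
  have fX := hX.path.finVar.mono hp0 hs ht
  have hA := fA.varLE hp2
  have hx0 := var_nonneg p (incr X) s t
  have hC := sewConst_nonneg p
  have h1 : VarLE (p / 2) (fun a b => ‖XX a b‖) s t (var (p / 2) XX s t) :=
    hA.of_norm_le hp2 fun _ _ _ _ _ => by simp
  -- The three summands are the second-order term and the two sewing errors. In each error the
  -- `p`-variation factor is frozen at a bound for the whole interval, and the `p / 2`-variation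
  -- over the cell is summed through `FinVar.varLE_var`.
  have key := ((h1.const_mul (K := (d : ℝ) ^ 2 * G) (by positivity)).add (by linarith)
    (fR.varLE_var hp2 |>.const_mul (K := sewConst p * var p (incr X) s t) (by positivity))).add
    (by linarith) (fA.varLE_var hp2 |>.const_mul (K := sewConst p * ((d : ℝ) ^ 2 * G))
      (by positivity))
  have hRG := hR.var_le hp2
  refine (key.of_norm_le hp2 fun a b ha hab hb' => ?_).le hp2 ?_
  · simp only [Pi.add_apply]
    rcases hab.eq_or_lt with rfl | hab'
    · simp
    have hVa' := hVa a ⟨ha, hab'.trans_le hb'⟩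
    have ha0 := hs.trans ha
    have hbT := hb'.trans ht
    have e : remainder X J V a b =
        pairing (V' a) (XX a b) + (J b - J a - germ X XX V V' a b) := by
      simp only [remainder, germ, incr]; abel
    have k1 : var (p / 2) (trunc b (remainder X V V')) a b ≤
        var (p / 2) (trunc t (remainder X V V')) a b :=
      (((fR.mono hp2 ha hb').varLE hp2).of_norm_le hp2 fun _ _ _ _ _ =>
        norm_trunc_mono hb' _ _ _).var_le hp2
    have k2 : var p (trunc b (derivVar V')) a b ≤ (d : ℝ) ^ 2 * G :=
      ((hD.mono ha hb').of_norm_le hp0 fun _ _ _ _ _ => norm_trunc_mono hb' _ _ _).var_le hp0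
    have k3 : var p (incr X) a b ≤ var p (incr X) s t := fX.var_mono hp0 ha hb'
    have k4 := var_nonneg (p / 2) (trunc t (remainder X V V')) a b
    have k5 := var_nonneg p (incr X) a b
    have k6 := var_nonneg (p / 2) XX a b
    have b1 : ‖pairing (V' a) (XX a b)‖ ≤ (d : ℝ) ^ 2 * G * ‖XX a b‖ :=
      (norm_pairing_le _ _).trans (by gcongr)
    have b2 : sewBound p (remainder X V V') (incr X) (derivVar V') XX a b ≤
        sewConst p * var p (incr X) s t * var (p / 2) (trunc t (remainder X V V')) a b +
          sewConst p * ((d : ℝ) ^ 2 * G) * var (p / 2) XX a b := by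
      unfold sewBound
      calc _ ≤ sewConst p * (var (p / 2) (trunc t (remainder X V V')) a b * var p (incr X) s t +
            (d : ℝ) ^ 2 * G * var (p / 2) XX a b) := by gcongr
        _ = _ := by ring
    rw [Real.norm_of_nonneg (by positivity), e]
    refine (norm_add_le _ _).trans ?_
    have := hJ' a b ha0 hab hbT
    linarith
  · have hxx := var_nonneg (p / 2) XX s t
    have hCx := mul_nonneg hC hx0
    have := mul_le_mul_of_nonneg_left hRG hCx
    unfold intConst roughNorm
    have n1 : 0 ≤ (d : ℝ) ^ 2 * G * var p (incr X) s t := by positivity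
    have n2 : 0 ≤ sewConst p * G * var (p / 2) XX s t := by positivity
    have n3 : 0 ≤ sewConst p * (d : ℝ) ^ 2 * G * var p (incr X) s t := by positivity
    linarith

theorem IsRoughPath.roughNorm_mono (hp : 0 < p) (hX : IsRoughPath p T X XX) {s t s' t' : ℝ}
    (hs : 0 ≤ s) (ht : t ≤ T) (hs' : s ≤ s') (ht' : t' ≤ t) :
    roughNorm p X XX s' t' ≤ roughNorm p X XX s t := by
  have hp2 : 0 < p / 2 := by positivity
  exact add_le_add ((hX.path.finVar.mono hp hs ht).var_mono hp hs' ht')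
    ((hX.finVar_area.mono hp2 hs ht).var_mono hp2 hs' ht')

theorem roughNorm_nonneg (p : ℝ) (X : ℝ → Vec d) (XX : ℝ → ℝ → Mat d) (s t : ℝ) :
    0 ≤ roughNorm p X XX s t := add_nonneg (var_nonneg _ _ _ _) (var_nonneg _ _ _ _)

theorem IsRoughPath.tendsto_roughNorm (hp : 0 < p) (hX : IsRoughPath p T X XX) {s : ℝ}
    (hs : 0 ≤ s) (hsT : s < T) : Tendsto (fun t => roughNorm p X XX s t) (𝓝[>] s) (𝓝 0) := by
  have hp2 : 0 < p / 2 := by positivity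
  have := (hX.path.finVar.tendsto_right hp hX.path.cadlag.rightContLeft_incr hs hsT).add
    (hX.finVar_area.tendsto_right hp2 hX.area.rightContLeft hs hsT)
  simpa [roughNorm] using this

/-- The rough integral is right-continuous. -/
theorem continuousWithinAt_integral [ProperSpace E] (hp : 2 < p) (hp3 : p < 3)
    (hX : IsRoughPath p T X XX) (hV : IsControlled p T X V V') {J : ℝ → E}
    (hJ : ∀ t ∈ Icc 0 T, HasRoughIntegral X XX V V' 0 t (J t)) {s : ℝ} (hs : s ∈ Ico 0 T) :
    ContinuousWithinAt J (Ioi s) s := by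
  have hp0 : 0 < p := by linarith
  have hp2 : 0 < p / 2 := by positivity
  set G := ctrlNorm p X V V' s T
  have h1 := (hX.tendsto_roughNorm hp0 hs.1 hs.2).const_mul (intConst p d * G)
  have h2 := (hX.path.finVar.tendsto_right hp0 hX.path.cadlag.rightContLeft_incr hs.1
    hs.2).const_mul ‖V s‖
  have h3 := h2.add h1
  simp only [mul_zero, add_zero] at h3
  rw [ContinuousWithinAt, tendsto_iff_norm_sub_tendsto_zero]
  refine squeeze_zero' (Eventually.of_forall fun _ => norm_nonneg _) ?_ h3
  filter_upwards [Ioo_mem_nhdsGT hs.2] with t ht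
  have h4 := (varLE_integral_remainder hp hp3 hX hV hJ hs.1 ht.1 ht.2.le (G := G) fun u hu =>
    hV.ctrlNorm_mono hp0 hs.1 (hu.2.le.trans ht.2.le) le_rfl).norm_le hp2 le_rfl ht.1.le le_rfl
  have h5 := (hX.path.finVar.mono hp0 hs.1 ht.2.le).norm_le hp0 le_rfl ht.1.le le_rfl
  refine (norm_incr_le_remainder X J V s t).trans (add_le_add ?_ h4)
  gcongr

end RoughIntegral

end RoughFDE

namespace RoughFDE

/-! ### A superadditive control for the rough path -/

section RoughControl

variable {d : ℕ} {p T : ℝ} {X : ℝ → Vec d} {XX : ℝ → ℝ → Mat d}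

/-- The superadditive function that controls a rough path. -/
noncomputable def roughControl (p : ℝ) (X : ℝ → Vec d) (XX : ℝ → ℝ → Mat d) (s t : ℝ) : ℝ :=
  var p (incr X) s t ^ p + var (p / 2) XX s t ^ (p / 2)

theorem roughControl_nonneg (p : ℝ) (X : ℝ → Vec d) (XX : ℝ → ℝ → Mat d) (s t : ℝ) :
    0 ≤ roughControl p X XX s t :=
  add_nonneg (Real.rpow_nonneg (var_nonneg _ _ _ _) _) (Real.rpow_nonneg (var_nonneg _ _ _ _) _)

theorem IsRoughPath.roughControl_superadditive (hp : 0 < p) (hX : IsRoughPath p T X XX)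
    {s u t : ℝ} (hs : 0 ≤ s) (hsu : s ≤ u) (hut : u ≤ t) (ht : t ≤ T) :
    roughControl p X XX s u + roughControl p X XX u t ≤ roughControl p X XX s t := by
  have hp2 : 0 < p / 2 := by positivity
  have h1 := (hX.path.finVar.mono hp hs ht).superadditive hp hsu hut
  have h2 := (hX.finVar_area.mono hp2 hs ht).superadditive hp2 hsu hut
  unfold roughControl
  linarith

theorem IsRoughPath.roughControl_lsc (hp : 0 < p) (hX : IsRoughPath p T X XX) {u t : ℝ}
    (hu : 0 ≤ u) (hut : u < t) (ht : t ≤ T) {η : ℝ} (hη : 0 < η) :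
    ∀ᶠ v in 𝓝[>] u, roughControl p X XX u t ≤ roughControl p X XX v t + η := by
  have hp2 : 0 < p / 2 := by positivity
  filter_upwards [(hX.path.finVar.mono hp le_rfl ht).eventually_le hp
      (fun u v hu huv hv => hX.path.cadlag.rightContLeft_incr u v hu huv (hv.trans ht)) hu hut
        (half_pos hη),
    (hX.finVar_area.mono hp2 le_rfl ht).eventually_le hp2
      (fun u v hu huv hv => hX.area.rightContLeft u v hu huv (hv.trans ht)) hu hut
        (half_pos hη)] with v h1 h2
  unfold roughControl
  linarith

/-- The path contributes at most `ε / 2` and the area at most `(ε / 2) ^ 2`, which is no more than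
`ε / 2` as `ε ≤ 1`. -/
theorem roughNorm_le_of_roughControl_le (hp : 0 < p) {ε s t : ℝ} (hε : 0 < ε)
    (hε1 : ε ≤ 1) (h : roughControl p X XX s t ≤ (ε / 2) ^ p) : roughNorm p X XX s t ≤ ε := by
  have h1 := var_nonneg p (incr X) s t
  have h2 := var_nonneg (p / 2) XX s t
  have h3 := Real.rpow_nonneg h1 p
  have h4 := Real.rpow_nonneg h2 (p / 2)
  unfold roughControl at h
  have h5 : var p (incr X) s t ≤ ε / 2 :=
    (Real.rpow_le_rpow_iff h1 (by positivity) hp).1 (by linarith)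
  have h6 : var (p / 2) XX s t ≤ (ε / 2) ^ 2 := by
    refine (Real.rpow_le_rpow_iff h2 (by positivity) (z := p / 2) (by positivity)).1 ?_
    rw [← Real.rpow_natCast, ← Real.rpow_mul (by positivity)]
    have : ((2 : ℕ) : ℝ) * (p / 2) = p := by push_cast; ring
    rw [this]
    linarith
  unfold roughNorm
  nlinarith

theorem roughControl_le (hp : 0 < p) (s t : ℝ) :
    roughControl p X XX s t ≤ roughNorm p X XX s t ^ p + roughNorm p X XX s t ^ (p / 2) := by
  have h1 := var_nonneg p (incr X) s t
  have h2 := var_nonneg (p / 2) XX s t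
  unfold roughControl roughNorm
  gcongr <;> linarith

end RoughControl

/-! ### The fixed point map -/

section Image

variable {d k : ℕ} {p T : ℝ} {X : ℝ → Vec d} {XX : ℝ → ℝ → Mat d}
  {F : (ℝ → Vec k) → ℝ → Vec d →L[ℝ] Vec k}
  {F' : (ℝ → Vec k) → (ℝ → Vec d →L[ℝ] Vec k) → ℝ → Vec d →L[ℝ] Vec d →L[ℝ] Vec k}
  {y : ℝ → Vec k} {y' : ℝ → Vec d →L[ℝ] Vec k}
  {Y Z : ℝ → Vec k} {Y' Z' : ℝ → Vec d →L[ℝ] Vec k}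

/-- `(Z, Z')` is the image of `(Y, Y')` under the fixed point map of the equation. -/
structure IsImage (p T : ℝ) (X : ℝ → Vec d) (XX : ℝ → ℝ → Mat d)
    (F : (ℝ → Vec k) → ℝ → Vec d →L[ℝ] Vec k)
    (F' : (ℝ → Vec k) → (ℝ → Vec d →L[ℝ] Vec k) → ℝ → Vec d →L[ℝ] Vec d →L[ℝ] Vec k)
    (y : ℝ → Vec k) (y' : ℝ → Vec d →L[ℝ] Vec k) (Y : ℝ → Vec k) (Y' : ℝ → Vec d →L[ℝ] Vec k)
    (Z : ℝ → Vec k) (Z' : ℝ → Vec d →L[ℝ] Vec k) : Prop where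
  source : IsControlled p T X Y Y'
  target : IsControlled p T X Z Z'
  deriv_eq : ∀ t ∈ Icc 0 T, Z' t = y' t + F Y t
  integral_eq : ∀ t ∈ Icc 0 T, HasRoughIntegral X XX (F Y) (F' Y Y') 0 t (Z t - y t)

theorem IsSolution.isImage (h : IsSolution p T X F F' XX y y' Y Y') :
    IsImage p T X XX F F' y y' Y Y' Y Y' :=
  ⟨h.controlled, h.controlled, h.deriv_eq, h.integral_eq⟩

theorem exists_image (hp : 2 < p) (hp3 : p < 3) (hT : 0 < T) (hX : IsRoughPath p T X XX)
    (hy : IsControlled p T X y y') (hF : IsNonAnticipative p T X F F')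
    (hY : IsControlled p T X Y Y') : ∃ Z Z', IsImage p T X XX F F' y y' Y Y' Z Z' := by
  have hp0 : 0 < p := by linarith
  have hp2 : 0 < p / 2 := by positivity
  have hV := hF.maps Y Y' hY
  obtain ⟨J, hJ, -⟩ := exists_roughIntegral hp hp3 hT.le hX hV
  have h1 := varLE_integral_remainder hp hp3 hX hV hJ le_rfl hT le_rfl
    (G := ctrlNorm p X (F Y) (F' Y Y') 0 T) fun u hu => hV.ctrlNorm_mono hp0 le_rfl hu.2.le le_rfl
  have h2 := (hy.finVar_remainder.varLE hp2).add (by linarith) h1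
  have e : remainder X y y' + remainder X J (F Y) =
      remainder X (fun t => y t + J t) (fun t => y' t + F Y t) := by
    ext1 a; ext1 b
    simp only [Pi.add_apply, remainder, incr, _root_.add_apply]
    abel
  rw [e] at h2
  refine ⟨fun t => y t + J t, fun t => y' t + F Y t, hY,
    isControlled_of_varLE hp.le hX.path (hy.deriv.add (by linarith) hV.path) (fun t ht =>
      (hy.path.cadlag.1 t ht).add (continuousWithinAt_integral hp hp3 hX hV hJ ht)) h2,
    fun t _ => rfl, fun t ht => by simpa using hJ t ht⟩

/-- The bound over the closed interval uses the integrand only on `[s, u]` with `u < t`. This is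
what allows passing from `[s, t)` to `[s, t]`. -/
theorem IsImage.var_remainder_le (hp : 2 < p) (hp3 : p < 3) (hX : IsRoughPath p T X XX)
    (hy : IsControlled p T X y y') (hF : IsNonAnticipative p T X F F')
    (h : IsImage p T X XX F F' y y' Y Y' Z Z') {s t G : ℝ} (hs : 0 ≤ s) (hst : s < t)
    (ht : t ≤ T) (hG : ∀ u ∈ Ioo s t, ctrlNorm p X (F Y) (F' Y Y') s u ≤ G) :
    var (p / 2) (remainder X Z Z') s t ≤ var (p / 2) (remainder X y y') s t +
      intConst p d * G * roughNorm p X XX s t := by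
  have hp2 : 0 < p / 2 := by positivity
  have h1 := varLE_integral_remainder hp hp3 hX (hF.maps Y Y' h.source) h.integral_eq hs hst ht hG
  refine (((hy.finVar_remainder.mono hp2 hs ht).varLE hp2).add (by linarith) h1 |>.of_norm_le hp2
    fun a b ha hab hb => le_of_eq ?_).var_le hp2
  congr 1
  simp only [Pi.add_apply, remainder, incr, h.deriv_eq a ⟨hs.trans ha, hab.trans (hb.trans ht)⟩,
    _root_.add_apply]
  abel

/-- The growth condition speaks of positive times; time zero follows by right-continuity of `F Y`.
-/
theorem GrowthCondition.norm_le {CF : ℝ} (hG : GrowthCondition p T X F F' CF)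
    (hF : IsNonAnticipative p T X F F') (hT : 0 < T) (hY : IsControlled p T X Y Y') {t : ℝ}
    (ht : t ∈ Icc 0 T) : ‖F Y t‖ ≤ CF := by
  rcases ht.1.eq_or_lt with rfl | ht0
  · have h1 := ((hF.maps Y Y' hY).path.cadlag.1 0 ⟨le_rfl, hT⟩).norm
    refine le_of_tendsto h1 ?_
    filter_upwards [Ioo_mem_nhdsGT hT] with u hu
    exact (hG Y Y' hY 0 u le_rfl hu.1 hu.2.le).1
  · exact (hG Y Y' hY 0 t le_rfl ht0 ht.2).1

theorem IsImage.varLE_deriv (hp : 1 ≤ p) (hy : IsControlled p T X y y')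
    (h : IsImage p T X XX F F' y y' Y Y' Z Z') {s t c : ℝ} (hs : 0 ≤ s) (ht : t ≤ T)
    (hc : VarLE p (incr (F Y)) s t c) :
    VarLE p (incr Z') s t (var p (incr y') s t + c) := by
  have hp0 : 0 < p := by linarith
  refine ((hy.deriv.finVar.mono hp0 hs ht).varLE hp0).add hp hc |>.of_norm_le hp0
    fun a b ha hab hb => le_of_eq ?_
  congr 1
  simp only [Pi.add_apply, incr, h.deriv_eq a ⟨hs.trans ha, hab.trans (hb.trans ht)⟩,
    h.deriv_eq b ⟨hs.trans (ha.trans hab), hb.trans ht⟩]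
  abel

end Image

/-! ### The a priori bound, uniform over Picard iterates -/

section APriori

variable {d k : ℕ} {p T : ℝ} {X : ℝ → Vec d} {XX : ℝ → ℝ → Mat d}
  {F : (ℝ → Vec k) → ℝ → Vec d →L[ℝ] Vec k}
  {F' : (ℝ → Vec k) → (ℝ → Vec d →L[ℝ] Vec k) → ℝ → Vec d →L[ℝ] Vec d →L[ℝ] Vec k}
  {y : ℝ → Vec k} {y' : ℝ → Vec d →L[ℝ] Vec k}
  {Y Z : ℝ → Vec k} {Y' Z' : ℝ → Vec d →L[ℝ] Vec k}

/-- The invariant bound for `|Y'_s| + ‖Y'‖_p` on short intervals. -/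
def derivBound (a b : ℝ) : ℝ := 2 * a + 4 * b + a * b

/-- The invariant bound for the seminorm of a controlled path on short intervals. -/
def localBound (a b : ℝ) : ℝ := derivBound a b + (a + 1)

/-- A bound for the seminorm of the integrand on short intervals. -/
def integrandBound (a b c : ℝ) : ℝ := b * (1 + localBound a b) ^ 2 * (1 + c) ^ 2

/-- The inverse of the size of the intervals on which the local bound is invariant. -/
noncomputable def invSize (p : ℝ) (d : ℕ) (a b c : ℝ) : ℝ :=
  1 + localBound a b + intConst p d * integrandBound a b c

/-- A bound for the seminorm on closed intervals whose interior is short. -/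
noncomputable def closedBound (p : ℝ) (d : ℕ) (a b c : ℝ) : ℝ :=
  a + b + (a + (b * (1 + localBound a b * c + localBound a b) + 2 * b)) +
    (a + intConst p d * integrandBound a b c * c)

/-- The number of short intervals. -/
noncomputable def intervalCount (p : ℝ) (d : ℕ) (a b c : ℝ) : ℕ :=
  ⌈(c ^ p + c ^ (p / 2)) * (2 * invSize p d a b c) ^ p⌉₊

/-- The a priori bound. -/
noncomputable def globalBound (p : ℝ) (d : ℕ) (a b c : ℝ) : ℝ :=
  (intervalCount p d a b c + 1) * (1 + c) ^ intervalCount p d a b c * closedBound p d a b c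

section Monotonicity

variable {a b c a' b' c' : ℝ}

theorem localBound_mono (ha : 0 ≤ a) (hb : 0 ≤ b) (ha' : a ≤ a') (hb' : b ≤ b') :
    localBound a b ≤ localBound a' b' := by
  have : 0 ≤ a' := ha.trans ha'
  unfold localBound derivBound
  gcongr

theorem localBound_nonneg (ha : 0 ≤ a) (hb : 0 ≤ b) : 0 ≤ localBound a b := by
  unfold localBound derivBound; positivity

theorem integrandBound_nonneg (hb : 0 ≤ b) : 0 ≤ integrandBound a b c := by
  unfold integrandBound; positivity

theorem integrandBound_mono (ha : 0 ≤ a) (hb : 0 ≤ b) (hc : 0 ≤ c) (ha' : a ≤ a') (hb' : b ≤ b')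
    (hc' : c ≤ c') : integrandBound a b c ≤ integrandBound a' b' c' := by
  have := localBound_mono ha hb ha' hb'
  have := localBound_nonneg ha hb
  have : 0 ≤ b' := hb.trans hb'
  unfold integrandBound
  gcongr

theorem invSize_mono (ha : 0 ≤ a) (hb : 0 ≤ b) (hc : 0 ≤ c) (ha' : a ≤ a') (hb' : b ≤ b')
    (hc' : c ≤ c') : invSize p d a b c ≤ invSize p d a' b' c' := by
  have := localBound_mono ha hb ha' hb'
  have := integrandBound_mono ha hb hc ha' hb' hc'
  have := intConst_nonneg p d
  unfold invSize
  gcongr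

theorem one_le_invSize (ha : 0 ≤ a) (hb : 0 ≤ b) : 1 ≤ invSize p d a b c := by
  have := localBound_nonneg ha hb
  have := mul_nonneg (intConst_nonneg p d) (integrandBound_nonneg (a := a) (c := c) hb)
  unfold invSize
  linarith

theorem closedBound_nonneg (ha : 0 ≤ a) (hb : 0 ≤ b) (hc : 0 ≤ c) : 0 ≤ closedBound p d a b c := by
  have := localBound_nonneg ha hb
  have := mul_nonneg (intConst_nonneg p d) (integrandBound_nonneg (a := a) (c := c) hb)
  unfold closedBound
  positivity

theorem closedBound_mono (ha : 0 ≤ a) (hb : 0 ≤ b) (hc : 0 ≤ c) (ha' : a ≤ a') (hb' : b ≤ b')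
    (hc' : c ≤ c') : closedBound p d a b c ≤ closedBound p d a' b' c' := by
  have h1 := localBound_mono ha hb ha' hb'
  have h2 := localBound_nonneg ha hb
  have h3 := h2.trans h1
  have h4 := integrandBound_mono ha hb hc ha' hb' hc'
  have h5 := integrandBound_nonneg (a := a) (c := c) hb
  have h6 := h5.trans h4
  have := intConst_nonneg p d
  have : 0 ≤ b' := hb.trans hb'
  unfold closedBound
  gcongr

theorem intervalCount_mono (hp : 0 < p) (ha : 0 ≤ a) (hb : 0 ≤ b) (hc : 0 ≤ c) (ha' : a ≤ a')
    (hb' : b ≤ b') (hc' : c ≤ c') : intervalCount p d a b c ≤ intervalCount p d a' b' c' := by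
  have := invSize_mono (p := p) (d := d) ha hb hc ha' hb' hc'
  have := one_le_invSize (p := p) (d := d) (c := c) ha hb
  have : 0 ≤ c' := hc.trans hc'
  unfold intervalCount
  gcongr

theorem globalBound_nonneg (ha : 0 ≤ a) (hb : 0 ≤ b) (hc : 0 ≤ c) : 0 ≤ globalBound p d a b c := by
  have := closedBound_nonneg (p := p) (d := d) ha hb hc
  unfold globalBound
  positivity

theorem globalBound_mono (hp : 0 < p) (ha : 0 ≤ a) (hb : 0 ≤ b) (hc : 0 ≤ c) (ha' : a ≤ a')
    (hb' : b ≤ b') (hc' : c ≤ c') : globalBound p d a b c ≤ globalBound p d a' b' c' := by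
  have h1 := closedBound_mono (p := p) (d := d) ha hb hc ha' hb' hc'
  have h2 := closedBound_nonneg (p := p) (d := d) ha hb hc
  have h3 := intervalCount_mono (d := d) hp ha hb hc ha' hb' hc'
  have h4 : (1 + c) ^ intervalCount p d a b c ≤ (1 + c') ^ intervalCount p d a' b' c' :=
    (pow_le_pow_left₀ (by positivity) (by linarith) _).trans
      (pow_le_pow_right₀ (by linarith) h3)
  have h5 : 0 ≤ (1 + c) ^ intervalCount p d a b c := by positivity
  have h6 := h5.trans h4
  unfold globalBound
  gcongr

end Monotonicity

/-- The data of the equation satisfy the assumptions of the a priori bound. -/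
structure IsBoundedEquation (p T : ℝ) (X : ℝ → Vec d) (XX : ℝ → ℝ → Mat d)
    (F : (ℝ → Vec k) → ℝ → Vec d →L[ℝ] Vec k)
    (F' : (ℝ → Vec k) → (ℝ → Vec d →L[ℝ] Vec k) → ℝ → Vec d →L[ℝ] Vec d →L[ℝ] Vec k)
    (y : ℝ → Vec k) (y' : ℝ → Vec d →L[ℝ] Vec k) (CF : ℝ) : Prop where
  two_lt : 2 < p
  lt_three : p < 3
  pos : 0 < T
  rough : IsRoughPath p T X XX
  start : IsControlled p T X y y'
  nonAnticipative : IsNonAnticipative p T X F F'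
  const_pos : 0 < CF
  growth : GrowthCondition p T X F F' CF

variable {CF : ℝ}

/-- The local bound is invariant under the fixed point map, and it gives a bound on the closed
interval for the image. -/
theorem IsBoundedEquation.image_bounds (H : IsBoundedEquation p T X XX F F' y y' CF)
    (h : IsImage p T X XX F F' y y' Y Y' Z Z') {a c s t : ℝ} (ha : ctrlNorm p X y y' 0 T = a)
    (hc : roughNorm p X XX 0 T = c) (hs : 0 ≤ s) (hst : s < t) (ht : t ≤ T)
    (hsmall : ∀ u ∈ Ioo s t, roughNorm p X XX s u ≤ 1 / invSize p d a CF c)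
    (hY : ∀ u ∈ Ioo s t, ‖Y' s‖ + var p (incr Y') s u ≤ derivBound a CF ∧
      var (p / 2) (remainder X Y Y') s u ≤ a + 1) :
    (∀ u ∈ Ioo s t, ‖Z' s‖ + var p (incr Z') s u ≤ derivBound a CF ∧
      var (p / 2) (remainder X Z Z') s u ≤ a + 1) ∧
    ctrlNorm p X Z Z' s t ≤ closedBound p d a CF c := by
  have hp := H.two_lt
  have hp0 : 0 < p := by linarith
  have hp2 : 0 < p / 2 := by positivity
  have hb := H.const_pos
  have ha0 : 0 ≤ a := ha ▸ ctrlNorm_nonneg _ _ _ _ _ _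
  have hc0 : 0 ≤ c := hc ▸ roughNorm_nonneg _ _ _ _ _
  have hV := H.nonAnticipative.maps Y Y' h.source
  obtain ⟨y1, y2, y3⟩ := H.start.ctrlNorm_bounds hp0 le_rfl le_rfl ha.le
  have hM0 := localBound_nonneg ha0 hb.le
  have hG0 := integrandBound_nonneg (a := a) (c := c) hb.le
  have hC0 := intConst_nonneg p d
  have hI := one_le_invSize (p := p) (d := d) (c := c) ha0 hb.le
  have hxc : ∀ u, u ≤ T → var p (incr X) s u ≤ c := fun u hu => by
    have h1 := H.rough.roughNorm_mono hp0 le_rfl le_rfl hs hu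
    rw [hc] at h1
    have := var_nonneg (p / 2) XX s u
    unfold roughNorm at h1
    linarith
  have hsT : s ∈ Icc 0 T := ⟨hs, hst.le.trans ht⟩
  have hZs : ‖Z' s‖ ≤ a + CF := by
    rw [h.deriv_eq s hsT]
    exact (norm_add_le _ _).trans (add_le_add (y1 s hsT)
      (H.growth.norm_le H.nonAnticipative H.pos h.source hsT))
  have hgr : ∀ u ∈ Ioo s t, ctrlNorm p X (F Y) (F' Y Y') s u ≤ integrandBound a CF c := by
    intro u hu
    obtain ⟨h1, h2⟩ := hY u hu
    refine (H.growth Y Y' h.source s u hs hu.1 (hu.2.le.trans ht)).2.2.2.trans ?_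
    have h3 : ctrlNorm p X Y Y' s u ≤ localBound a CF := by
      unfold ctrlNorm localBound; linarith
    have h4 := hxc u (hu.2.le.trans ht)
    have h5 := var_nonneg p (incr X) s u
    have h6 := ctrlNorm_nonneg p X Y Y' s u
    unfold integrandBound
    gcongr
  have hyv : ∀ u, u ≤ T → var p (incr y') s u ≤ a := fun u hu => (y2.mono hs hu).var_le hp0
  have hyr : ∀ u, u ≤ T → var (p / 2) (remainder X y y') s u ≤ a := fun u hu =>
    (y3.mono hs hu).var_le hp2
  have hVv : ∀ u, u ≤ T → VarLE p (incr (F Y)) s u (var p (incr (F Y)) s u) := fun u hu =>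
    (hV.path.finVar.mono hp0 hs hu).varLE hp0
  have hFv : ∀ u ∈ Ioo s t, var p (incr (F Y)) s u ≤
      CF * (1 + (‖Y' s‖ + var p (incr Y') s u) * var p (incr X) s u +
        var (p / 2) (remainder X Y Y') s u) := fun u hu =>
    (H.growth Y Y' h.source s u hs hu.1 (hu.2.le.trans ht)).2.2.1
  refine ⟨fun u hu => ?_, ?_⟩
  · have huT := hu.2.le.trans ht
    obtain ⟨m1, m2⟩ := hY u hu
    have hε := hsmall u hu
    have hrn := roughNorm_nonneg p X XX s u
    have hx : var p (incr X) s u ≤ 1 / invSize p d a CF c := by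
      have := var_nonneg (p / 2) XX s u
      unfold roughNorm at hε
      linarith
    have hinv : 0 < invSize p d a CF c := by linarith
    have hD0 : 0 ≤ derivBound a CF := by unfold derivBound; positivity
    constructor
    -- Here `a + CF` bounds `Z' s`, `a` bounds the variation of `y'`, and `CF * (3 + a)` that of `F
    -- Y`, since smallness makes the product with `X` at most `1`. The sum is `derivBound a CF`.
    · have h1 := (h.varLE_deriv (by linarith) H.start hs huT (hVv u huT)).var_le hp0
      have h2 := hFv u hu
      have h3 : (‖Y' s‖ + var p (incr Y') s u) * var p (incr X) s u ≤ 1 := by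
        calc _ ≤ derivBound a CF * (1 / invSize p d a CF c) :=
              mul_le_mul m1 hx (var_nonneg _ _ _ _) hD0
          _ ≤ 1 := by
              rw [mul_one_div, div_le_one hinv]
              have := mul_nonneg hC0 hG0
              unfold invSize localBound
              linarith
      have h4 : CF * (1 + (‖Y' s‖ + var p (incr Y') s u) * var p (incr X) s u +
          var (p / 2) (remainder X Y Y') s u) ≤ CF * (1 + 1 + (a + 1)) := by gcongr
      have h5 := hyv u huT
      unfold derivBound
      linarith
    -- The quadratic growth of the integrand is paid for by the small rough norm, so the new
    -- remainder exceeds that of `y` by at most `1`, whatever the iterate.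
    · have h1 := h.var_remainder_le hp H.lt_three H.rough H.start H.nonAnticipative hs hu.1 huT
        fun v hv => hgr v ⟨hv.1, hv.2.trans hu.2⟩
      have h2 : intConst p d * integrandBound a CF c * roughNorm p X XX s u ≤ 1 := by
        calc _ ≤ intConst p d * integrandBound a CF c * (1 / invSize p d a CF c) := by gcongr
          _ ≤ 1 := by
              rw [mul_one_div, div_le_one hinv]
              unfold invSize
              linarith
      have := hyr u huT
      linarith
  · have h1 := h.var_remainder_le hp H.lt_three H.rough H.start H.nonAnticipative hs hst ht hgr
    have h2 : intConst p d * integrandBound a CF c * roughNorm p X XX s t ≤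
        intConst p d * integrandBound a CF c * c := by
      have := H.rough.roughNorm_mono hp0 le_rfl le_rfl hs ht
      rw [hc] at this
      gcongr
    -- At `t` the increment of `F Y` is not small, but boundedness of `F` limits it to `2 * CF`.
    have h3 : VarLE p (incr (F Y)) s t
        (CF * (1 + localBound a CF * c + localBound a CF) + 2 * CF) := by
      refine varLE_of_Ico (by linarith) hst (incr_self _ _) (fun u hu => ?_) (by positivity)
        fun u hu => ?_
      · refine (hVv u (hu.2.le.trans ht)).le hp0 ((hFv u hu).trans ?_)
        obtain ⟨m1, m2⟩ := hY u hu
        have k1 : ‖Y' s‖ + var p (incr Y') s u ≤ localBound a CF := by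
          unfold localBound; linarith
        have k2 : var (p / 2) (remainder X Y Y') s u ≤ localBound a CF := by
          have := norm_nonneg (Y' s)
          have := var_nonneg p (incr Y') s u
          unfold localBound; linarith
        have k3 := hxc u (hu.2.le.trans ht)
        have k4 := var_nonneg p (incr X) s u
        gcongr
      · have k1 := H.growth.norm_le H.nonAnticipative H.pos h.source (t := t)
          ⟨hs.trans hst.le, ht⟩
        have k2 := H.growth.norm_le H.nonAnticipative H.pos h.source (t := u)
          ⟨hs.trans hu.1, hu.2.le.trans ht⟩
        exact (norm_sub_le _ _).trans (by linarith)
    have h4 := (h.varLE_deriv (by linarith) H.start hs ht h3).var_le hp0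
    have := hyv t ht
    have := hyr t ht
    unfold ctrlNorm closedBound
    linarith

/-- A sequence of Picard iterates that starts at zero. -/
structure IsPicard (p T : ℝ) (X : ℝ → Vec d) (XX : ℝ → ℝ → Mat d)
    (F : (ℝ → Vec k) → ℝ → Vec d →L[ℝ] Vec k)
    (F' : (ℝ → Vec k) → (ℝ → Vec d →L[ℝ] Vec k) → ℝ → Vec d →L[ℝ] Vec d →L[ℝ] Vec k)
    (y : ℝ → Vec k) (y' : ℝ → Vec d →L[ℝ] Vec k) (Y : ℕ → ℝ → Vec k)
    (Y' : ℕ → ℝ → Vec d →L[ℝ] Vec k) : Prop where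
  zero : Y 0 = 0
  zero' : Y' 0 = 0
  image : ∀ n, IsImage p T X XX F F' y y' (Y n) (Y' n) (Y (n + 1)) (Y' (n + 1))

theorem IsBoundedEquation.exists_picard (H : IsBoundedEquation p T X XX F F' y y' CF) :
    ∃ Y Y', IsPicard p T X XX F F' y y' Y Y' := by
  have hex : ∀ P : {P : (ℝ → Vec k) × (ℝ → Vec d →L[ℝ] Vec k) // IsControlled p T X P.1 P.2},
      ∃ Q : {P : (ℝ → Vec k) × (ℝ → Vec d →L[ℝ] Vec k) // IsControlled p T X P.1 P.2},
        IsImage p T X XX F F' y y' P.1.1 P.1.2 Q.1.1 Q.1.2 := fun P => by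
    obtain ⟨Z, Z', hZ⟩ := exists_image H.two_lt H.lt_three H.pos H.rough H.start
      H.nonAnticipative P.2
    exact ⟨⟨(Z, Z'), hZ.target⟩, hZ⟩
  choose Φ hΦ using hex
  have h0 := isControlled_zero (E := Vec k) H.rough.path H.two_lt.le
  let S : ℕ → {P : (ℝ → Vec k) × (ℝ → Vec d →L[ℝ] Vec k) // IsControlled p T X P.1 P.2} :=
    fun n => Φ^[n] ⟨(0, 0), h0⟩
  refine ⟨fun n => (S n).1.1, fun n => (S n).1.2, rfl, rfl, fun n => ?_⟩
  have := hΦ (S n)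
  rwa [show Φ (S n) = S (n + 1) from (Function.iterate_succ_apply' Φ n _).symm] at this

/-- The intervals are chosen from the rough path alone, so one subdivision serves all iterates. The
zero path satisfies the local bounds, and the map preserves them. -/
theorem IsBoundedEquation.picard_bound (H : IsBoundedEquation p T X XX F F' y y' CF)
    {Y : ℕ → ℝ → Vec k} {Y' : ℕ → ℝ → Vec d →L[ℝ] Vec k}
    (h : IsPicard p T X XX F F' y y' Y Y') (n : ℕ) :
    ctrlNorm p X (Y n) (Y' n) 0 T ≤
      globalBound p d (ctrlNorm p X y y' 0 T) CF (roughNorm p X XX 0 T) := by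
  have hp := H.two_lt
  have hp0 : 0 < p := by linarith
  have hb := H.const_pos
  obtain ⟨a, ha⟩ : ∃ a, a = ctrlNorm p X y y' 0 T := ⟨_, rfl⟩
  obtain ⟨c, hc⟩ : ∃ c, c = roughNorm p X XX 0 T := ⟨_, rfl⟩
  rw [← ha, ← hc]
  have ha0 : 0 ≤ a := ha ▸ ctrlNorm_nonneg _ _ _ _ _ _
  have hc0 : 0 ≤ c := hc ▸ roughNorm_nonneg _ _ _ _ _
  have hI := one_le_invSize (p := p) (d := d) (c := c) ha0 hb.le
  have hI0 : 0 < invSize p d a CF c := by linarith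
  have hK0 := closedBound_nonneg (p := p) (d := d) ha0 hb.le hc0
  have hz : ∀ s t, ‖Y' 0 s‖ = 0 ∧ var p (incr (Y' 0)) s t = 0 ∧
      var (p / 2) (remainder X (Y 0) (Y' 0)) s t = 0 := by
    intro s t
    have e1 : incr (0 : ℝ → Vec d →L[ℝ] Vec k) = fun _ _ => 0 := by ext; simp [incr]
    have e2 : remainder X (0 : ℝ → Vec k) (0 : ℝ → Vec d →L[ℝ] Vec k) = fun _ _ => 0 := by
      ext; simp [remainder, incr]
    have e3 : ∀ {G : Type} [NormedAddCommGroup G] (q : ℝ), 0 < q →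
        var q (fun _ _ => (0 : G)) s t = 0 := fun {G} _ q hq =>
      le_antisymm (VarLE.var_le hq ⟨le_rfl, fun a n _ => by simp [Real.zero_rpow hq.ne']⟩)
        (var_nonneg _ _ _ _)
    rw [h.zero, h.zero', e1, e2]
    exact ⟨by simp, e3 p hp0, e3 (p / 2) (by positivity)⟩
  have hsm : ∀ s t, 0 ≤ s → s < t → t ≤ T →
      (∀ u ∈ Ioo s t, roughNorm p X XX s u ≤ 1 / invSize p d a CF c) → ∀ n,
      (∀ u ∈ Ioo s t, ‖Y' n s‖ + var p (incr (Y' n)) s u ≤ derivBound a CF ∧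
        var (p / 2) (remainder X (Y n) (Y' n)) s u ≤ a + 1) ∧
      ctrlNorm p X (Y n) (Y' n) s t ≤ closedBound p d a CF c := by
    intro s t hs hst ht hsmall n
    induction n with
    | zero =>
      refine ⟨fun u _ => ?_, ?_⟩
      · obtain ⟨z1, z2, z3⟩ := hz s u
        rw [z1, z2, z3]
        have : 0 ≤ derivBound a CF := by unfold derivBound; positivity
        constructor <;> linarith
      · obtain ⟨z1, z2, z3⟩ := hz s t
        rw [ctrlNorm, z1, z2, z3]
        simpa using hK0
    | succ n ih => exact H.image_bounds (h.image n) ha.symm hc.symm hs hst ht hsmall ih.1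
  set ε := 1 / invSize p d a CF c with hε
  have hε0 : 0 < ε := by positivity
  have hε1 : ε ≤ 1 := by rw [hε, div_le_one hI0]; exact hI
  have hmain := control_induction (ω := roughControl p X XX) (T := T) (θ := (ε / 2) ^ p)
    (by positivity) (roughControl_nonneg p X XX)
    (fun s u t hs hsu hut ht => H.rough.roughControl_superadditive hp0 hs hsu hut ht)
    (fun u t hu hut ht η hη => H.rough.roughControl_lsc hp0 hu hut ht hη)
    -- Every gluing multiplies by at most `1 + c` and adds one more piece, whence `(m + 1) * (1 + c)
    -- ^ m`.
    (Q := fun m s t => ∀ n, ctrlNorm p X (Y n) (Y' n) s t ≤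
      (m + 1) * (1 + c) ^ m * closedBound p d a CF c)
    ?_ ?_ ?_ (intervalCount p d a CF c) 0 T le_rfl H.pos le_rfl ?_
  · exact hmain n
  · intro s t hs hst ht hω n
    simpa using (hsm s t hs hst ht (fun u hu =>
      roughNorm_le_of_roughControl_le hp0 hε0 hε1 (hω u hu)) n).2
  · intro m s u t hs hsu hut ht h1 h2 n
    have h3 := (h.image n).source.ctrlNorm_glue hp.le H.rough.path hs hsu.le hut.le ht
    have hxc : var p (incr X) 0 T ≤ c := by
      have := var_nonneg (p / 2) XX 0 T
      rw [hc, roughNorm]; linarith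
    have h4 := h1 n
    have h5 := h2 n
    have h6 := ctrlNorm_nonneg p X (Y n) (Y' n) s u
    have h7 := ctrlNorm_nonneg p X (Y n) (Y' n) u t
    have h8 : (1 : ℝ) ≤ (1 + c) ^ m := one_le_pow₀ (by linarith)
    simp only [Nat.cast_zero, zero_add, pow_zero, one_mul] at h4
    calc _ ≤ (1 + var p (incr X) 0 T) * (ctrlNorm p X (Y n) (Y' n) s u +
            ctrlNorm p X (Y n) (Y' n) u t) := h3
      _ ≤ (1 + c) * ((1 + c) ^ m * closedBound p d a CF c +
            (m + 1) * (1 + c) ^ m * closedBound p d a CF c) := by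
          have := h4.trans (le_mul_of_one_le_left hK0 h8)
          gcongr
      _ = _ := by push_cast; ring
  · intro m s t hQ n
    refine (hQ n).trans ?_
    have h8 : (1 + c) ^ m ≤ (1 + c) ^ (m + 1) := pow_le_pow_right₀ (by linarith) (by omega)
    push_cast
    gcongr
    linarith
  · have h1 := roughControl_le (X := X) (XX := XX) hp0 0 T
    rw [← hc] at h1
    have h2 : (ε / 2) ^ p * (2 * invSize p d a CF c) ^ p = 1 := by
      rw [← Real.mul_rpow (by positivity) (by positivity), hε,
        show 1 / invSize p d a CF c / 2 * (2 * invSize p d a CF c) = 1 by field_simp,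
        Real.one_rpow]
    calc roughControl p X XX 0 T ≤ (c ^ p + c ^ (p / 2)) *
          ((2 * invSize p d a CF c) ^ p * (ε / 2) ^ p) := by rw [mul_comm _ ((ε / 2) ^ p), h2]; linarith
      _ = (c ^ p + c ^ (p / 2)) * (2 * invSize p d a CF c) ^ p * (ε / 2) ^ p := by ring
      _ ≤ intervalCount p d a CF c * (ε / 2) ^ p := by
          gcongr
          exact Nat.le_ceil _

end APriori

end RoughFDE

/-! ### Geometric decay of differences of iterates -/

namespace RoughFDE

/-- Bounded by a multiple of `(3 / 4) ^ n`. -/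
def GeoBounded (f : ℕ → ℝ) : Prop := ∃ B : ℝ, 0 ≤ B ∧ ∀ n, f n ≤ B * (3 / 4) ^ n

namespace GeoBounded

variable {f g : ℕ → ℝ}

theorem mono (hf : GeoBounded f) (h : ∀ n, g n ≤ f n) : GeoBounded g := by
  obtain ⟨B, hB, H⟩ := hf
  exact ⟨B, hB, fun n => (h n).trans (H n)⟩

theorem add (hf : GeoBounded f) (hg : GeoBounded g) : GeoBounded fun n => f n + g n := by
  obtain ⟨B, hB, H⟩ := hf
  obtain ⟨D, hD, H'⟩ := hg
  exact ⟨B + D, add_nonneg hB hD, fun n => by rw [add_mul]; exact add_le_add (H n) (H' n)⟩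

theorem const_mul (hf : GeoBounded f) {c : ℝ} (hc : 0 ≤ c) : GeoBounded fun n => c * f n := by
  obtain ⟨B, hB, H⟩ := hf
  exact ⟨c * B, mul_nonneg hc hB, fun n => by
    rw [mul_assoc]; exact mul_le_mul_of_nonneg_left (H n) hc⟩

theorem succ (hf : GeoBounded f) : GeoBounded fun n => f (n + 1) := by
  obtain ⟨B, hB, H⟩ := hf
  refine ⟨B, hB, fun n => (H (n + 1)).trans ?_⟩
  have : (0 : ℝ) ≤ (3 / 4) ^ n := by positivity
  rw [pow_succ]
  nlinarith

/-- Needed because the estimates bound step `n + 1` by step `n`; the factor `4 / 3` undoes one step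
of decay. -/
theorem of_succ (hf : GeoBounded fun n => f (n + 1)) : GeoBounded f := by
  obtain ⟨B, hB, H⟩ := hf
  refine ⟨|f 0| + 4 / 3 * B, by positivity, fun n => ?_⟩
  rcases n with _ | n
  · have := le_abs_self (f 0)
    simp only [pow_zero, mul_one]
    linarith
  · refine (H n).trans ?_
    have h1 : (0 : ℝ) ≤ (3 / 4) ^ n := by positivity
    have h2 : 0 ≤ |f 0| * (3 / 4) ^ n := by positivity
    rw [pow_succ]
    nlinarith

theorem zero : GeoBounded fun _ => 0 := ⟨0, le_rfl, fun n => by simp⟩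

theorem const_le_zero {c : ℝ} (h : GeoBounded fun _ => c) : c ≤ 0 := by
  obtain ⟨B, _, H⟩ := h
  have h1 : Tendsto (fun n : ℕ => B * (3 / 4 : ℝ) ^ n) atTop (𝓝 (B * 0)) :=
    (tendsto_pow_atTop_nhds_zero_of_lt_one (by norm_num) (by norm_num)).const_mul B
  rw [mul_zero] at h1
  exact ge_of_tendsto' h1 H

theorem tendsto_zero (h : GeoBounded f) (h0 : ∀ n, 0 ≤ f n) : Tendsto f atTop (𝓝 0) := by
  obtain ⟨B, _, H⟩ := h
  have h1 : Tendsto (fun n : ℕ => B * (3 / 4 : ℝ) ^ n) atTop (𝓝 (B * 0)) :=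
    (tendsto_pow_atTop_nhds_zero_of_lt_one (by norm_num) (by norm_num)).const_mul B
  rw [mul_zero] at h1
  exact squeeze_zero h0 H h1

end GeoBounded

/-- Here `m` measures the derivative, `r` the remainder and `e` the starting value. The new
derivative contains `L * r` with no small factor; the weight `M > 4 * L` makes this at most a
quarter of `M * r`. The new remainder carries `ε`, which absorbs the weight. -/
theorem weighted_contraction {L M C ε e m r : ℝ} (hL : 0 ≤ L) (hM : M = 4 * L + 1)
    (hε : L * ε + M * C * L * ε ≤ 1 / 4) (h1 : 0 ≤ L * ε) (he : 0 ≤ e) (hm : 0 ≤ m) (hr : 0 ≤ r) :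
    L * (e + (m * ε + r)) + M * (C * (L * (e + (m + r))) * ε) ≤
      1 / 2 * (m + M * r) + (L + 1) * e := by
  have k1 := mul_le_mul_of_nonneg_right hε hm
  have k2 := mul_le_mul_of_nonneg_right (show M * C * L * ε ≤ 1 / 4 by linarith) hr
  have k3 := mul_le_mul_of_nonneg_right (show M * C * L * ε ≤ 1 / 4 by linarith) he
  have k4 : M * (C * (L * (e + (m + r))) * ε) = M * C * L * ε * e + M * C * L * ε * m +
    M * C * L * ε * r := by ring
  have k5 := mul_nonneg hL hr
  have k6 : M * r = 4 * (L * r) + r := by rw [hM]; ring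
  rw [k4, k6]
  linarith

/-! ### Lipschitz estimates for the fixed point map -/

section Difference

variable {d k : ℕ} {p T : ℝ} {X : ℝ → Vec d} {XX : ℝ → ℝ → Mat d}
  {F : (ℝ → Vec k) → ℝ → Vec d →L[ℝ] Vec k}
  {F' : (ℝ → Vec k) → (ℝ → Vec d →L[ℝ] Vec k) → ℝ → Vec d →L[ℝ] Vec d →L[ℝ] Vec k}
  {y : ℝ → Vec k} {y' : ℝ → Vec d →L[ℝ] Vec k} {CF K L : ℝ}
  {Y Z Y₁ Z₁ : ℝ → Vec k} {Y' Z' Y₁' Z₁' : ℝ → Vec d →L[ℝ] Vec k}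

/-- The starting data cancel, so the difference of the images is the integral of the difference of
the integrands. As for a single image, only `[s, u]` with `u < t` enters. -/
theorem IsImage.var_remainder_sub_le (H : IsBoundedEquation p T X XX F F' y y' CF)
    (hL : LipschitzCondition p T X F F' K L) (hL0 : 0 < L)
    (hY : IsImage p T X XX F F' y y' Y Y' Y₁ Y₁') (hZ : IsImage p T X XX F F' y y' Z Z' Z₁ Z₁')
    (hYK : 2 * ctrlNorm p X Y Y' 0 T ≤ K) (hZK : 2 * ctrlNorm p X Z Z' 0 T ≤ K)
    {s t B : ℝ} (hs : 0 ≤ s) (hst : s < t) (ht : t ≤ T)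
    (hB : ∀ u ∈ Ioo s t, ‖(Y - Z) s‖ + ctrlNorm p X (Y - Z) (Y' - Z') s u ≤ B) :
    var (p / 2) (remainder X (Y₁ - Z₁) (Y₁' - Z₁')) s t ≤
      intConst p d * (L * B) * roughNorm p X XX s t := by
  have hp := H.two_lt
  have hp0 : 0 < p := by linarith
  have hp2 : 0 < p / 2 := by positivity
  have hV := (H.nonAnticipative.maps Y Y' hY.source).sub hp.le
    (H.nonAnticipative.maps Z Z' hZ.source)
  have hJ : ∀ t ∈ Icc 0 T, HasRoughIntegral X XX (F Y - F Z) (F' Y Y' - F' Z Z') 0 t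
      ((Y₁ - Z₁) t) := fun t ht => by
    have := (hY.integral_eq t ht).sub (hZ.integral_eq t ht)
    rwa [sub_sub_sub_cancel_right] at this
  refine ((varLE_integral_remainder hp H.lt_three H.rough hV hJ hs hst ht (G := L * B)
    fun u hu => ?_).of_norm_le hp2 fun a b ha hab hb => le_of_eq ?_).var_le hp2
  · have huT := hu.2.le.trans ht
    have h1 := (hL Y Y' Z Z' hY.source hZ.source s u hs hu.1 huT
      ((hY.source.ctrlNorm_le_sub hp0 hs hu.1.le huT).trans hYK)
      ((hZ.source.ctrlNorm_le_sub hp0 hs hu.1.le huT).trans hZK)).2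
    rw [ctrlDist_eq_ctrlNorm_sub, ctrlDist_eq_ctrlNorm_sub] at h1
    exact h1.trans (mul_le_mul_of_nonneg_left (hB u hu) hL0.le)
  · have ha' : a ∈ Icc 0 T := ⟨hs.trans ha, hab.trans (hb.trans ht)⟩
    simp only [remainder, Pi.sub_apply, hY.deriv_eq a ha', hZ.deriv_eq a ha',
      add_sub_add_left_eq_sub]

/-- The derivative difference is `F Y - F Z` up to cancellation. It involves the remainder over the
closed interval, but the derivative only on `[s, t)`; so at an endpoint the remainder is estimated
first and the derivative afterwards. -/
theorem IsImage.var_deriv_sub_le (H : IsBoundedEquation p T X XX F F' y y' CF)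
    (hL : LipschitzCondition p T X F F' K L) (hL0 : 0 < L)
    (hY : IsImage p T X XX F F' y y' Y Y' Y₁ Y₁') (hZ : IsImage p T X XX F F' y y' Z Z' Z₁ Z₁')
    (hYK : 2 * ctrlNorm p X Y Y' 0 T ≤ K) (hZK : 2 * ctrlNorm p X Z Z' 0 T ≤ K)
    {s t m : ℝ} (hs : 0 ≤ s) (hst : s < t) (ht : t ≤ T) (hm0 : 0 ≤ m)
    (hm : ∀ a ∈ Ico s t, ‖(Y' - Z') a‖ ≤ m) :
    var p (incr (Y₁' - Z₁')) s t ≤ L * (‖(Y - Z) s‖ + (m * var p (incr X) s t +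
      var (p / 2) (remainder X (Y - Z) (Y' - Z')) s t)) := by
  have hp := H.two_lt
  have hp0 : 0 < p := by linarith
  have hp2 : 0 < p / 2 := by positivity
  have hV := (H.nonAnticipative.maps Y Y' hY.source).sub hp.le
    (H.nonAnticipative.maps Z Z' hZ.source)
  have hD := hY.source.sub hp.le hZ.source
  have h1 := (hL Y Y' Z Z' hY.source hZ.source s t hs hst ht
      ((hY.source.ctrlNorm_le_sub hp0 hs hst.le ht).trans hYK)
      ((hZ.source.ctrlNorm_le_sub hp0 hs hst.le ht).trans hZK)).1
  have h2 : var p (incr (Y - Z)) s t ≤ _ :=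
    (varLE_incr_of_remainder (Y := Y - Z) (Y' := Y' - Z') (by linarith)
      ((H.rough.path.finVar.mono hp0 hs ht).varLE hp0)
      ((hD.finVar_remainder.mono hp2 hs ht).varLE hp2) hm0 hm).var_le hp0
  have h3 : var p (incr (Y₁' - Z₁')) s t ≤ var p (incr (F Y - F Z)) s t := by
    refine (((hV.path.finVar.mono hp0 hs ht).varLE hp0).of_norm_le hp0
      fun a b ha hab hb => le_of_eq ?_).var_le hp0
    have ha' : a ∈ Icc 0 T := ⟨hs.trans ha, hab.trans (hb.trans ht)⟩
    have hb' : b ∈ Icc 0 T := ⟨hs.trans (ha.trans hab), hb.trans ht⟩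
    simp only [incr, Pi.sub_apply, hY.deriv_eq a ha', hZ.deriv_eq a ha', hY.deriv_eq b hb',
      hZ.deriv_eq b hb', add_sub_add_left_eq_sub]
  exact h3.trans (h1.trans (mul_le_mul_of_nonneg_left (add_le_add le_rfl h2) hL0.le))

theorem IsControlled.norm_le_start (hp : 2 ≤ p) (hX : IsRoughPath p T X XX)
    (h : IsControlled p T X Y Y') {s u : ℝ} (hs : 0 ≤ s) (hsu : s ≤ u) (hu : u ≤ T) :
    ‖Y u‖ ≤ ‖Y s‖ + (1 + roughNorm p X XX 0 T) * ctrlNorm p X Y Y' s u := by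
  have hp0 : 0 < p := by linarith
  have hp2 : 0 < p / 2 := by positivity
  have e : Y u = Y s + incr Y s u := by simp [incr]
  have h1 := norm_incr_le_remainder X Y Y' s u
  have h2 := hX.path.finVar.norm_le hp0 hs hsu hu
  have h3 := (h.finVar_remainder.mono hp2 hs hu).norm_le hp2 le_rfl hsu le_rfl
  have h4 := var_nonneg (p / 2) XX 0 T
  have h5 := var_nonneg p (incr X) 0 T
  have h6 := var_nonneg p (incr Y') s u
  have h7 := norm_nonneg (Y' s)
  have h8 := var_nonneg (p / 2) (RoughFDE.remainder X Y Y') s u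
  have h9 : ‖Y' s‖ * ‖incr X s u‖ ≤ ‖Y' s‖ * var p (incr X) 0 T := by gcongr
  have h10 : ‖Y u‖ ≤ ‖Y s‖ + ‖incr Y s u‖ := by rw [e]; exact norm_add_le _ _
  unfold roughNorm ctrlNorm
  nlinarith [mul_nonneg h5 h6, mul_nonneg h5 h8, mul_nonneg h4 h6, mul_nonneg h4 h8,
    mul_nonneg h4 h7]

/-- On short intervals the differences of two sequences of iterates contract. -/
theorem norm_sub_le_of_small (H : IsBoundedEquation p T X XX F F' y y' CF)
    (hL : LipschitzCondition p T X F F' K L) (hL0 : 0 < L)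
    {Y Z : ℕ → ℝ → Vec k} {Y' Z' : ℕ → ℝ → Vec d →L[ℝ] Vec k}
    (hY : ∀ n, IsImage p T X XX F F' y y' (Y n) (Y' n) (Y (n + 1)) (Y' (n + 1)))
    (hZ : ∀ n, IsImage p T X XX F F' y y' (Z n) (Z' n) (Z (n + 1)) (Z' (n + 1)))
    (hYK : ∀ n, 2 * ctrlNorm p X (Y n) (Y' n) 0 T ≤ K)
    (hZK : ∀ n, 2 * ctrlNorm p X (Z n) (Z' n) 0 T ≤ K)
    {M ε Be Bf A₀ : ℝ} (hM : M = 4 * L + 1) (hε0 : 0 < ε)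
    (hε : L * ε + M * intConst p d * L * ε ≤ 1 / 4) (hBe : 0 ≤ Be) (hBf : 0 ≤ Bf) {s u : ℝ}
    (hs : 0 ≤ s) (hsu : s < u) (huT : u ≤ T) (hru : roughNorm p X XX s u ≤ ε)
    (He : ∀ n, ‖(Y n - Z n) s‖ ≤ Be * (3 / 4) ^ n)
    (Hf : ∀ n, ‖(Y' n - Z' n) s‖ ≤ Bf * (3 / 4) ^ n)
    (hA₀ : ‖(Y' 0 - Z' 0) s‖ + var p (incr (Y' 0 - Z' 0)) s u +
      M * var (p / 2) (remainder X (Y 0 - Z 0) (Y' 0 - Z' 0)) s u ≤ A₀) (n : ℕ) :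
    ‖(Y' n - Z' n) s‖ + var p (incr (Y' n - Z' n)) s u +
      M * var (p / 2) (remainder X (Y n - Z n) (Y' n - Z' n)) s u ≤
        (A₀ + 4 * (Bf + (L + 1) * Be)) * (3 / 4) ^ n := by
  have hp := H.two_lt
  have hp0 : 0 < p := by linarith
  have hC := intConst_nonneg p d
  have hM0 : 0 < M := by rw [hM]; positivity
  have hA₀0 : 0 ≤ A₀ := le_trans (add_nonneg (add_nonneg (norm_nonneg _) (var_nonneg _ _ _ _))
    (mul_nonneg hM0.le (var_nonneg _ _ _ _))) hA₀
  have hD : ∀ n, IsControlled p T X (Y n - Z n) (Y' n - Z' n) := fun n =>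
    (hY n).source.sub hp.le (hZ n).source
  have hxu : var p (incr X) s u ≤ ε :=
    (le_add_of_nonneg_right (var_nonneg (p / 2) XX s u)).trans hru
  induction n with
  | zero =>
    have : 0 ≤ 4 * (Bf + (L + 1) * Be) := by positivity
    simp only [pow_zero, mul_one]
    linarith
  | succ n ih =>
    have h2 := norm_nonneg ((Y' n - Z' n) s)
    have h3 := var_nonneg p (incr (Y' n - Z' n)) s u
    have h4 := var_nonneg (p / 2) (remainder X (Y n - Z n) (Y' n - Z' n)) s u
    have h5 := norm_nonneg ((Y n - Z n) s)
    have r1 := (hY n).var_remainder_sub_le H hL hL0 (hZ n) (hYK n) (hZK n) hs hsu huT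
      (B := ‖(Y n - Z n) s‖ + ctrlNorm p X (Y n - Z n) (Y' n - Z' n) s u) fun v hv => by
        have := (hD n).ctrlNorm_mono hp0 hs hv.2.le huT
        linarith
    have m1 := (hY n).var_deriv_sub_le H hL hL0 (hZ n) (hYK n) (hZK n) hs hsu huT
      (m := ‖(Y' n - Z' n) s‖ + var p (incr (Y' n - Z' n)) s u) (by positivity)
      fun a ha => (((hD n).deriv.finVar.mono hp0 hs huT).varLE hp0).norm_incr_le hp0
        (Ico_subset_Icc_self ha)
    have e1 := He n
    have f1 := Hf (n + 1)
    unfold ctrlNorm at r1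
    generalize ‖(Y n - Z n) s‖ = e at *
    generalize var (p / 2) (remainder X (Y n - Z n) (Y' n - Z' n)) s u = r at *
    have hm0 := add_nonneg h2 h3
    generalize ‖(Y' n - Z' n) s‖ + var p (incr (Y' n - Z' n)) s u = m at *
    have r3 : M * var (p / 2) (remainder X (Y (n + 1) - Z (n + 1)) (Y' (n + 1) - Z' (n + 1))) s u ≤
        M * (intConst p d * (L * (e + (m + r))) * ε) := by
      refine mul_le_mul_of_nonneg_left (r1.trans ?_) hM0.le
      gcongr
    have m3 : var p (incr (Y' (n + 1) - Z' (n + 1))) s u ≤ L * (e + (m * ε + r)) := by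
      refine m1.trans ?_
      gcongr
    have w := weighted_contraction hL0.le hM hε (by positivity) h5 hm0 h4
    have q : (0 : ℝ) ≤ (3 / 4) ^ n := by positivity
    have f2 : Bf * (3 / 4) ^ (n + 1) ≤ Bf * (3 / 4) ^ n := by
      rw [pow_succ]; nlinarith [mul_nonneg hBf q]
    have c3 : (L + 1) * e ≤ (L + 1) * (Be * (3 / 4) ^ n) := by gcongr
    -- The contraction factor is `1 / 2` and the inhomogeneity decays like `(3 / 4) ^ n`; a constant
    -- at least four times the inhomogeneity closes the induction, as `1 / 2 + 1 / 4 = 3 / 4`.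
    have c6 : (A₀ + 4 * (Bf + (L + 1) * Be)) * (3 / 4) ^ (n + 1) =
        1 / 2 * ((A₀ + 4 * (Bf + (L + 1) * Be)) * (3 / 4) ^ n) +
          (1 / 4 * A₀ * (3 / 4) ^ n + Bf * (3 / 4) ^ n + (L + 1) * (Be * (3 / 4) ^ n)) := by
      rw [pow_succ]; ring
    have c7 : 0 ≤ 1 / 4 * A₀ * (3 / 4) ^ n := by positivity
    rw [c6]
    linarith

/-- Two sequences of iterates of the fixed point map that start from the same values converge to
each other geometrically. -/
theorem geoBounded_ctrlNorm_sub (H : IsBoundedEquation p T X XX F F' y y' CF)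
    (hL : LipschitzCondition p T X F F' K L) (hL0 : 0 < L)
    {Y Z : ℕ → ℝ → Vec k} {Y' Z' : ℕ → ℝ → Vec d →L[ℝ] Vec k}
    (hY : ∀ n, IsImage p T X XX F F' y y' (Y n) (Y' n) (Y (n + 1)) (Y' (n + 1)))
    (hZ : ∀ n, IsImage p T X XX F F' y y' (Z n) (Z' n) (Z (n + 1)) (Z' (n + 1)))
    (hYK : ∀ n, 2 * ctrlNorm p X (Y n) (Y' n) 0 T ≤ K)
    (hZK : ∀ n, 2 * ctrlNorm p X (Z n) (Z' n) 0 T ≤ K)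
    (h0 : GeoBounded fun n => ‖(Y n - Z n) 0‖) (h0' : GeoBounded fun n => ‖(Y' n - Z' n) 0‖) :
    GeoBounded fun n => ctrlNorm p X (Y n - Z n) (Y' n - Z' n) 0 T := by
  have hp := H.two_lt
  have hp0 : 0 < p := by linarith
  have hp2 : 0 < p / 2 := by positivity
  have hC := intConst_nonneg p d
  have hD : ∀ n, IsControlled p T X (Y n - Z n) (Y' n - Z' n) := fun n =>
    (hY n).source.sub hp.le (hZ n).source
  obtain ⟨c, hc⟩ : ∃ c, c = roughNorm p X XX 0 T := ⟨_, rfl⟩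
  have hc0 : 0 ≤ c := hc ▸ roughNorm_nonneg _ _ _ _ _
  set M := 4 * L + 1 with hM
  have hM0 : 0 < M := by positivity
  set ε := 1 / (4 * L * (1 + M * intConst p d) + 1) with hε
  have hden : 0 < 4 * L * (1 + M * intConst p d) + 1 := by positivity
  have hε0 : 0 < ε := by positivity
  have hε1 : ε ≤ 1 := by
    rw [hε, div_le_one hden]
    have : 0 ≤ 4 * L * (1 + M * intConst p d) := by positivity
    linarith
  have hεL : L * ε + M * intConst p d * L * ε ≤ 1 / 4 := by
    have : L * ε + M * intConst p d * L * ε = L * (1 + M * intConst p d) /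
        (4 * L * (1 + M * intConst p d) + 1) := by rw [hε]; ring
    rw [this, div_le_div_iff₀ hden (by norm_num)]
    linarith
  have hrn : ∀ s t, 0 ≤ s → t ≤ T → roughNorm p X XX s t ≤ c := fun s t hs ht => by
    rw [hc]; exact H.rough.roughNorm_mono hp0 le_rfl le_rfl hs ht
  have hxr : ∀ s t, var p (incr X) s t ≤ roughNorm p X XX s t := fun s t =>
    le_add_of_nonneg_right (var_nonneg _ _ _ _)
  obtain ⟨n, hn⟩ := exists_nat_ge (roughControl p X XX 0 T / (ε / 2) ^ p)
  have hθ : 0 < (ε / 2) ^ p := by positivity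
  refine control_induction (ω := roughControl p X XX) (T := T) (θ := (ε / 2) ^ p)
    hθ (roughControl_nonneg p X XX)
    (fun s u t hs hsu hut ht => H.rough.roughControl_superadditive hp0 hs hsu hut ht)
    (fun u t hu hut ht η hη => H.rough.roughControl_lsc hp0 hu hut ht hη)
    (Q := fun _ s t => (GeoBounded fun n => ‖(Y n - Z n) s‖) →
      (GeoBounded fun n => ‖(Y' n - Z' n) s‖) →
      GeoBounded fun n => ctrlNorm p X (Y n - Z n) (Y' n - Z' n) s t)
    ?_ ?_ (fun _ _ _ h => h) n 0 T le_rfl H.pos le_rfl ((div_le_iff₀ hθ).1 hn) h0 h0'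
  · intro s t hs hst ht hω he hf
    obtain ⟨Be, hBe, He⟩ := id he
    obtain ⟨Bf, hBf, Hf⟩ := id hf
    set A₀ := (1 + M) * ctrlNorm p X (Y 0 - Z 0) (Y' 0 - Z' 0) s T with hA₀
    have hN0 := ctrlNorm_nonneg p X (Y 0 - Z 0) (Y' 0 - Z' 0) s T
    set B₁ := A₀ + 4 * (Bf + (L + 1) * Be) with hB₁
    have hB₁0 : 0 ≤ B₁ := by positivity
    -- The contraction on `[s, u]` is uniform in `u < t`, because its starting constant `A₀` is
    -- taken over all of `[s, T]`.
    have key : ∀ n, ∀ u ∈ Ioo s t,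
        ‖(Y' n - Z' n) s‖ + var p (incr (Y' n - Z' n)) s u +
          M * var (p / 2) (remainder X (Y n - Z n) (Y' n - Z' n)) s u ≤ B₁ * (3 / 4) ^ n := by
      intro n u hu
      have huT := hu.2.le.trans ht
      refine norm_sub_le_of_small H hL hL0 hY hZ hYK hZK hM hε0 hεL hBe hBf hs hu.1 huT
        (roughNorm_le_of_roughControl_le hp0 hε0 hε1 (hω u hu)) He Hf ?_ n
      have h1 := (hD 0).ctrlNorm_mono hp0 hs huT le_rfl
      have h2 := norm_nonneg ((Y' 0 - Z' 0) s)
      have h3 := var_nonneg p (incr (Y' 0 - Z' 0)) s u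
      have h4 := var_nonneg (p / 2) (remainder X (Y 0 - Z 0) (Y' 0 - Z' 0)) s u
      rw [hA₀]
      refine le_trans ?_ (mul_le_mul_of_nonneg_left h1 (by positivity))
      unfold ctrlNorm
      nlinarith [mul_nonneg hM0.le h2, mul_nonneg hM0.le h3]
    have hMM : 1 ≤ M := by rw [hM]; linarith
    have hN : ∀ n, ∀ u ∈ Ioo s t, ctrlNorm p X (Y n - Z n) (Y' n - Z' n) s u ≤
        B₁ * (3 / 4) ^ n := fun n u hu => by
      refine le_trans ?_ (key n u hu)
      have h4 := var_nonneg (p / 2) (remainder X (Y n - Z n) (Y' n - Z' n)) s u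
      unfold ctrlNorm
      nlinarith
    have hG₁ : GeoBounded fun n => B₁ * (3 / 4) ^ n := ⟨B₁, hB₁0, fun n => le_rfl⟩
    -- The endpoint `t` is included by one application of the map. Its constant is not small, which
    -- does not affect geometric decay.
    have hR : GeoBounded fun n =>
        var (p / 2) (remainder X (Y n - Z n) (Y' n - Z' n)) s t := by
      refine .of_succ (((he.add hG₁).const_mul (c := intConst p d * L * c)
        (by positivity)).mono fun n => ?_)
      have h1 := (hY n).var_remainder_sub_le H hL hL0 (hZ n) (hYK n) (hZK n) hs hst ht
        (B := ‖(Y n - Z n) s‖ + B₁ * (3 / 4) ^ n) fun u hu => by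
          have := hN n u hu; linarith
      refine h1.trans ?_
      have h2 := hrn s t hs ht
      calc _ ≤ intConst p d * (L * (‖(Y n - Z n) s‖ + B₁ * (3 / 4) ^ n)) * c := by gcongr
        _ = _ := by ring
    have hV : GeoBounded fun n => var p (incr (Y' n - Z' n)) s t := by
      refine .of_succ (((he.add ((hG₁.const_mul hc0).add hR)).const_mul hL0.le).mono fun n => ?_)
      have h1 := (hY n).var_deriv_sub_le H hL hL0 (hZ n) (hYK n) (hZK n) hs hst ht
        (m := B₁ * (3 / 4) ^ n) (by positivity) fun a ha => by
          have hu : max a ((s + t) / 2) ∈ Ioo s t :=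
            ⟨lt_max_of_lt_right (by linarith), max_lt ha.2 (by linarith)⟩
          exact ((hD n).ctrlNorm_bounds hp0 hs (hu.2.le.trans ht) (hN n _ hu)).1 a
            ⟨ha.1, le_max_left _ _⟩
      refine h1.trans ?_
      have h2 := (hxr s t).trans (hrn s t hs ht)
      have : B₁ * (3 / 4) ^ n * var p (incr X) s t ≤ c * (B₁ * (3 / 4) ^ n) := by
        rw [mul_comm]; gcongr
      gcongr
    exact (hf.add hV).add hR
  · intro m s u t hs hsu hut ht h1 h2 he hf
    have g1 := h1 he hf
    -- Decay on `[s, u]` yields decay of the values at `u`, the starting data of the next interval.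
    have g2 := h2 ((he.add (g1.const_mul (c := 1 + c) (by positivity))).mono fun n => by
        rw [hc]
        exact (hD n).norm_le_start hp.le H.rough hs hsu.le (hut.le.trans ht))
      (g1.mono fun n => ((hD n).ctrlNorm_bounds hp0 hs (hut.le.trans ht) le_rfl).1 u
        ⟨hsu.le, le_rfl⟩)
    refine ((g1.add g2).const_mul (c := 1 + var p (incr X) 0 T)
      (by have := var_nonneg p (incr X) 0 T; positivity)).mono fun n => ?_
    exact (hD n).ctrlNorm_glue hp.le H.rough.path hs hsu.le hut.le ht

end Difference

end RoughFDE

namespace RoughFDE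

/-! ### Limits of geometrically convergent sequences -/

section Limits

variable {E : Type*} [NormedAddCommGroup E]

/-- Telescoping bounds `A n - A (n + j)` uniformly in `j`, with `4 = 1 / (1 - 3 / 4)`, and lower
semicontinuity of the variation passes to the limit. -/
theorem varLE_sub_of_geometric {q s t B : ℝ} (hq : 1 ≤ q) {A : ℕ → ℝ → ℝ → E} {A₁ : ℝ → ℝ → E}
    (hB : 0 ≤ B) (h : ∀ n, VarLE q (A n - A (n + 1)) s t (B * (3 / 4) ^ n))
    (hA : ∀ a b, s ≤ a → a ≤ b → b ≤ t → Tendsto (fun n => A n a b) atTop (𝓝 (A₁ a b))) (n : ℕ) :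
    VarLE q (A n - A₁) s t (4 * B * (3 / 4) ^ n) := by
  have hq0 : 0 < q := by linarith
  have step : ∀ j, VarLE q (A n - A (n + j)) s t (4 * B * ((3 / 4) ^ n - (3 / 4) ^ (n + j))) := by
    intro j
    induction j with
    | zero =>
      rw [add_zero, sub_self, sub_self, mul_zero]
      exact ⟨le_rfl, fun a m _ => by simp [Real.zero_rpow hq0.ne']⟩
    | succ j ih =>
      have h1 := ih.add hq (h (n + j))
      rw [sub_add_sub_cancel] at h1
      have e : 4 * B * ((3 / 4) ^ n - (3 / 4) ^ (n + j)) + B * (3 / 4) ^ (n + j) =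
          4 * B * ((3 / 4) ^ n - (3 / 4) ^ (n + (j + 1))) := by
        rw [← add_assoc, pow_succ]; ring
      rw [e] at h1
      exact h1
  refine VarLE.of_tendsto (l := atTop) (A := fun j => A n - A (n + j)) hq0
    (Eventually.of_forall fun j => (step j).le hq0 ?_) fun a b ha hab hb => ?_
  · have : (0 : ℝ) ≤ (3 / 4) ^ (n + j) := by positivity
    have : (3 / 4 : ℝ) ^ n - (3 / 4) ^ (n + j) ≤ (3 / 4) ^ n := by linarith
    gcongr
  · have h1 := (tendsto_add_atTop_iff_nat n).2 (hA a b ha hab hb)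
    have h2 : Tendsto (fun j => A (n + j) a b) atTop (𝓝 (A₁ a b)) :=
      h1.congr fun j => by rw [add_comm]
    exact tendsto_const_nhds.sub h2

theorem continuousWithinAt_of_geometric {T D t : ℝ} {f : ℕ → ℝ → E} {g : ℝ → E}
    (hf : ∀ n, ContinuousWithinAt (f n) (Ioi t) t)
    (h : ∀ n, ∀ u ∈ Icc 0 T, ‖f n u - g u‖ ≤ D * (3 / 4) ^ n) (ht : t ∈ Ico 0 T) :
    ContinuousWithinAt g (Ioi t) t := by
  rw [ContinuousWithinAt, Metric.tendsto_nhds]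
  intro ε hε
  have h1 : Tendsto (fun n : ℕ => D * (3 / 4 : ℝ) ^ n) atTop (𝓝 (D * 0)) :=
    (tendsto_pow_atTop_nhds_zero_of_lt_one (by norm_num) (by norm_num)).const_mul D
  rw [mul_zero] at h1
  have hε3 : 0 < ε / 3 := by positivity
  obtain ⟨n, hn⟩ := (h1.eventually (gt_mem_nhds hε3)).exists
  filter_upwards [Metric.tendsto_nhds.1 (hf n) _ hε3, Ioo_mem_nhdsGT ht.2] with u hu hut
  have k1 := h n u ⟨ht.1.trans hut.1.le, hut.2.le⟩
  have k2 := h n t (Ico_subset_Icc_self ht)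
  rw [← dist_eq_norm] at k1 k2
  rw [dist_comm] at k1
  have k3 := dist_triangle4 (g u) (f n u) (f n t) (g t)
  linarith

theorem exists_limit_of_geometric [CompleteSpace E] {T D : ℝ} {f : ℕ → ℝ → E}
    (h : ∀ n, ∀ u ∈ Icc 0 T, ‖f n u - f (n + 1) u‖ ≤ D * (3 / 4) ^ n) :
    ∃ g : ℝ → E, ∀ u ∈ Icc 0 T, Tendsto (fun n => f n u) atTop (𝓝 (g u)) ∧
      ∀ n, ‖f n u - g u‖ ≤ 4 * D * (3 / 4) ^ n := by
  have hex : ∀ u, ∃ l : E, u ∈ Icc 0 T → Tendsto (fun n => f n u) atTop (𝓝 l) := by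
    intro u
    by_cases hu : u ∈ Icc 0 T
    · have hc : CauchySeq fun n => f n u :=
        cauchySeq_of_le_geometric (3 / 4) D (by norm_num) fun n => by
          rw [dist_eq_norm]; exact h n u hu
      obtain ⟨l, hl⟩ := cauchySeq_tendsto_of_complete hc
      exact ⟨l, fun _ => hl⟩
    · exact ⟨0, fun hu' => absurd hu' hu⟩
  choose g hg using hex
  refine ⟨g, fun u hu => ⟨hg u hu, fun n => ?_⟩⟩
  have := dist_le_of_le_geometric_of_tendsto (3 / 4) D (by norm_num)
    (fun n => by rw [dist_eq_norm]; exact h n u hu) (hg u hu) n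
  rw [dist_eq_norm] at this
  refine this.trans (le_of_eq ?_)
  ring

end Limits

/-! ### Existence and uniqueness of the solution -/

section Solution

variable {d k : ℕ} {p T : ℝ} {X : ℝ → Vec d} {XX : ℝ → ℝ → Mat d}
  {F : (ℝ → Vec k) → ℝ → Vec d →L[ℝ] Vec k}
  {F' : (ℝ → Vec k) → (ℝ → Vec d →L[ℝ] Vec k) → ℝ → Vec d →L[ℝ] Vec d →L[ℝ] Vec k}
  {y : ℝ → Vec k} {y' : ℝ → Vec d →L[ℝ] Vec k} {CF : ℝ}

/-- Completeness of the space of controlled paths. -/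
theorem exists_controlled_limit (hp : 2 ≤ p) (hT : 0 ≤ T) (hX : IsRoughPath p T X XX)
    {W : ℕ → ℝ → Vec k} {W' : ℕ → ℝ → Vec d →L[ℝ] Vec k}
    (hW : ∀ n, IsControlled p T X (W n) (W' n)) (h0 : ∀ n, W n 0 = W (n + 1) 0)
    (hg : GeoBounded fun n => ctrlNorm p X (W n - W (n + 1)) (W' n - W' (n + 1)) 0 T) :
    ∃ (Y : ℝ → Vec k) (Y' : ℝ → Vec d →L[ℝ] Vec k), IsControlled p T X Y Y' ∧
      (GeoBounded fun n => ctrlNorm p X (W n - Y) (W' n - Y') 0 T) ∧ ∀ n, W n 0 = Y 0 := by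
  have hp0 : 0 < p := by linarith
  have hp2 : 0 < p / 2 := by positivity
  obtain ⟨B, hB, HB⟩ := hg
  have hD : ∀ n, IsControlled p T X (W n - W (n + 1)) (W' n - W' (n + 1)) := fun n =>
    (hW n).sub hp (hW (n + 1))
  have hb := fun n => (hD n).ctrlNorm_bounds hp0 le_rfl le_rfl (HB n)
  have hc := roughNorm_nonneg p X XX 0 T
  obtain ⟨Y, hY⟩ := exists_limit_of_geometric (f := W) (T := T)
    (D := (1 + roughNorm p X XX 0 T) * B) fun n u hu => by
      have h1 := (hD n).norm_le_start hp hX le_rfl hu.1 hu.2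
      have h2 := ((hD n).ctrlNorm_mono hp0 le_rfl hu.2 le_rfl).trans (HB n)
      have h3 : (W n - W (n + 1)) 0 = 0 := sub_eq_zero.2 (h0 n)
      rw [h3, norm_zero, zero_add] at h1
      refine h1.trans ?_
      rw [mul_assoc]
      gcongr
  obtain ⟨Y', hY'⟩ := exists_limit_of_geometric (f := W') (T := T) (D := B) fun n u hu =>
    (hb n).1 u hu
  have v1 : ∀ n, VarLE p (incr (W' n - Y')) 0 T (4 * B * (3 / 4) ^ n) := fun n => by
    rw [incr_sub]
    refine varLE_sub_of_geometric (A := fun n => incr (W' n)) (by linarith) hB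
      (fun n => ?_) (fun a b ha hab hb => ?_) n
    · have := (hb n).2.1
      rwa [incr_sub] at this
    · exact (hY' b ⟨ha.trans hab, hb⟩).1.sub (hY' a ⟨ha, hab.trans hb⟩).1
  have v2 : ∀ n, VarLE (p / 2) (remainder X (W n - Y) (W' n - Y')) 0 T
      (4 * B * (3 / 4) ^ n) := fun n => by
    rw [remainder_sub]
    refine varLE_sub_of_geometric (A := fun n => remainder X (W n) (W' n)) (by linarith) hB
      (fun n => ?_) (fun a b ha hab hb => ?_) n
    · have := (hb n).2.2
      rwa [remainder_sub] at this
    · have ha' : a ∈ Icc 0 T := ⟨ha, hab.trans hb⟩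
      exact ((hY b ⟨ha.trans hab, hb⟩).1.sub (hY a ha').1).sub
        ((isBoundedBilinearMap_apply (𝕜 := ℝ) (E := Vec d) (F := Vec k)).continuous.continuousAt
          |>.tendsto.comp ((hY' a ha').1.prodMk_nhds tendsto_const_nhds))
  have hYv : FinVar p (incr Y') 0 T := by
    have := ((hW 0).deriv.finVar.varLE hp0).sub (by linarith) (v1 0)
    rw [← incr_sub, sub_sub_cancel] at this
    exact this.finVar hp0 fun u _ => incr_self _ _
  have hYr := ((hW 0).finVar_remainder.varLE hp2).sub (by linarith) (v2 0)
  rw [← remainder_sub, sub_sub_cancel, sub_sub_cancel] at hYr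
  refine ⟨Y, Y', isControlled_of_varLE hp hX.path (memD_of_finVar hp0 hYv fun t ht =>
    continuousWithinAt_of_geometric (fun n => (hW n).deriv.cadlag.1 t ht)
      (fun n u hu => (hY' u hu).2 n) ht) (fun t ht =>
    continuousWithinAt_of_geometric (fun n => (hW n).path.cadlag.1 t ht)
      (fun n u hu => (hY u hu).2 n) ht) hYr, ⟨12 * B, by positivity, fun n => ?_⟩, fun n => ?_⟩
  · have k1 := (hY' 0 ⟨le_rfl, hT⟩).2 n
    have k2 := (v1 n).var_le hp0
    have k3 := (v2 n).var_le hp2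
    dsimp only [ctrlNorm, Pi.sub_apply]
    linarith
  · refine tendsto_nhds_unique (tendsto_const_nhds.congr fun m => ?_) (hY 0 ⟨le_rfl, hT⟩).1
    have : ∀ m, W m 0 = W 0 0 := fun m => by
      induction m with
      | zero => rfl
      | succ m ih => rw [← h0 m, ih]
    rw [this n, this m]

theorem ctrlNorm_le_add (hp : 2 ≤ p) {Y Z : ℝ → Vec k}
    {Y' Z' : ℝ → Vec d →L[ℝ] Vec k}
    (hD : IsControlled p T X (Z - Y) (Z' - Y')) (hZ : IsControlled p T X Z Z') :
    ctrlNorm p X Y Y' 0 T ≤ ctrlNorm p X Z Z' 0 T + ctrlNorm p X (Z - Y) (Z' - Y') 0 T := by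
  have hp0 : 0 < p := by linarith
  have hp2 : 0 < p / 2 := by positivity
  have h1 := (hZ.deriv.finVar.varLE hp0).sub (by linarith) (hD.deriv.finVar.varLE hp0)
  have h2 := (hZ.finVar_remainder.varLE hp2).sub (by linarith) (hD.finVar_remainder.varLE hp2)
  rw [← incr_sub, sub_sub_cancel] at h1
  rw [← remainder_sub, sub_sub_cancel, sub_sub_cancel] at h2
  have h3 := h1.var_le hp0
  have h4 := h2.var_le hp2
  have h5 : ‖Y' 0‖ ≤ ‖Z' 0‖ + ‖(Z' - Y') 0‖ := by
    have e : Y' 0 = Z' 0 - (Z' - Y') 0 := by simp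
    conv_lhs => rw [e]
    exact norm_sub_le _ _
  unfold ctrlNorm
  linarith

theorem IsImage.start_eq {Y Z : ℝ → Vec k} {Y' Z' : ℝ → Vec d →L[ℝ] Vec k}
    (hT : 0 ≤ T) (h : IsImage p T X XX F F' y y' Y Y' Z Z') : Z 0 = y 0 :=
  sub_eq_zero.1 ((h.integral_eq 0 ⟨le_rfl, hT⟩).unique le_rfl (hasRoughIntegral_zero _ _ _ _))

/-- By non-anticipativity `F` at time zero sees the starting value only. This is what makes the
derivatives of iterates agree at zero. -/
theorem IsImage.deriv_start_eq {Y Z Y₁ Z₁ : ℝ → Vec k} {Y' Z' Y₁' Z₁' : ℝ → Vec d →L[ℝ] Vec k}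
    (hT : 0 ≤ T) (hF : IsNonAnticipative p T X F F')
    (hY : IsImage p T X XX F F' y y' Y Y' Y₁ Y₁') (hZ : IsImage p T X XX F F' y y' Z Z' Z₁ Z₁')
    (h : Y 0 = Z 0) : Y₁' 0 = Z₁' 0 := by
  rw [hY.deriv_eq 0 ⟨le_rfl, hT⟩, hZ.deriv_eq 0 ⟨le_rfl, hT⟩,
    hF.fst Y Y' Z Z' hY.source hZ.source 0 ⟨le_rfl, hT⟩ fun u hu => ?_]
  obtain rfl := le_antisymm hu.2 hu.1
  exact h

theorem IsControlled.eqOn_of_ctrlNorm_sub (hp : 2 ≤ p) (hX : IsRoughPath p T X XX)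
    {Y Z : ℝ → Vec k} {Y' Z' : ℝ → Vec d →L[ℝ] Vec k}
    (hD : IsControlled p T X (Y - Z) (Y' - Z')) (h0 : Y 0 = Z 0)
    (h : ctrlNorm p X (Y - Z) (Y' - Z') 0 T ≤ 0) :
    EqOn Y Z (Icc 0 T) ∧ EqOn Y' Z' (Icc 0 T) := by
  have hp0 : 0 < p := by linarith
  refine ⟨fun u hu => ?_, fun u hu => ?_⟩
  · have h1 := hD.norm_le_start hp hX le_rfl hu.1 hu.2
    have h2 := (hD.ctrlNorm_mono hp0 le_rfl hu.2 le_rfl).trans h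
    have h3 : (Y - Z) 0 = 0 := sub_eq_zero.2 h0
    have h4 := roughNorm_nonneg p X XX 0 T
    rw [h3, norm_zero, zero_add] at h1
    exact sub_eq_zero.1 (norm_le_zero_iff.1 (h1.trans
      (mul_nonpos_of_nonneg_of_nonpos (by positivity) h2)))
  · exact sub_eq_zero.1 (norm_le_zero_iff.1
      ((hD.ctrlNorm_bounds hp0 le_rfl le_rfl h).1 u hu))

/-- A solution is its own image, so two constant sequences of solutions are sequences of iterates. A
constant that decays geometrically is not positive. -/
theorem IsSolution.unique (H : IsBoundedEquation p T X XX F F' y y' CF)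
    (hL : ∀ K : ℝ, 0 < K → ∃ L : ℝ, 0 < L ∧ LipschitzCondition p T X F F' K L)
    {Y Z : ℝ → Vec k} {Y' Z' : ℝ → Vec d →L[ℝ] Vec k}
    (hY : IsSolution p T X F F' XX y y' Y Y') (hZ : IsSolution p T X F F' XX y y' Z Z') :
    EqOn Y Z (Icc 0 T) ∧ EqOn Y' Z' (Icc 0 T) := by
  have n1 := ctrlNorm_nonneg p X Y Y' 0 T
  have n2 := ctrlNorm_nonneg p X Z Z' 0 T
  obtain ⟨L, hL0, hL⟩ := hL (2 * (ctrlNorm p X Y Y' 0 T + ctrlNorm p X Z Z' 0 T + 1))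
    (by positivity)
  have e0 : Y 0 = Z 0 := (hY.isImage.start_eq H.pos.le).trans (hZ.isImage.start_eq H.pos.le).symm
  have e1 := hY.isImage.deriv_start_eq H.pos.le H.nonAnticipative hZ.isImage e0
  have hgeo := geoBounded_ctrlNorm_sub H hL hL0 (Y := fun _ => Y) (Z := fun _ => Z)
    (Y' := fun _ => Y') (Z' := fun _ => Z') (fun _ => hY.isImage) (fun _ => hZ.isImage)
    (fun _ => by linarith) (fun _ => by linarith)
    (GeoBounded.zero.mono fun _ => by simp [e0]) (GeoBounded.zero.mono fun _ => by simp [e1])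
  exact (hY.controlled.sub H.two_lt.le hZ.controlled).eqOn_of_ctrlNorm_sub H.two_lt.le H.rough e0
    hgeo.const_le_zero

theorem IsBoundedEquation.exists_solution (H : IsBoundedEquation p T X XX F F' y y' CF)
    (hL : ∀ K : ℝ, 0 < K → ∃ L : ℝ, 0 < L ∧ LipschitzCondition p T X F F' K L) :
    ∃ (Y : ℝ → Vec k) (Y' : ℝ → Vec d →L[ℝ] Vec k), IsSolution p T X F F' XX y y' Y Y' ∧
      ctrlNorm p X Y Y' 0 T ≤
        globalBound p d (ctrlNorm p X y y' 0 T) CF (roughNorm p X XX 0 T) := by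
  have hp := H.two_lt
  have hp0 : 0 < p := by linarith
  have hp2 : 0 < p / 2 := by positivity
  have hT := H.pos.le
  obtain ⟨S, S', hS⟩ := H.exists_picard
  set K₀ := globalBound p d (ctrlNorm p X y y' 0 T) CF (roughNorm p X XX 0 T) with hK₀
  have hK₀0 : 0 ≤ K₀ := globalBound_nonneg (ctrlNorm_nonneg _ _ _ _ _ _) H.const_pos.le
    (roughNorm_nonneg _ _ _ _ _)
  have hSK : ∀ n, ctrlNorm p X (S n) (S' n) 0 T ≤ K₀ := H.picard_bound hS
  obtain ⟨L, hL0, hL⟩ := hL (2 * K₀ + 1) (by positivity)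
  have hS0 : ∀ n, S (n + 1) 0 = y 0 := fun n => (hS.image n).start_eq hT
  -- Iteration starts from zero rather than `y`: values at time zero agree from index `1` on and
  -- derivatives from index `2` on, hence the shifts by `2`.
  have hS0' : ∀ n, S' (n + 2) 0 = S' (n + 3) 0 := fun n =>
    (hS.image (n + 1)).deriv_start_eq hT H.nonAnticipative (hS.image (n + 2))
      ((hS0 n).trans (hS0 (n + 1)).symm)
  have hgeo := geoBounded_ctrlNorm_sub H hL hL0 (Y := fun n => S (n + 2))
    (Z := fun n => S (n + 3)) (Y' := fun n => S' (n + 2)) (Z' := fun n => S' (n + 3))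
    (fun n => hS.image (n + 2)) (fun n => hS.image (n + 3))
    (fun n => by linarith [hSK (n + 2)]) (fun n => by linarith [hSK (n + 3)])
    (GeoBounded.zero.mono fun n => by simp [hS0]) (GeoBounded.zero.mono fun n => (by
      show ‖S' (n + 2) 0 - S' (n + 3) 0‖ ≤ 0
      rw [← hS0' n, sub_self, norm_zero]))
  have hSc : ∀ n, IsControlled p T X (S (n + 2)) (S' (n + 2)) := fun n => (hS.image (n + 2)).source
  obtain ⟨Y, Y', hY, hlim, hY0⟩ := exists_controlled_limit hp.le hT H.rough hSc
    (fun n => (hS0 (n + 1)).trans (hS0 (n + 2)).symm) hgeo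
  have hDc : ∀ n, IsControlled p T X (S (n + 2) - Y) (S' (n + 2) - Y') := fun n =>
    (hSc n).sub hp.le hY
  have hYK : ctrlNorm p X Y Y' 0 T ≤ K₀ := by
    have h1 : Tendsto (fun n => K₀ + ctrlNorm p X (S (n + 2) - Y) (S' (n + 2) - Y') 0 T) atTop
        (𝓝 (K₀ + 0)) := (hlim.tendsto_zero fun n => ctrlNorm_nonneg _ _ _ _ _ _).const_add K₀
    rw [add_zero] at h1
    refine ge_of_tendsto' h1 fun n => (ctrlNorm_le_add hp.le (hDc n) (hSc n)).trans ?_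
    exact add_le_add (hSK _) le_rfl
  -- It remains to see that the limit equals its image `Z`. One application of the Lipschitz bounds
  -- on the whole of `[0, T]`, with no smallness, shows that the iterates converge to `Z` as well.
  obtain ⟨Z, Z', hZ⟩ := exists_image hp H.lt_three H.pos H.rough H.start H.nonAnticipative hY
  have hgeoZ : GeoBounded fun n => ctrlNorm p X (S (n + 3) - Z) (S' (n + 3) - Z') 0 T := by
    refine (hlim.const_mul (c := intConst p d * L * roughNorm p X XX 0 T +
      L * (roughNorm p X XX 0 T + 1)) ?_).mono fun n => ?_
    · have := intConst_nonneg p d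
      have := roughNorm_nonneg p X XX 0 T
      positivity
    have hN := ctrlNorm_nonneg p X (S (n + 2) - Y) (S' (n + 2) - Y') 0 T
    have e0 : (S (n + 2) - Y) 0 = 0 := sub_eq_zero.2 (hY0 n)
    have e1 : S' (n + 3) 0 = Z' 0 :=
      (hS.image (n + 2)).deriv_start_eq hT H.nonAnticipative hZ (hY0 n)
    have r1 := (hS.image (n + 2)).var_remainder_sub_le H hL hL0 hZ
      (by linarith [hSK (n + 2)]) (by linarith) le_rfl H.pos le_rfl
      (B := ctrlNorm p X (S (n + 2) - Y) (S' (n + 2) - Y') 0 T) fun u hu => by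
        rw [e0, norm_zero, zero_add]
        exact (hDc n).ctrlNorm_mono hp0 le_rfl hu.2.le le_rfl
    have m1 := (hS.image (n + 2)).var_deriv_sub_le H hL hL0 hZ
      (by linarith [hSK (n + 2)]) (by linarith) le_rfl H.pos le_rfl hN
      fun a ha => ((hDc n).ctrlNorm_bounds hp0 le_rfl le_rfl le_rfl).1 a (Ico_subset_Icc_self ha)
    rw [e0, norm_zero, zero_add] at m1
    have k1 : var (p / 2) (remainder X (S (n + 2) - Y) (S' (n + 2) - Y')) 0 T ≤
        ctrlNorm p X (S (n + 2) - Y) (S' (n + 2) - Y') 0 T :=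
      le_add_of_nonneg_left (add_nonneg (norm_nonneg _) (var_nonneg _ _ _ _))
    have k2 : var p (incr X) 0 T ≤ roughNorm p X XX 0 T :=
      le_add_of_nonneg_right (var_nonneg _ _ _ _)
    have m2 : var p (incr (S' (n + 3) - Z')) 0 T ≤
        L * (ctrlNorm p X (S (n + 2) - Y) (S' (n + 2) - Y') 0 T * roughNorm p X XX 0 T +
          ctrlNorm p X (S (n + 2) - Y) (S' (n + 2) - Y') 0 T) := by
      refine m1.trans ?_
      gcongr
    have e2 : ‖(S' (n + 3) - Z') 0‖ = 0 := by simp [e1]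
    calc ctrlNorm p X (S (n + 3) - Z) (S' (n + 3) - Z') 0 T
        = ‖(S' (n + 3) - Z') 0‖ + var p (incr (S' (n + 3) - Z')) 0 T +
          var (p / 2) (remainder X (S (n + 3) - Z) (S' (n + 3) - Z')) 0 T := rfl
      _ ≤ 0 + L * (ctrlNorm p X (S (n + 2) - Y) (S' (n + 2) - Y') 0 T * roughNorm p X XX 0 T +
            ctrlNorm p X (S (n + 2) - Y) (S' (n + 2) - Y') 0 T) +
          intConst p d * (L * ctrlNorm p X (S (n + 2) - Y) (S' (n + 2) - Y') 0 T) *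
            roughNorm p X XX 0 T := add_le_add (add_le_add e2.le m2) r1
      _ = _ := by ring
  have hYZ : ctrlNorm p X (Y - Z) (Y' - Z') 0 T ≤ 0 := by
    refine ((hgeoZ.add hlim.succ).mono (g := fun _ => ctrlNorm p X (Y - Z) (Y' - Z') 0 T)
      fun n => ?_).const_le_zero
    have h1 := ctrlNorm_le_add hp.le
      (Z := S (n + 3) - Z) (Z' := S' (n + 3) - Z') (by
        rw [sub_sub_sub_cancel_right, sub_sub_sub_cancel_right]; exact hDc (n + 1))
      ((hSc (n + 1)).sub hp.le hZ.target)
    rw [sub_sub_sub_cancel_right, sub_sub_sub_cancel_right] at h1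
    exact h1
  obtain ⟨E1, E2⟩ := (hY.sub hp.le hZ.target).eqOn_of_ctrlNorm_sub hp.le H.rough
    (((hY0 0).symm.trans (hS0 1)).trans (hZ.start_eq hT).symm) hYZ
  refine ⟨Y, Y', ⟨hY, fun t ht => ?_, fun t ht => ?_⟩, hYK⟩
  · rw [E2 ht]; exact hZ.deriv_eq t ht
  · rw [E1 ht]; exact hZ.integral_eq t ht

end Solution

end RoughFDE
theorem theorem2p3 (p : ℝ) (hp₂ : 2 < p) (hp₃ : p < 3) (d k : ℕ) :
    ∃ K : ℝ → ℝ → ℝ → ℝ,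
      (∀ a b c : ℝ, 0 ≤ a → 0 ≤ b → 0 ≤ c → 0 ≤ K a b c) ∧
      (∀ a b c a' b' c' : ℝ, 0 ≤ a → 0 ≤ b → 0 ≤ c → a ≤ a' → b ≤ b' → c ≤ c' →
        K a b c ≤ K a' b' c') ∧
      ∀ (T : ℝ), 0 < T →
      ∀ (X : ℝ → RoughFDE.Vec d) (XX : ℝ → ℝ → RoughFDE.Mat d),
        RoughFDE.IsRoughPath p T X XX →
      ∀ (y : ℝ → RoughFDE.Vec k) (y' : ℝ → RoughFDE.Vec d →L[ℝ] RoughFDE.Vec k),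
        RoughFDE.IsControlled p T X y y' →
      ∀ (F : (ℝ → RoughFDE.Vec k) → ℝ → RoughFDE.Vec d →L[ℝ] RoughFDE.Vec k)
        (F' : (ℝ → RoughFDE.Vec k) → (ℝ → RoughFDE.Vec d →L[ℝ] RoughFDE.Vec k) →
          ℝ → RoughFDE.Vec d →L[ℝ] RoughFDE.Vec d →L[ℝ] RoughFDE.Vec k),
        RoughFDE.IsNonAnticipative p T X F F' →
      ∀ (CF : ℝ), 0 < CF → RoughFDE.GrowthCondition p T X F F' CF →
        (∀ L : ℝ, 0 < L → ∃ C : ℝ, 0 < C ∧ RoughFDE.LipschitzCondition p T X F F' L C) →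
      ∃ (Y : ℝ → RoughFDE.Vec k) (Y' : ℝ → RoughFDE.Vec d →L[ℝ] RoughFDE.Vec k),
        RoughFDE.IsSolution p T X F F' XX y y' Y Y' ∧
        (∀ Z Z', RoughFDE.IsSolution p T X F F' XX y y' Z Z' →
          Set.EqOn Z Y (Set.Icc 0 T) ∧ Set.EqOn Z' Y' (Set.Icc 0 T)) ∧
        RoughFDE.ctrlNorm p X Y Y' 0 T ≤
          K (RoughFDE.ctrlNorm p X y y' 0 T) CF (RoughFDE.roughNorm p X XX 0 T) := by
  refine ⟨RoughFDE.globalBound p d, fun a b c ha hb hc => RoughFDE.globalBound_nonneg ha hb hc,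
    fun a b c a' b' c' ha hb hc ha' hb' hc' =>
      RoughFDE.globalBound_mono (by linarith) ha hb hc ha' hb' hc', ?_⟩
  intro T hT X XX hX y y' hy F F' hF CF hCF hG hL
  have H : RoughFDE.IsBoundedEquation p T X XX F F' y y' CF :=
    ⟨hp₂, hp₃, hT, hX, hy, hF, hCF, hG⟩
  obtain ⟨Y, Y', hY, hK⟩ := H.exists_solution hL
  exact ⟨Y, Y', hY, fun Z Z' hZ => hZ.unique H hL hY, hK⟩
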